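/- Let $0<\alpha<1$, $\lambda\ge 0$, $\sigma>0$, $q>0$, $T>0$, $x_l<x_r$ and $\gamma\ge 1$. For a function $w$ on $[0,T]$ let $${}^{C}_0\mathbb{D}^{\alpha,\lambda}_{\tau}w(\tau)=\frac{e^{-\lambda\tau}}{\Gamma(1-\alpha)}\int_0^\tau (\tau-\eta)^{-\alpha}\,\frac{d}{d\eta}\big[e^{\lambda\eta}w(\eta)\big]\,d\eta .$$ Let $v$ be a solution of $${}^{C}_0\mathbb{D}^{\alpha,\lambda}_{\tau}v=\tfrac12\sigma^2 v_{xx}-qv+g \ \text{ on } (x_l,x_r)\times(0,T],\qquad v(x,0)=v_0(x)\ \ (x_l<x<x_r),\qquad v(x_l,\tau)=v(x_r,\tau)=0\ \ (0<\tau\le T),$$ where $g(\cdot,\tau)$ is continuous on $[x_l,x_r]$ for each $\tau\in(0,T]$ and $v(x,\cdot)$ is continuous on $[0,T]$ for each $x\in[x_l,x_r]$. Assume that $v(\cdot,\tau)\in C^6[x_l,x_r]$ for each $\tau\in(0,T]$, that $v(x,\cdot)\in C^2(0,T]$ for each $x\in[x_l,x_r]$, and that there is a constant $C$ such that, for all $(x,\tau)\in[x_l,x_r]\times(0,T]$,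 $$\left|\frac{\partial^p v}{\partial x^p}\right|\le C\ \ (p=0,\dots,4),\qquad \left|\frac{\partial^6 v}{\partial x^6}\right|\le C(1+\tau^{-\alpha}),\qquad \left|\frac{\partial^\ell v}{\partial \tau^\ell}\right|\le C(1+\tau^{\alpha-\ell})\ \ (\ell=0,1,2).$$ For positive integers $M,N$ put $\tau_n=T(n/M)^\gamma$, $h=(x_r-x_l)/N$, $x_i=x_l+ih$, and for grid functions let $$\delta_x^2w_i=\frac{w_{i+1}-2w_i+w_{i-1}}{h^2},\qquad \mathcal H_xw_i=w_i+\tfrac{h^2}{12}\delta_x^2w_i\ \ (1\le i\le N-1),$$ $$\mathcal D^{\alpha,\lambda}_\tau w^n=\frac{e^{-\lambda\tau_n}}{\Gamma(1-\alpha)}\sum_{k=1}^n a_k^{(n,\alpha)}\big(e^{\lambda\tau_k}w^k-e^{\lambda\tau_{k-1}}w^{k-1}\big),\qquad a_k^{(n,\alpha)}=\frac{1}{\tau_k-\tau_{k-1}}\int_{\tau_{k-1}}^{\tau_k}\frac{ds}{(\tau_n-s)^\alpha}.$$ Then there is a constant $c_2>0$, which may depend on the data and the solution of the problem (including $\alpha$)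 and on $\gamma$ but not on $M,N$, such that for all $M,N\ge1$ and every solution $\{v_i^n\}$ of the direct scheme $$\mathcal H_x\big(\mathcal D^{\alpha,\lambda}_\tau v_i^n\big)=\tfrac12\sigma^2\delta_x^2v_i^n-q\,\mathcal H_xv_i^n+\mathcal H_xg(x_i,\tau_n)\ \ (1\le i\le N-1,\ 1\le n\le M),$$ $$v_i^0=v_0(x_i)\ \ (1\le i\le N-1),\qquad v_0^n=v_N^n=0\ \ (0\le n\le M),$$ one has $$\max_{0\le i\le N}|v(x_i,\tau_n)-v_i^n|\le\Gamma(1-\alpha)\,c_2\big(M^{-\min\{\gamma\alpha,\,2-\alpha\}}+h^4\big),\qquad 0\le n\le M .$$ -/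

import Mathlib

open Set

noncomputable section

/-! ### The continuous problem -/

/-- The tempered Caputo derivative of order `α` with tempering parameter `lam`:
`e^{-lam τ} / Γ(1-α) * ∫_0^τ (τ-η)^{-α} * d/dη [e^{lam η} w(η)] dη`. -/
def temperedCaputo (α lam : ℝ) (w : ℝ → ℝ) (τ : ℝ) : ℝ :=
  Real.exp (-lam * τ) / Real.Gamma (1 - α) *
    ∫ η in (0 : ℝ)..τ, (τ - η) ^ (-α) * deriv (fun y => Real.exp (lam * y) * w y) η

/-- `v` solves the tempered time-fractional diffusion-reaction problem with homogeneous
boundary values on `(xl, xr) × (0, T]`, with source `g` and initial value `v₀`, and every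
`v(x, ·)` is continuous up to the initial time. -/
structure IsTemperedSolution (α lam σ q T xl xr : ℝ) (g : ℝ → ℝ → ℝ) (v₀ : ℝ → ℝ)
    (v : ℝ → ℝ → ℝ) : Prop where
  equation : ∀ x ∈ Ioo xl xr, ∀ τ ∈ Ioc 0 T,
    temperedCaputo α lam (v x) τ =
      σ ^ 2 / 2 * iteratedDeriv 2 (fun y => v y τ) x - q * v x τ + g x τ
  initial : ∀ x ∈ Ioo xl xr, v x 0 = v₀ x
  boundary_left : ∀ τ ∈ Ioc 0 T, v xl τ = 0
  boundary_right : ∀ τ ∈ Ioc 0 T, v xr τ = 0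
  continuous_time : ∀ x ∈ Icc xl xr, ContinuousOn (v x) (Icc 0 T)

/-- The regularity bounds on `[xl, xr] × (0, T]`; derivatives at the ends of the intervals are
one-sided. -/
structure RegularityBounds (α T xl xr : ℝ) (v : ℝ → ℝ → ℝ) : Prop where
  smooth_space : ∀ τ ∈ Ioc 0 T, ContDiffOn ℝ 6 (fun x => v x τ) (Icc xl xr)
  smooth_time : ∀ x ∈ Icc xl xr, ContDiffOn ℝ 2 (v x) (Ioc 0 T)
  bounds : ∃ C : ℝ, ∀ x ∈ Icc xl xr, ∀ τ ∈ Ioc 0 T,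
    (∀ p : ℕ, p ≤ 4 → |iteratedDerivWithin p (fun y => v y τ) (Icc xl xr) x| ≤ C) ∧
    |iteratedDerivWithin 6 (fun y => v y τ) (Icc xl xr) x| ≤ C * (1 + τ ^ (-α)) ∧
    (∀ l : ℕ, l ≤ 2 →
      |iteratedDerivWithin l (v x) (Ioc 0 T) τ| ≤ C * (1 + τ ^ (α - (l : ℝ))))

/-! ### The direct compact scheme -/

/-- The graded time levels `τ_n = T (n / M)^γ`. -/
def timeLevel (T γ : ℝ) (M n : ℕ) : ℝ := T * ((n : ℝ) / (M : ℝ)) ^ γ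

/-- The spatial grid size `h = (xr - xl) / N`. -/
def gridSize (xl xr : ℝ) (N : ℕ) : ℝ := (xr - xl) / (N : ℝ)

/-- The spatial grid nodes `x_i = xl + i h`. -/
def gridNode (xl xr : ℝ) (N i : ℕ) : ℝ := xl + (i : ℝ) * gridSize xl xr N

/-- The coefficients `a_k^{(n,α)} = (1 / Δτ_k) ∫_{τ_{k-1}}^{τ_k} (τ_n - s)^{-α} ds`,
for `1 ≤ k ≤ n`. -/
def l1Coeff (α T γ : ℝ) (M n k : ℕ) : ℝ :=
  (∫ s in (timeLevel T γ M (k - 1))..(timeLevel T γ M k), (timeLevel T γ M n - s) ^ (-α)) /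
    (timeLevel T γ M k - timeLevel T γ M (k - 1))

/-- The nonuniform tempered L1 formula at `τ_n`, for the time grid function `w`:
`e^{-lam τ_n} / Γ(1-α) * ∑_{k=1}^n a_k^{(n,α)} (u^k - u^{k-1})` with `u^k = e^{lam τ_k} w^k`. -/
def temperedL1 (α lam T γ : ℝ) (M : ℕ) (w : ℕ → ℝ) (n : ℕ) : ℝ :=
  Real.exp (-lam * timeLevel T γ M n) / Real.Gamma (1 - α) *
    ∑ k ∈ Finset.Icc 1 n, l1Coeff α T γ M n k *
      (Real.exp (lam * timeLevel T γ M k) * w k -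
        Real.exp (lam * timeLevel T γ M (k - 1)) * w (k - 1))

/-- The second central difference `δ_x² w_i`, for `i ≥ 1`. -/
def secondDiff (h : ℝ) (w : ℕ → ℝ) (i : ℕ) : ℝ := (w (i + 1) - 2 * w i + w (i - 1)) / h ^ 2

/-- The compact operator `H_x` on grid functions with indices `0, …, N`. -/
def compactOp (h : ℝ) (N : ℕ) (w : ℕ → ℝ) (i : ℕ) : ℝ :=
  if i = 0 ∨ i = N then w i else w i + h ^ 2 / 12 * secondDiff h w i

/-- The grid function `w i n` (space index `i`, time index `n`) solves the direct compact
scheme. Values outside `0 ≤ i ≤ N`, `0 ≤ n ≤ M` play no role. -/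
structure IsDirectSchemeSolution (α lam σ q T xl xr γ : ℝ) (g : ℝ → ℝ → ℝ) (v₀ : ℝ → ℝ)
    (M N : ℕ) (w : ℕ → ℕ → ℝ) : Prop where
  equation : ∀ i n : ℕ, 1 ≤ i → i < N → 1 ≤ n → n ≤ M →
    compactOp (gridSize xl xr N) N (fun j => temperedL1 α lam T γ M (w j) n) i =
      σ ^ 2 / 2 * secondDiff (gridSize xl xr N) (fun j => w j n) i
        - q * compactOp (gridSize xl xr N) N (fun j => w j n) i
        + compactOp (gridSize xl xr N) N
            (fun j => g (gridNode xl xr N j) (timeLevel T γ M n)) i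
  initial : ∀ i : ℕ, 1 ≤ i → i < N → w i 0 = v₀ (gridNode xl xr N i)
  boundary_left : ∀ n : ℕ, n ≤ M → w 0 n = 0
  boundary_right : ∀ n : ℕ, n ≤ M → w N n = 0

end

noncomputable section

/-! ### Summability from a Lorentzian bound -/

/-! The proof combines consistency with stability in the maximum norm, with no restriction on the
mesh ratio. Multiplying the error by `e^{lam τ_n}` turns the tempered L1 formula into a plain one
with weights `b n k`, nonnegative and increasing in `k`.

Stability. Let `H` be the compact operator, `A = -h² δ_x²` and `c = σ²/(2h²)`. When `(b n n + q)/12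
> c` the implicit matrix has positive off-diagonal entries and the maximum principle is lost. Put `E
= H e` and fix one large `s` for all time levels. The error equation becomes `E^n = K G^n`, where `K
= (1 + μ H⁻¹A/4)⁻¹`, `μ = 4c/s`, and `s G^n` is a combination with nonnegative coefficients of `E^n`
and the earlier `E^k`, plus the residual. The powers of `K` are bounded on bounded sequences
uniformly in the exponent and in `μ ≤ 1/3` (`summable_abs_resolventKernel`). Hence `sup_m ‖K^m x‖_∞`
is an equivalent norm in which `K` does not expand, and the usual maximum-principle induction runs
in that norm (`compact_scheme_stability`). Odd periodic extension carries the result to the grid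
(`grid_compact_scheme_stability`). Residuals of size `ρ * b n 1` are allowed, and `b n 1` dominates
`τ_n^{-α}/Γ(1-α)`.

The power bound is a Fourier estimate: the symbol of `K^m` is below a Gaussian of width
`(mμ)^{-1/2}`, and two integrations by parts give its kernel a Lorentzian majorant whose sum is
independent of `mμ`.

Consistency. On each time step the L1 error is the integral of a weight, shifted by any constant,
against the deviation of `u'` from its mean. The first step uses a Beta integral, the last the
integral of the weight, the others the increment of the weight. Summed on the graded mesh this gives
`τ_n^{-α} M^{-min(γα, 2-α)}` (`HasWeakSingularity.abs_truncation_error_le`). The compact difference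
costs `(1 + τ_n^{-α}) h^4` (`abs_compact_truncation_le`). Both carry the factor that stability
absorbs.

Since `H` also samples the source at the end points, the equation is needed there too.
`boundary_equation` obtains it by a limit from the interior, using the uniform accuracy of the L1
formula. -/

lemma div_sq_add_sq_le_arctan_sub {Y a b : ℝ} (hY : 0 < Y) (ha : 0 ≤ a) (hab : a < b) :
    (b - a) * (Y / (Y ^ 2 + b ^ 2)) ≤ Real.arctan (b / Y) - Real.arctan (a / Y) := by
  have hd : a / Y < b / Y := by gcongr
  obtain ⟨c, ⟨hc1, hc2⟩, hc⟩ := exists_hasDerivAt_eq_slope Real.arctan (fun x => 1 / (1 + x ^ 2)) hd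
    Real.continuous_arctan.continuousOn (fun x _ => Real.hasDerivAt_arctan x)
  have hc0 : 0 ≤ c := le_trans (by positivity) hc1.le
  have hpos : 0 < b / Y - a / Y := by linarith
  rw [eq_div_iff hpos.ne'] at hc
  rw [← hc]
  have h1 : c ^ 2 ≤ (b / Y) ^ 2 := by gcongr
  have h2 : (b - a) * (Y / (Y ^ 2 + b ^ 2)) = 1 / (1 + (b / Y) ^ 2) * (b / Y - a / Y) := by
    field_simp
  rw [h2]
  gcongr

lemma sum_div_sq_add_sq_le {Y : ℝ} (hY : 0 < Y) (n : ℕ) :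
    ∑ j ∈ Finset.range n, Y / (Y ^ 2 + ((j : ℝ) + 1) ^ 2) ≤ Real.pi / 2 := by
  have h : ∑ j ∈ Finset.range n, Y / (Y ^ 2 + ((j : ℝ) + 1) ^ 2) ≤ Real.arctan (n / Y) := by
    induction n with
    | zero => simp
    | succ n ih =>
      rw [Finset.sum_range_succ]
      have := div_sq_add_sq_le_arctan_sub hY (Nat.cast_nonneg n) (lt_add_one (n : ℝ))
      push_cast
      have h1 : ((n : ℝ) + 1 - n) = 1 := by ring
      rw [h1, one_mul] at this
      linarith
  exact h.trans (Real.arctan_lt_pi_div_two _).le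

/-- Comparison of the sum with the integral of the Lorentzian costs `π/2` on each half-line whatever
the width `Y`. The term at `0` is bounded separately, because the Lorentzian there is `C/Y`, which
is large for small `Y`. -/
lemma summable_abs_of_lorentzian {k : ℤ → ℝ} {Y C : ℝ} (hY : 0 < Y) (h0 : |k 0| ≤ 1)
    (heven : ∀ j, k (-j) = k j) (hk : ∀ j, |k j| * (Y ^ 2 + (j : ℝ) ^ 2) ≤ C * Y) :
    Summable (fun j => |k j|) ∧ ∑' j, |k j| ≤ 1 + Real.pi * C := by
  have hC : 0 ≤ C := nonneg_of_mul_nonneg_left (le_trans (by positivity) (hk 0)) hY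
  have hb : ∀ j : ℕ, |k (j + 1)| ≤ C * (Y / (Y ^ 2 + ((j : ℝ) + 1) ^ 2)) := by
    intro j
    have := hk (j + 1)
    push_cast at this
    rw [← mul_div_assoc, le_div_iff₀ (by positivity)]
    exact this
  have hs : ∀ n, ∑ j ∈ Finset.range n, |k (j + 1)| ≤ C * (Real.pi / 2) := by
    intro n
    calc _ ≤ ∑ j ∈ Finset.range n, C * (Y / (Y ^ 2 + ((j : ℝ) + 1) ^ 2)) :=
          Finset.sum_le_sum fun j _ => hb j
      _ = C * ∑ j ∈ Finset.range n, (Y / (Y ^ 2 + ((j : ℝ) + 1) ^ 2)) := by rw [Finset.mul_sum]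
      _ ≤ _ := by gcongr; exact sum_div_sq_add_sq_le hY n
  have hsum : Summable (fun j : ℕ => |k ((j : ℤ) + 1)|) :=
    summable_of_sum_range_le (fun _ => abs_nonneg _) hs
  have hle : ∑' j : ℕ, |k ((j : ℤ) + 1)| ≤ C * (Real.pi / 2) :=
    hsum.tsum_le_of_sum_range_le hs
  have hneg : (fun n : ℕ => |k (-((n : ℤ) + 1))|) = fun n : ℕ => |k ((n : ℤ) + 1)| :=
    funext fun n => by rw [heven]
  have hp : HasSum (fun n : ℕ => |k (n : ℤ)|) (∑' j : ℕ, |k ((j : ℤ) + 1)| + |k 0|) := by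
    rw [← hasSum_nat_add_iff' 1]
    simpa using hsum.hasSum
  have hsn : HasSum (fun n : ℕ => |k (-((n : ℤ) + 1))|) (∑' j : ℕ, |k ((j : ℤ) + 1)|) :=
    hneg ▸ hsum.hasSum
  have h := HasSum.of_nat_of_neg_add_one (f := fun j : ℤ => |k j|) hp hsn
  refine ⟨h.summable, ?_⟩
  rw [h.tsum_eq]
  linarith

/-! ### The powers of the resolvent symbol -/

/-- The symbol of `h² H⁻¹ A / 4`, where `A = -δ_x²` and `H` is the compact operator. -/
def compactSymbol (θ : ℝ) : ℝ := 3 * (1 - Real.cos θ) / (5 + Real.cos θ)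

/-- The symbol of the resolvent `(1 + μ h² H⁻¹ A / 4)⁻¹`. -/
def resolventSymbol (μ θ : ℝ) : ℝ := (1 + μ * compactSymbol θ)⁻¹

/-- The Fourier coefficients of the `m`-th power of the resolvent symbol. -/
def resolventKernel (μ : ℝ) (m : ℕ) (j : ℤ) : ℝ :=
  1 / Real.pi * ∫ θ in (0 : ℝ)..Real.pi, resolventSymbol μ θ ^ m * Real.cos (j * θ)

lemma five_add_cos_ge (θ : ℝ) : 4 ≤ 5 + Real.cos θ := by linarith [Real.neg_one_le_cos θ]

lemma compactSymbol_nonneg (θ : ℝ) : 0 ≤ compactSymbol θ := by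
  have := five_add_cos_ge θ
  have := Real.cos_le_one θ
  unfold compactSymbol
  apply div_nonneg <;> linarith

lemma compactSymbol_le (θ : ℝ) : compactSymbol θ ≤ 3 / 2 := by
  have := five_add_cos_ge θ
  have := Real.neg_one_le_cos θ
  unfold compactSymbol
  rw [div_le_iff₀ (by linarith)]
  linarith

lemma compactSymbol_ge {θ : ℝ} (h0 : 0 ≤ θ) (hπ : θ ≤ Real.pi) : θ ^ 2 / 10 ≤ compactSymbol θ := by
  have h5 := five_add_cos_ge θ
  have h1 := Real.cos_le_one θ
  have h2 := Real.cos_le_one_sub_mul_cos_sq (x := θ) (by rw [abs_of_nonneg h0]; exact hπ)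
  have hpi : Real.pi ^ 2 < 10 := by nlinarith [Real.pi_lt_d2, Real.pi_pos]
  have h3 : 2 / 10 * θ ^ 2 ≤ 2 / Real.pi ^ 2 * θ ^ 2 := by
    have := Real.pi_pos
    gcongr
  unfold compactSymbol
  rw [le_div_iff₀ (by linarith)]
  nlinarith [sq_nonneg θ]

lemma resolventSymbol_pos {μ : ℝ} (hμ : 0 ≤ μ) (θ : ℝ) : 0 < resolventSymbol μ θ := by
  have := mul_nonneg hμ (compactSymbol_nonneg θ)
  unfold resolventSymbol
  positivity

lemma resolventSymbol_le_one {μ : ℝ} (hμ : 0 ≤ μ) (θ : ℝ) : resolventSymbol μ θ ≤ 1 := by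
  have := mul_nonneg hμ (compactSymbol_nonneg θ)
  unfold resolventSymbol
  apply inv_le_one_of_one_le₀
  linarith

/-- The bound on `μ` keeps `x = μ * compactSymbol θ` below `1`, where `1/(1+x) ≤ 1 - x/2 ≤
e^{-x/2}`. The quadratic lower bound of the symbol then makes this Gaussian in `θ`. -/
lemma resolventSymbol_le_exp {μ θ : ℝ} (hμ : 0 ≤ μ) (hμ1 : μ ≤ 1 / 3) (h0 : 0 ≤ θ)
    (hπ : θ ≤ Real.pi) : resolventSymbol μ θ ≤ Real.exp (-(μ * θ ^ 2 / 20)) := by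
  set x := μ * compactSymbol θ with hx
  have hx0 : 0 ≤ x := mul_nonneg hμ (compactSymbol_nonneg θ)
  have hx1 : x ≤ 1 := by
    have := compactSymbol_le θ
    have := compactSymbol_nonneg θ
    nlinarith
  have h1 : resolventSymbol μ θ ≤ 1 - x / 2 := by
    unfold resolventSymbol
    rw [← hx, inv_le_iff_one_le_mul₀ (by linarith)]
    nlinarith
  have h2 : 1 - x / 2 ≤ Real.exp (-(x / 2)) := by linarith [Real.add_one_le_exp (-(x / 2))]
  refine h1.trans (h2.trans (Real.exp_le_exp.2 ?_))
  have := mul_le_mul_of_nonneg_left (compactSymbol_ge h0 hπ) hμ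
  linarith

lemma resolventSymbol_pow_le {μ θ : ℝ} (hμ : 0 ≤ μ) (hμ1 : μ ≤ 1 / 3) (h0 : 0 ≤ θ)
    (hπ : θ ≤ Real.pi) (m : ℕ) :
    resolventSymbol μ θ ^ m ≤ Real.exp (-(m * μ * θ ^ 2 / 20)) := by
  have := pow_le_pow_left₀ (resolventSymbol_pos hμ θ).le (resolventSymbol_le_exp hμ hμ1 h0 hπ) m
  rw [← Real.exp_nat_mul] at this
  refine this.trans (le_of_eq ?_)
  congr 1
  ring

lemma hasDerivAt_compactSymbol (θ : ℝ) :
    HasDerivAt compactSymbol (18 * Real.sin θ / (5 + Real.cos θ) ^ 2) θ := by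
  have h5 := five_add_cos_ge θ
  have h := (((Real.hasDerivAt_cos θ).const_sub 1).const_mul 3).div
    ((Real.hasDerivAt_cos θ).const_add 5) (by linarith)
  refine h.congr_deriv ?_
  congr 1
  ring

lemma hasDerivAt_compactSymbol_deriv (θ : ℝ) :
    HasDerivAt (fun θ => 18 * Real.sin θ / (5 + Real.cos θ) ^ 2)
      (18 * (Real.cos θ * (5 + Real.cos θ) + 2 * Real.sin θ ^ 2) / (5 + Real.cos θ) ^ 3) θ := by
  have h5 := five_add_cos_ge θ
  have h5' : 5 + Real.cos θ ≠ 0 := by linarith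
  have h := ((Real.hasDerivAt_sin θ).const_mul 18).div
    (((Real.hasDerivAt_cos θ).const_add 5).pow 2) (pow_ne_zero 2 h5')
  refine h.congr_deriv ?_
  simp only [Pi.pow_apply]
  rw [div_eq_div_iff (by positivity) (by positivity)]
  push_cast
  ring

lemma hasDerivAt_resolventSymbol {μ : ℝ} (hμ : 0 ≤ μ) (θ : ℝ) :
    HasDerivAt (resolventSymbol μ)
      (-(μ * (18 * Real.sin θ / (5 + Real.cos θ) ^ 2)) * resolventSymbol μ θ ^ 2) θ := by
  have hx0 : 0 ≤ μ * compactSymbol θ := mul_nonneg hμ (compactSymbol_nonneg θ)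
  have h := (((hasDerivAt_compactSymbol θ).const_mul μ).const_add 1).inv (by positivity)
  refine h.congr_deriv ?_
  unfold resolventSymbol
  field_simp

lemma hasDerivAt_resolventSymbol_pow {μ : ℝ} (hμ : 0 ≤ μ) (m : ℕ) (θ : ℝ) :
    HasDerivAt (fun θ => resolventSymbol μ θ ^ m)
      (-(m * μ) * (18 * Real.sin θ / (5 + Real.cos θ) ^ 2) * resolventSymbol μ θ ^ (m + 1)) θ := by
  have h := (hasDerivAt_resolventSymbol hμ θ).pow m
  refine h.congr_deriv ?_
  rcases m with _ | m
  · simp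
  · simp only [Nat.add_sub_cancel]
    ring

/-- The second derivative of the `m`-th power of the resolvent symbol. -/
def resolventSymbolPowDeriv2 (μ : ℝ) (m : ℕ) (θ : ℝ) : ℝ :=
  m * (m + 1) * μ ^ 2 * (18 * Real.sin θ / (5 + Real.cos θ) ^ 2) ^ 2 * resolventSymbol μ θ ^ (m + 2)
  - m * μ * (18 * (Real.cos θ * (5 + Real.cos θ) + 2 * Real.sin θ ^ 2) / (5 + Real.cos θ) ^ 3)
      * resolventSymbol μ θ ^ (m + 1)

lemma hasDerivAt_resolventSymbol_pow_deriv {μ : ℝ} (hμ : 0 ≤ μ) (m : ℕ) (θ : ℝ) :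
    HasDerivAt (fun θ => -(m * μ) * (18 * Real.sin θ / (5 + Real.cos θ) ^ 2) *
        resolventSymbol μ θ ^ (m + 1))
      (resolventSymbolPowDeriv2 μ m θ) θ := by
  have h := ((hasDerivAt_compactSymbol_deriv θ).const_mul (-(m * μ))).mul
    (hasDerivAt_resolventSymbol_pow hμ (m + 1) θ)
  refine h.congr_deriv ?_
  unfold resolventSymbolPowDeriv2
  push_cast
  ring

lemma continuous_resolventSymbol {μ : ℝ} (hμ : 0 ≤ μ) : Continuous (resolventSymbol μ) :=
  continuous_iff_continuousAt.2 fun θ => (hasDerivAt_resolventSymbol hμ θ).continuousAt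

lemma continuous_resolventSymbolPowDeriv2 {μ : ℝ} (hμ : 0 ≤ μ) (m : ℕ) :
    Continuous (resolventSymbolPowDeriv2 μ m) := by
  have h := continuous_resolventSymbol hμ
  have h5 : ∀ θ, 5 + Real.cos θ ≠ 0 := fun θ => by linarith [five_add_cos_ge θ]
  unfold resolventSymbolPowDeriv2
  fun_prop (disch := first | exact h5 _ | (intro x; exact pow_ne_zero _ (h5 x)))

lemma abs_resolventSymbolPowDeriv2_le {μ θ : ℝ} (hμ : 0 ≤ μ) (hμ1 : μ ≤ 1 / 3) (h0 : 0 ≤ θ)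
    (hπ : θ ≤ Real.pi) (m : ℕ) :
    |resolventSymbolPowDeriv2 μ m θ| ≤ 323 * (m * μ) * Real.exp (-(m * μ / 40) * θ ^ 2) := by
  set X : ℝ := m * μ with hX
  have hX0 : 0 ≤ X := by positivity
  have h5 := five_add_cos_ge θ
  have hc := Real.cos_le_one θ
  have hs : |Real.sin θ| ≤ θ := by
    simpa [abs_of_nonneg h0] using Real.abs_sin_le_abs (x := θ)
  have hG := resolventSymbol_pow_le hμ hμ1 h0 hπ m
  have hG0 := resolventSymbol_pos hμ θ
  have hG1 := resolventSymbol_le_one hμ θ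
  set E := Real.exp (-(m * μ * θ ^ 2 / 20))
  have hE1 : resolventSymbol μ θ ^ (m + 1) ≤ E :=
    (pow_le_pow_of_le_one hG0.le hG1 (Nat.le_succ m)).trans hG
  have hE2 : resolventSymbol μ θ ^ (m + 2) ≤ E :=
    (pow_le_pow_of_le_one hG0.le hG1 (by omega)).trans hG
  have hb1 : |18 * Real.sin θ / (5 + Real.cos θ) ^ 2| ≤ 2 * θ := by
    rw [abs_div, abs_mul, abs_of_nonneg (sq_nonneg (5 + Real.cos θ)), div_le_iff₀ (by positivity)]
    norm_num
    have : (16 : ℝ) ≤ (5 + Real.cos θ) ^ 2 := by nlinarith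
    nlinarith
  have hb2 : |18 * (Real.cos θ * (5 + Real.cos θ) + 2 * Real.sin θ ^ 2) / (5 + Real.cos θ) ^ 3| ≤ 3 := by
    rw [abs_div, abs_of_pos (show 0 < (5 + Real.cos θ) ^ 3 by positivity),
      div_le_iff₀ (by positivity), abs_le, Real.sin_sq]
    have h4 := Real.neg_one_le_cos θ
    have : (64 : ℝ) ≤ (5 + Real.cos θ) ^ 3 := by
      calc (64 : ℝ) = 4 ^ 3 := by norm_num
        _ ≤ _ := by gcongr
    constructor <;> nlinarith
  have hm : (m : ℝ) * (m + 1) * μ ^ 2 ≤ 2 * X ^ 2 := by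
    rw [hX]
    have : (m : ℝ) * (m + 1) ≤ 2 * m ^ 2 := by
      rcases Nat.eq_zero_or_pos m with h | h
      · simp [h]
      · have : (1 : ℝ) ≤ m := by exact_mod_cast h
        nlinarith
    nlinarith [sq_nonneg μ]
  -- Half of the Gaussian exponent is spent on absorbing the factor `X θ²`, through `z e^{-z} ≤ 1`.
  -- The final constant is `323 = 8 * 40 + 3`.
  have hzE : X * θ ^ 2 * E ≤ 40 * Real.exp (-(m * μ / 40) * θ ^ 2) := by
    set z := X * θ ^ 2 / 40 with hz
    have h1 : E = Real.exp (-z) * Real.exp (-z) := by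
      rw [← Real.exp_add, hz, hX]; simp only [E]; congr 1; ring
    have h2 : Real.exp (-(m * μ / 40) * θ ^ 2) = Real.exp (-z) := by
      congr 1; rw [hz, hX]; ring
    have h3 : z * Real.exp (-z) ≤ 1 := by
      rw [Real.exp_neg, ← div_eq_mul_inv, div_le_one (Real.exp_pos z)]
      linarith [Real.add_one_le_exp z]
    have h4 : X * θ ^ 2 = 40 * z := by rw [hz]; ring
    rw [h1, h2, h4]
    have := Real.exp_pos (-z)
    nlinarith
  have hE' : E ≤ Real.exp (-(m * μ / 40) * θ ^ 2) := by
    apply Real.exp_le_exp.2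
    have : 0 ≤ m * μ * θ ^ 2 := by positivity
    linarith
  have hE0 : 0 < E := Real.exp_pos _
  have t1 : |(m : ℝ) * (m + 1) * μ ^ 2 * (18 * Real.sin θ / (5 + Real.cos θ) ^ 2) ^ 2 *
      resolventSymbol μ θ ^ (m + 2)| ≤ 2 * X ^ 2 * (2 * θ) ^ 2 * E := by
    rw [abs_mul, abs_mul, abs_pow _ 2, abs_of_pos (pow_pos hG0 _),
      abs_of_nonneg (show (0 : ℝ) ≤ m * (m + 1) * μ ^ 2 by positivity)]
    gcongr
  have t2 : |m * μ * (18 * (Real.cos θ * (5 + Real.cos θ) + 2 * Real.sin θ ^ 2) /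
      (5 + Real.cos θ) ^ 3) * resolventSymbol μ θ ^ (m + 1)| ≤ X * 3 * E := by
    rw [abs_mul, abs_mul, abs_of_pos (pow_pos hG0 _), ← hX, abs_of_nonneg hX0]
    gcongr
  unfold resolventSymbolPowDeriv2
  refine (abs_sub _ _).trans ?_
  calc _ ≤ 2 * X ^ 2 * (2 * θ) ^ 2 * E + X * 3 * E := add_le_add t1 t2
    _ = 8 * X * (X * θ ^ 2 * E) + 3 * X * E := by ring
    _ ≤ 8 * X * (40 * Real.exp (-(m * μ / 40) * θ ^ 2)) +
        3 * X * Real.exp (-(m * μ / 40) * θ ^ 2) := by gcongr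
    _ = _ := by ring

lemma integral_exp_neg_mul_sq_le {X : ℝ} (hX : 0 < X) :
    ∫ θ in (0 : ℝ)..Real.pi, Real.exp (-(X / 40) * θ ^ 2) ≤ 6 / √X := by
  have h1 : ∫ θ in (0 : ℝ)..Real.pi, Real.exp (-(X / 40) * θ ^ 2) ≤
      ∫ θ in Ioi (0 : ℝ), Real.exp (-(X / 40) * θ ^ 2) := by
    rw [intervalIntegral.integral_of_le Real.pi_pos.le]
    apply MeasureTheory.setIntegral_mono_set
    · exact (integrable_exp_neg_mul_sq (by positivity)).integrableOn
    · exact Filter.Eventually.of_forall fun _ => (Real.exp_pos _).le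
    · exact Filter.Eventually.of_forall fun x hx => hx.1
  refine h1.trans ?_
  rw [integral_gaussian_Ioi, div_le_iff₀ (by norm_num), Real.sqrt_le_left (by positivity),
    div_mul_eq_mul_div, div_pow, mul_pow, Real.sq_sqrt hX.le, div_div_eq_mul_div]
  rw [div_le_div_iff_of_pos_right hX]
  linarith [Real.pi_lt_d2]

/-- Both boundary terms vanish: the first through `sin (jπ) = 0`, the second because the derivative
of the symbol contains the factor `sin θ`. -/
lemma integral_resolventSymbol_by_parts {μ : ℝ} (hμ : 0 ≤ μ) (m : ℕ) (j : ℤ) :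
    (j : ℝ) ^ 2 * ∫ θ in (0 : ℝ)..Real.pi, resolventSymbol μ θ ^ m * Real.cos (j * θ) =
      - ∫ θ in (0 : ℝ)..Real.pi, resolventSymbolPowDeriv2 μ m θ * Real.cos (j * θ) := by
  have h5 : ∀ θ, 5 + Real.cos θ ≠ 0 := fun θ => by linarith [five_add_cos_ge θ]
  have hc := continuous_resolventSymbol hμ
  have hsin : ∀ θ : ℝ, HasDerivAt (fun θ => Real.sin (j * θ)) (j * Real.cos (j * θ)) θ := by
    intro θ
    have := ((hasDerivAt_id θ).const_mul (j : ℝ)).sin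
    refine this.congr_deriv ?_
    simp; ring
  have hcos : ∀ θ : ℝ, HasDerivAt (fun θ => -Real.cos (j * θ)) (j * Real.sin (j * θ)) θ := by
    intro θ
    have := ((hasDerivAt_id θ).const_mul (j : ℝ)).cos.neg
    refine this.congr_deriv ?_
    simp; ring
  have hc1 : Continuous (fun θ => -(m * μ) * (18 * Real.sin θ / (5 + Real.cos θ) ^ 2) *
      resolventSymbol μ θ ^ (m + 1)) :=
    continuous_iff_continuousAt.2 fun θ =>
      (hasDerivAt_resolventSymbol_pow_deriv hμ m θ).continuousAt
  have i1 := intervalIntegral.integral_mul_deriv_eq_deriv_mul (a := 0) (b := Real.pi)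
    (fun θ _ => hasDerivAt_resolventSymbol_pow hμ m θ) (fun θ _ => hsin θ)
    (hc1.intervalIntegrable _ _) ((by fun_prop : Continuous fun θ : ℝ =>
      (j : ℝ) * Real.cos (j * θ)).intervalIntegrable _ _)
  have i2 := intervalIntegral.integral_mul_deriv_eq_deriv_mul (a := 0) (b := Real.pi)
    (fun θ _ => hasDerivAt_resolventSymbol_pow_deriv hμ m θ) (fun θ _ => hcos θ)
    ((continuous_resolventSymbolPowDeriv2 hμ m).intervalIntegrable _ _)
    ((by fun_prop : Continuous fun θ : ℝ =>
      (j : ℝ) * Real.sin (j * θ)).intervalIntegrable _ _)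
  simp only [Real.sin_int_mul_pi, mul_zero, Real.sin_zero, Real.sin_pi, zero_div, sub_zero,
    zero_mul, zero_sub] at i1 i2
  have e1 : ∀ θ : ℝ, resolventSymbol μ θ ^ m * (j * Real.cos (j * θ)) =
      j * (resolventSymbol μ θ ^ m * Real.cos (j * θ)) := fun θ => by ring
  have e2 : ∀ θ : ℝ, -(m * μ) * (18 * Real.sin θ / (5 + Real.cos θ) ^ 2) *
      resolventSymbol μ θ ^ (m + 1) * (j * Real.sin (j * θ)) =
      j * (-(m * μ) * (18 * Real.sin θ / (5 + Real.cos θ) ^ 2) *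
      resolventSymbol μ θ ^ (m + 1) * Real.sin (j * θ)) := fun θ => by ring
  simp only [e1, e2, intervalIntegral.integral_const_mul, mul_neg,
    intervalIntegral.integral_neg, neg_neg] at i1 i2
  rw [pow_two, mul_assoc, i1, mul_neg, i2]

/-- With `X = mμ`, the Gaussian bound gives `6/√X` for the coefficient, and the second derivative
gives `323 X * 6/√X` for `j²` times it. Adding `X` times the former to the latter produces `(1 +
323) * 6 = 1944`. -/
lemma abs_resolventKernel_mul_le {μ : ℝ} (hμ : 0 < μ) (hμ1 : μ ≤ 1 / 3) {m : ℕ} (hm : 0 < m)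
    (j : ℤ) : |resolventKernel μ m j| * (√(m * μ) ^ 2 + (j : ℝ) ^ 2) ≤ 1944 * √(m * μ) := by
  set X : ℝ := m * μ with hX
  have hX0 : 0 < X := by positivity
  have hsq : 0 < √X := Real.sqrt_pos.2 hX0
  have hpi := Real.pi_gt_three
  set I := ∫ θ in (0 : ℝ)..Real.pi, resolventSymbol μ θ ^ m * Real.cos (j * θ) with hI
  have hk : |resolventKernel μ m j| ≤ |I| := by
    unfold resolventKernel
    rw [abs_mul, ← hI, abs_of_pos (by positivity)]
    apply mul_le_of_le_one_left (abs_nonneg _)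
    rw [div_le_one (by positivity)]
    linarith
  have hcont : Continuous fun θ : ℝ => Real.exp (-(X / 40) * θ ^ 2) := by fun_prop
  have hJ := integral_exp_neg_mul_sq_le hX0
  have h1 : |I| ≤ 6 / √X := by
    refine le_trans ?_ hJ
    rw [hI, ← Real.norm_eq_abs]
    refine intervalIntegral.norm_integral_le_of_norm_le (μ := MeasureTheory.volume) Real.pi_pos.le
      (Filter.Eventually.of_forall fun θ hθ => ?_) (hcont.intervalIntegrable _ _)
    rw [Real.norm_eq_abs, abs_mul, abs_of_pos (pow_pos (resolventSymbol_pos hμ.le θ) _)]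
    have a1 := resolventSymbol_pow_le hμ.le hμ1 hθ.1.le hθ.2 m
    have a2 := Real.abs_cos_le_one (j * θ)
    have a3 : Real.exp (-(m * μ * θ ^ 2 / 20)) ≤ Real.exp (-(X / 40) * θ ^ 2) := by
      apply Real.exp_le_exp.2
      have : 0 ≤ X * θ ^ 2 := by positivity
      rw [← hX]; linarith
    calc _ ≤ resolventSymbol μ θ ^ m * 1 := by
          gcongr
          exact (pow_pos (resolventSymbol_pos hμ.le θ) _).le
      _ ≤ _ := by rw [mul_one]; exact a1.trans a3
  have h2 : (j : ℝ) ^ 2 * |I| ≤ 323 * X * (6 / √X) := by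
    have : (j : ℝ) ^ 2 * |I| =
        |∫ θ in (0 : ℝ)..Real.pi, resolventSymbolPowDeriv2 μ m θ * Real.cos (j * θ)| := by
      rw [← abs_of_nonneg (sq_nonneg (j : ℝ)), ← abs_mul, hI,
        integral_resolventSymbol_by_parts hμ.le, abs_neg]
    rw [this]
    calc _ ≤ ∫ θ in (0 : ℝ)..Real.pi, 323 * X * Real.exp (-(X / 40) * θ ^ 2) := by
          rw [← Real.norm_eq_abs]
          refine intervalIntegral.norm_integral_le_of_norm_le (μ := MeasureTheory.volume)
            Real.pi_pos.le (Filter.Eventually.of_forall fun θ hθ => ?_)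
            ((hcont.const_mul (323 * X)).intervalIntegrable _ _)
          rw [Real.norm_eq_abs, abs_mul]
          have a1 := abs_resolventSymbolPowDeriv2_le hμ.le hμ1 hθ.1.le hθ.2 m
          have a2 := Real.abs_cos_le_one (j * θ)
          calc _ ≤ |resolventSymbolPowDeriv2 μ m θ| * 1 := by gcongr
            _ ≤ _ := by rw [mul_one]; exact a1
      _ = 323 * X * ∫ θ in (0 : ℝ)..Real.pi, Real.exp (-(X / 40) * θ ^ 2) := by
          rw [intervalIntegral.integral_const_mul]
      _ ≤ _ := by gcongr
  have hXX : X = √X * √X := (Real.mul_self_sqrt hX0.le).symm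
  calc |resolventKernel μ m j| * (√X ^ 2 + (j : ℝ) ^ 2)
      ≤ |I| * (√X ^ 2 + (j : ℝ) ^ 2) := by gcongr
    _ = √X ^ 2 * |I| + (j : ℝ) ^ 2 * |I| := by ring
    _ ≤ √X ^ 2 * (6 / √X) + 323 * X * (6 / √X) := by gcongr
    _ = 1944 * √X := by
        rw [Real.sq_sqrt hX0.le, ← add_mul]
        nth_rewrite 1 2 [hXX]
        field_simp
        ring

lemma resolventKernel_zero (μ : ℝ) (j : ℤ) : resolventKernel μ 0 j = if j = 0 then 1 else 0 := by
  unfold resolventKernel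
  have hpi := Real.pi_pos.ne'
  split_ifs with h
  · subst h; simp [hpi]
  · have hj : (j : ℝ) ≠ 0 := by exact_mod_cast h
    simp [intervalIntegral.integral_comp_mul_left (fun x => Real.cos x) hj]

lemma resolventKernel_neg (μ : ℝ) (m : ℕ) (j : ℤ) :
    resolventKernel μ m (-j) = resolventKernel μ m j := by
  simp [resolventKernel]

lemma abs_resolventKernel_le_one {μ : ℝ} (hμ : 0 ≤ μ) (m : ℕ) (j : ℤ) :
    |resolventKernel μ m j| ≤ 1 := by
  have hpi := Real.pi_pos
  unfold resolventKernel
  rw [abs_mul, abs_of_pos (by positivity), one_div, inv_mul_le_iff₀ hpi, mul_one]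
  have := intervalIntegral.norm_integral_le_of_norm_le_const (a := 0) (b := Real.pi) (C := 1)
    (f := fun θ => resolventSymbol μ θ ^ m * Real.cos (j * θ)) (fun θ _ => by
      rw [Real.norm_eq_abs, abs_mul, abs_of_pos (pow_pos (resolventSymbol_pos hμ θ) _)]
      exact mul_le_one₀ (pow_le_one₀ (resolventSymbol_pos hμ θ).le (resolventSymbol_le_one hμ θ))
        (abs_nonneg _) (Real.abs_cos_le_one _))
  simpa [abs_of_pos hpi] using this

theorem summable_abs_resolventKernel {μ : ℝ} (hμ : 0 < μ) (hμ1 : μ ≤ 1 / 3) (m : ℕ) :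
    Summable (fun j => |resolventKernel μ m j|) ∧
      ∑' j, |resolventKernel μ m j| ≤ 1 + Real.pi * 1944 := by
  rcases Nat.eq_zero_or_pos m with rfl | hm
  · refine summable_abs_of_lorentzian (Y := 1) one_pos (abs_resolventKernel_le_one hμ.le _ _)
      (resolventKernel_neg μ 0) fun j => ?_
    rw [resolventKernel_zero]
    split_ifs with h <;> simp [h]
  · have : (0 : ℝ) < m * μ := by positivity
    exact summable_abs_of_lorentzian (Real.sqrt_pos.2 this) (abs_resolventKernel_le_one hμ.le _ _)
      (resolventKernel_neg μ m) (abs_resolventKernel_mul_le hμ hμ1 hm)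

/-! ### Three-point operators on two-sided sequences -/

/-- The symmetric three-point operator with weights `B, A, B`. -/
def threePoint (A B : ℝ) (f : ℤ → ℝ) (j : ℤ) : ℝ := A * f j + B * (f (j + 1) + f (j - 1))

/-- This is `(H + μA/4) K^{m+1} = H K^m` on kernels. A three-point operator multiplies the symbol by
`A + 2B cos θ`, and the resolvent symbol is the quotient of the two multipliers. -/
lemma resolventKernel_succ {μ : ℝ} (hμ : 0 ≤ μ) (m : ℕ) (j : ℤ) :
    threePoint (5 / 6 + μ / 2) (1 / 12 - μ / 4) (resolventKernel μ (m + 1)) j =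
      threePoint (5 / 6) (1 / 12) (resolventKernel μ m) j := by
  have hc := continuous_resolventSymbol hμ
  have hi : ∀ (m : ℕ) (c : ℝ), IntervalIntegrable
      (fun θ => resolventSymbol μ θ ^ m * Real.cos (c * θ)) MeasureTheory.volume 0 Real.pi :=
    fun m c => Continuous.intervalIntegrable (by fun_prop) _ _
  have key : ∀ (m : ℕ) (A B : ℝ), A * resolventKernel μ m j +
      B * (resolventKernel μ m (j + 1) + resolventKernel μ m (j - 1)) =
      1 / Real.pi * ∫ θ in (0 : ℝ)..Real.pi,
        (A + 2 * B * Real.cos θ) * (resolventSymbol μ θ ^ m * Real.cos (j * θ)) := by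
    intro m A B
    unfold resolventKernel
    have e : ∀ θ : ℝ, (A + 2 * B * Real.cos θ) * (resolventSymbol μ θ ^ m * Real.cos (j * θ)) =
        A * (resolventSymbol μ θ ^ m * Real.cos (j * θ)) +
        B * (resolventSymbol μ θ ^ m * Real.cos (((j + 1 : ℤ) : ℝ) * θ) +
          resolventSymbol μ θ ^ m * Real.cos (((j - 1 : ℤ) : ℝ) * θ)) := by
      intro θ
      have e1 : ((j + 1 : ℤ) : ℝ) * θ = j * θ + θ := by push_cast; ring
      have e2 : ((j - 1 : ℤ) : ℝ) * θ = j * θ - θ := by push_cast; ring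
      rw [e1, e2, Real.cos_add, Real.cos_sub]
      ring
    simp only [e]
    rw [intervalIntegral.integral_add ((hi _ _).const_mul _) (((hi _ _).add (hi _ _)).const_mul _),
      intervalIntegral.integral_const_mul, intervalIntegral.integral_const_mul,
      intervalIntegral.integral_add (hi _ _) (hi _ _)]
    ring
  have h1 := key (m + 1) (5 / 6 + μ / 2) (1 / 12 - μ / 4)
  have h2 := key m (5 / 6) (1 / 12)
  have h3 : ∀ θ : ℝ, (5 / 6 + μ / 2 + 2 * (1 / 12 - μ / 4) * Real.cos θ) *
      (resolventSymbol μ θ ^ (m + 1) * Real.cos (j * θ)) =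
      (5 / 6 + 2 * (1 / 12) * Real.cos θ) * (resolventSymbol μ θ ^ m * Real.cos (j * θ)) := by
    intro θ
    have h5 := five_add_cos_ge θ
    have hx0 : 0 ≤ μ * compactSymbol θ := mul_nonneg hμ (compactSymbol_nonneg θ)
    have : (5 / 6 + μ / 2 + 2 * (1 / 12 - μ / 4) * Real.cos θ) * resolventSymbol μ θ =
        5 / 6 + 2 * (1 / 12) * Real.cos θ := by
      unfold resolventSymbol
      rw [← div_eq_mul_inv, div_eq_iff (by positivity)]
      unfold compactSymbol
      have : 5 + Real.cos θ ≠ 0 := by linarith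
      field_simp
      ring
    rw [pow_succ, ← this]
    ring
  simp only [h3] at h1
  unfold threePoint
  linarith

/-! ### Convolution with bounded sequences -/

/-- The convolution of two-sided sequences. -/
def convZ (k f : ℤ → ℝ) (j : ℤ) : ℝ := ∑' i, k i * f (j - i)

section Convolution

variable {k f g : ℤ → ℝ} {B B' : ℝ}

lemma summable_convZ (hk : Summable fun i => |k i|) (hf : ∀ i, |f i| ≤ B) (j : ℤ) :
    Summable fun i => k i * f (j - i) := by
  refine Summable.of_norm_bounded (hk.mul_right B) fun i => ?_
  rw [Real.norm_eq_abs, abs_mul]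
  exact mul_le_mul_of_nonneg_left (hf _) (abs_nonneg _)

lemma abs_convZ_le (hk : Summable fun i => |k i|) (hf : ∀ i, |f i| ≤ B) (j : ℤ) :
    |convZ k f j| ≤ (∑' i, |k i|) * B := by
  rw [← tsum_mul_right]
  refine tsum_of_norm_bounded (f := fun i => k i * f (j - i)) (hk.mul_right B).hasSum fun i => ?_
  rw [Real.norm_eq_abs, abs_mul]
  exact mul_le_mul_of_nonneg_left (hf _) (abs_nonneg _)

lemma convZ_add (hk : Summable fun i => |k i|) (hf : ∀ i, |f i| ≤ B) (hg : ∀ i, |g i| ≤ B')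
    (j : ℤ) : convZ k (fun i => f i + g i) j = convZ k f j + convZ k g j := by
  unfold convZ
  rw [← (summable_convZ hk hf j).tsum_add (summable_convZ hk hg j)]
  simp only [mul_add]

lemma convZ_const_mul (k f : ℤ → ℝ) (c : ℝ) (j : ℤ) :
    convZ k (fun i => c * f i) j = c * convZ k f j := by
  unfold convZ
  rw [← tsum_mul_left]
  exact tsum_congr fun i => by ring

lemma convZ_sum {ι : Type*} (hk : Summable fun i => |k i|) (s : Finset ι) {F : ι → ℤ → ℝ}
    (hF : ∀ a ∈ s, ∀ i, |F a i| ≤ B) (j : ℤ) :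
    convZ k (fun i => ∑ a ∈ s, F a i) j = ∑ a ∈ s, convZ k (F a) j := by
  unfold convZ
  rw [← Summable.tsum_finsetSum fun a ha => summable_convZ hk (hF a ha) j]
  simp only [Finset.mul_sum]

lemma convZ_threePoint (hk : Summable fun i => |k i|) (hf : ∀ i, |f i| ≤ B) (A C : ℝ) (j : ℤ) :
    convZ k (threePoint A C f) j = threePoint A C (convZ k f) j := by
  have h1 := summable_convZ hk hf
  have e : ∀ i, k i * threePoint A C f (j - i) =
      A * (k i * f (j - i)) + C * (k i * f (j + 1 - i) + k i * f (j - 1 - i)) := by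
    intro i
    unfold threePoint
    rw [show j - i + 1 = j + 1 - i by ring, show j - i - 1 = j - 1 - i by ring]
    ring
  unfold threePoint convZ
  rw [← (h1 (j + 1)).tsum_add (h1 (j - 1)), ← tsum_mul_left, ← tsum_mul_left,
    ← ((h1 j).mul_left A).tsum_add (((h1 (j + 1)).add (h1 (j - 1))).mul_left C)]
  exact tsum_congr e

lemma threePoint_convZ (hk : Summable fun i => |k i|) (hf : ∀ i, |f i| ≤ B) (A C : ℝ) (j : ℤ) :
    threePoint A C (convZ k f) j = convZ (threePoint A C k) f j := by
  have h1 := summable_convZ hk hf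
  have s1 : Summable fun i => k (i + 1) * f (j - i) := by
    refine ((Equiv.addRight (1 : ℤ)).summable_iff.2 (h1 (j + 1))).congr fun i => ?_
    simp only [Function.comp, Equiv.coe_addRight]
    congr 2; ring
  have s2 : Summable fun i => k (i - 1) * f (j - i) := by
    refine ((Equiv.subRight (1 : ℤ)).summable_iff.2 (h1 (j - 1))).congr fun i => ?_
    simp only [Function.comp, Equiv.subRight_apply]
    congr 2; ring
  have t1 : convZ k f (j + 1) = ∑' i, k (i + 1) * f (j - i) := by
    unfold convZ
    rw [← (Equiv.addRight (1 : ℤ)).tsum_eq]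
    refine tsum_congr fun i => ?_
    simp only [Equiv.coe_addRight]
    congr 2; ring
  have t2 : convZ k f (j - 1) = ∑' i, k (i - 1) * f (j - i) := by
    unfold convZ
    rw [← (Equiv.subRight (1 : ℤ)).tsum_eq]
    refine tsum_congr fun i => ?_
    simp only [Equiv.subRight_apply]
    congr 2; ring
  unfold threePoint
  rw [t1, t2]
  unfold convZ
  rw [← s1.tsum_add s2, ← tsum_mul_left, ← tsum_mul_left,
    ← ((h1 j).mul_left A).tsum_add ((s1.add s2).mul_left C)]
  exact tsum_congr fun i => by ring

end Convolution

/-! ### Self-improving bounds -/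

/-- Replaces evaluation at a maximum point, which need not exist on an infinite index set. The bound
`B` serves only to make the supremum finite and does not enter the result. -/
lemma abs_le_of_self_improving {ι : Type*} [Nonempty ι] {g : ι → ℝ} {B t c : ℝ}
    (hB : ∀ i, |g i| ≤ B) (ht : t < 1)
    (h : ∀ X, (∀ i, |g i| ≤ X) → ∀ i, |g i| ≤ t * X + c) (i : ι) : |g i| ≤ c / (1 - t) := by
  have hbdd : BddAbove (range fun i => |g i|) := ⟨B, by rintro _ ⟨i, rfl⟩; exact hB i⟩
  have h1 : ∀ i, |g i| ≤ ⨆ i, |g i| := fun i => le_ciSup hbdd i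
  have h2 : (⨆ i, |g i|) ≤ t * (⨆ i, |g i|) + c := ciSup_le (h _ h1)
  refine (h1 i).trans ?_
  rw [le_div_iff₀ (by linarith)]
  linarith

lemma abs_threePoint_le {A C B : ℝ} {f : ℤ → ℝ} (hA : 0 ≤ A) (hC : 0 ≤ C)
    (hf : ∀ i, |f i| ≤ B) (j : ℤ) : |threePoint A C f j| ≤ (A + 2 * C) * B := by
  have h1 := abs_le.1 (hf j)
  have h2 := abs_le.1 (hf (j + 1))
  have h3 := abs_le.1 (hf (j - 1))
  unfold threePoint
  rw [abs_le]
  constructor <;> nlinarith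

/-- A diagonally dominant three-point operator is boundedly invertible on bounded sequences. -/
lemma abs_le_of_abs_threePoint_le {A C B D : ℝ} {f : ℤ → ℝ} (hC : 0 ≤ C) (hAC : 2 * C < A)
    (hf : ∀ i, |f i| ≤ B) (hD : ∀ i, |threePoint A C f i| ≤ D) (j : ℤ) :
    |f j| ≤ D / (A - 2 * C) := by
  have hA : 0 < A := by linarith
  have h := abs_le_of_self_improving (t := 2 * C / A) (c := D / A) hf
    (by rw [div_lt_one hA]; exact hAC) (fun X hX i => ?_) j
  · refine h.trans (le_of_eq ?_)
    have : A - 2 * C ≠ 0 := by linarith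
    rw [div_eq_div_iff _ this]
    · field_simp
    · rw [one_sub_div hA.ne']; positivity
  · have h1 := abs_le.1 (hD i)
    have h2 := abs_le.1 (hX (i + 1))
    have h3 := abs_le.1 (hX (i - 1))
    unfold threePoint at h1
    rw [div_mul_eq_mul_div, ← add_div, le_div_iff₀ hA]
    nth_rewrite 1 [← abs_of_pos hA]
    rw [← abs_mul, abs_le]
    constructor <;> nlinarith

lemma threePoint_injective {A C B B' : ℝ} {f g : ℤ → ℝ} (hC : 0 ≤ C) (hAC : 2 * C < A)
    (hf : ∀ i, |f i| ≤ B) (hg : ∀ i, |g i| ≤ B')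
    (h : ∀ i, threePoint A C f i = threePoint A C g i) (j : ℤ) : f j = g j := by
  have h1 := abs_le_of_abs_threePoint_le (f := fun i => f i - g i) (B := B + B') (D := 0) hC hAC
    (fun i => (abs_sub _ _).trans (add_le_add (hf i) (hg i)))
    (fun i => by
      have := h i
      unfold threePoint at this ⊢
      rw [show A * (f i - g i) + C * (f (i + 1) - g (i + 1) + (f (i - 1) - g (i - 1))) = 0 by
        linarith, abs_zero]) j
  rw [zero_div] at h1
  exact sub_eq_zero.1 (abs_nonpos_iff.1 h1)

/-! ### Maximum-norm stability -/

/-- From `(H + μA/4) E = H G` follows `K^m E = K^{m+1} G`. Both sides have the same image under `H +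
μA/4`, which is injective on bounded sequences by diagonal dominance, so no inverse has to be
constructed. -/
lemma convZ_resolventKernel_eq {μ B B' : ℝ} {E G : ℤ → ℝ} (hμ : 0 < μ) (hμ1 : μ ≤ 1 / 3)
    (hE : ∀ i, |E i| ≤ B) (hG : ∀ i, |G i| ≤ B')
    (h : ∀ i, threePoint (5 / 6 + μ / 2) (1 / 12 - μ / 4) E i = threePoint (5 / 6) (1 / 12) G i)
    (m : ℕ) (j : ℤ) :
    convZ (resolventKernel μ m) E j = convZ (resolventKernel μ (m + 1)) G j := by
  have s1 := (summable_abs_resolventKernel hμ hμ1 m).1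
  have s2 := (summable_abs_resolventKernel hμ hμ1 (m + 1)).1
  refine threePoint_injective (A := 5 / 6 + μ / 2) (C := 1 / 12 - μ / 4) (by linarith) (by linarith)
    (abs_convZ_le s1 hE) (abs_convZ_le s2 hG) (fun i => ?_) j
  rw [← convZ_threePoint s1 hE, threePoint_convZ s2 hG,
    funext (resolventKernel_succ hμ.le m), funext h, ← threePoint_convZ s1 hG,
    convZ_threePoint s1 hG]

lemma convZ_resolventKernel_zero (μ : ℝ) (f : ℤ → ℝ) (j : ℤ) :
    convZ (resolventKernel μ 0) f j = f j := by
  unfold convZ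
  rw [tsum_eq_single 0 (fun i hi => by rw [resolventKernel_zero, if_neg hi, zero_mul])]
  simp [resolventKernel_zero]

lemma sum_mul_sub_eq (b u : ℕ → ℝ) {n : ℕ} (hn : 1 ≤ n) :
    ∑ k ∈ Finset.Icc 1 n, b k * (u k - u (k - 1)) =
      b n * u n - ∑ k ∈ Finset.Ico 1 n, (b (k + 1) - b k) * u k - b 1 * u 0 := by
  induction n, hn using Nat.le_induction with
  | base => simp; ring
  | succ n hn ih =>
    rw [Finset.sum_Icc_succ_top (by omega), ih, Finset.sum_Ico_succ_top hn, Nat.add_sub_cancel]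
    ring

/-- The kernel bound for the powers of the resolvent of the compact operator. -/
def stabilityConst : ℝ := 1 + Real.pi * 1944

lemma stabilityConst_pos : 0 < stabilityConst := by
  have := Real.pi_pos
  unfold stabilityConst
  positivity

/-- Maximum-norm stability of the compact scheme on two-sided sequences, for an L1-type formula
with nonnegative increasing weights `b n k`. -/
theorem compact_scheme_stability {M : ℕ} {q c ρ B : ℝ} {b : ℕ → ℕ → ℝ} {e R : ℕ → ℤ → ℝ}
    (hq : 0 < q) (hc : 0 < c) (hρ : 0 ≤ ρ)
    (hb1 : ∀ n, 1 ≤ n → n ≤ M → 0 ≤ b n 1)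
    (hbm : ∀ n ≤ M, ∀ k, 1 ≤ k → k < n → b n k ≤ b n (k + 1))
    (he : ∀ n ≤ M, ∀ j, |e n j| ≤ B) (h0 : ∀ j, e 0 j = 0)
    (heq : ∀ n, 1 ≤ n → n ≤ M → ∀ j,
      threePoint (5 / 6) (1 / 12)
          (fun j => ∑ k ∈ Finset.Icc 1 n, b n k * (e k j - e (k - 1) j)) j
        + q * threePoint (5 / 6) (1 / 12) (e n) j + c * (2 * e n j - e n (j + 1) - e n (j - 1))
      = R n j)
    (hR : ∀ n, 1 ≤ n → n ≤ M → ∀ j, |R n j| ≤ ρ * b n 1) :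
    ∀ n ≤ M, ∀ j, |e n j| ≤ 3 / 2 * stabilityConst * ρ := by
  -- One `s` serves all time levels, because the induction compares the same powers of the same
  -- resolvent at different levels. The sum makes `s - b n n - q` nonnegative, and `12 * c` makes `μ
  -- ≤ 1/3`.
  set s : ℝ := ∑ n ∈ Finset.range (M + 1), |b n n| + q + 12 * c with hs
  have hs0 : 0 < s := by
    have : 0 ≤ ∑ n ∈ Finset.range (M + 1), |b n n| := Finset.sum_nonneg fun _ _ => abs_nonneg _
    linarith
  have hsb : ∀ n ≤ M, b n n + q ≤ s := by
    intro n hn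
    have := Finset.single_le_sum (f := fun n => |b n n|) (fun _ _ => abs_nonneg _)
      (Finset.mem_range.2 (Nat.lt_succ_of_le hn))
    have := le_abs_self (b n n)
    linarith
  set μ : ℝ := 4 * c / s with hμs
  have hμ : 0 < μ := by positivity
  have hμ1 : μ ≤ 1 / 3 := by
    rw [hμs, div_le_iff₀ hs0]
    have : 0 ≤ ∑ n ∈ Finset.range (M + 1), |b n n| := Finset.sum_nonneg fun _ _ => abs_nonneg _
    linarith
  have hker := fun m => (summable_abs_resolventKernel hμ hμ1 m).1
  have hker2 : ∀ m, ∑' j, |resolventKernel μ m j| ≤ stabilityConst :=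
    fun m => (summable_abs_resolventKernel hμ hμ1 m).2
  have hK := stabilityConst_pos
  set E : ℕ → ℤ → ℝ := fun n => threePoint (5 / 6) (1 / 12) (e n) with hEdef
  have hE : ∀ n ≤ M, ∀ j, |E n j| ≤ B := by
    intro n hn j
    have := abs_threePoint_le (A := 5 / 6) (C := 1 / 12) (by norm_num) (by norm_num) (he n hn) j
    norm_num at this
    exact this
  -- The induction bounds all powers `K^m E^n` at once: one use of the equation at level `n` raises
  -- the power by one, so a bound on `E^n` alone would not close.
  have main : ∀ n ≤ M, ∀ p : ℕ × ℤ,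
      |convZ (resolventKernel μ p.1) (E n) p.2| ≤ stabilityConst * ρ := by
    intro n
    induction n using Nat.strong_induction_on with
    | _ n ih =>
    intro hn
    rcases Nat.eq_zero_or_pos n with rfl | hn1
    · intro p
      have : ∀ j, |E 0 j| ≤ 0 := by
        intro j
        simp [hEdef, threePoint, h0]
      have h2 := abs_convZ_le (hker p.1) this p.2
      rw [mul_zero] at h2
      exact h2.trans (by positivity)
    have hbn : 0 ≤ b n 1 := hb1 n hn1 hn
    have hmono : ∀ k k', 1 ≤ k → k ≤ k' → k' ≤ n → b n k ≤ b n k' := by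
      intro k k' hk hk'
      induction k', hk' using Nat.le_induction with
      | base => simp
      | succ k' hk' ihk => exact fun h => (ihk (by omega)).trans (hbm n hn k' (by omega) (by omega))
    have hbmono : b n 1 ≤ b n n := hmono 1 n le_rfl hn1 le_rfl
    set F : ℤ → ℝ := fun j => ∑ k ∈ Finset.Ico 1 n, (b n (k + 1) - b n k) * E k j with hF
    set G : ℤ → ℝ := fun j => (1 / s) * (((s - b n n - q) * E n j + F j) + R n j) with hG
    have hsn := hsb n hn
    have hFb : ∀ k ∈ Finset.Ico 1 n, ∀ j, |(b n (k + 1) - b n k) * E k j| ≤ b n n * B := by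
      intro k hk j
      rw [Finset.mem_Ico] at hk
      have h2 : 0 ≤ b n (k + 1) - b n k := by linarith [hbm n hn k hk.1 hk.2]
      have h4 : 0 ≤ b n k := hbn.trans (hmono 1 k le_rfl hk.1 hk.2.le)
      rw [abs_mul, abs_of_nonneg h2]
      have := hmono (k + 1) n (by omega) (by omega) le_rfl
      exact mul_le_mul (by linarith) (hE k (by omega) j) (abs_nonneg _) (by linarith)
    have hFbd : ∀ j, |F j| ≤ ∑ k ∈ Finset.Ico 1 n, b n n * B := fun j =>
      (Finset.abs_sum_le_sum_abs _ _).trans (Finset.sum_le_sum fun k hk => hFb k hk j)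
    have hEFbd : ∀ j, |(s - b n n - q) * E n j + F j| ≤
        (s - b n n - q) * B + ∑ k ∈ Finset.Ico 1 n, b n n * B := by
      intro j
      refine (abs_add_le _ _).trans (add_le_add ?_ (hFbd j))
      rw [abs_mul, abs_of_nonneg (by linarith)]
      exact mul_le_mul_of_nonneg_left (hE n hn j) (by linarith)
    have hGbd : ∀ j, |G j| ≤ 1 / s * ((s - b n n - q) * B + ∑ k ∈ Finset.Ico 1 n, b n n * B
        + ρ * b n 1) := by
      intro j
      simp only [hG]
      rw [abs_mul, abs_of_pos (by positivity : 0 < 1 / s)]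
      exact mul_le_mul_of_nonneg_left ((abs_add_le _ _).trans
        (add_le_add (hEFbd j) (hR n hn1 hn j))) (by positivity)
    have hconvG : ∀ m j, convZ (resolventKernel μ m) G j =
        1 / s * ((s - b n n - q) * convZ (resolventKernel μ m) (E n) j +
          ∑ k ∈ Finset.Ico 1 n, (b n (k + 1) - b n k) * convZ (resolventKernel μ m) (E k) j +
          convZ (resolventKernel μ m) (R n) j) := by
      intro m j
      rw [hG, convZ_const_mul, convZ_add (hker m) hEFbd (hR n hn1 hn),
        convZ_add (hker m) (B := |s - b n n - q| * B) (fun i => by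
          rw [abs_mul]; exact mul_le_mul_of_nonneg_left (hE n hn i) (abs_nonneg _)) hFbd,
        convZ_const_mul, hF, convZ_sum (hker m) _ hFb]
      simp only [convZ_const_mul]
    -- Adding `(s - b n n - q) E^n` to both sides of the scheme gives `(H + μA/4) e^n = G`. Applying
    -- `H`, which commutes with the left operator, yields the claim.
    have hcontr : ∀ j, threePoint (5 / 6 + μ / 2) (1 / 12 - μ / 4) (E n) j =
        threePoint (5 / 6) (1 / 12) G j := by
      have heqe : ∀ j, threePoint (5 / 6 + μ / 2) (1 / 12 - μ / 4) (e n) j = G j := by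
        intro j
        have h1 := heq n hn1 hn j
        have h2 : ∀ j, ∑ k ∈ Finset.Icc 1 n, b n k * (e k j - e (k - 1) j) =
            b n n * e n j - ∑ k ∈ Finset.Ico 1 n, (b n (k + 1) - b n k) * e k j := by
          intro j
          rw [sum_mul_sub_eq (b n) (fun k => e k j) hn1, h0, mul_zero, sub_zero]
        simp only [h2] at h1
        have h3 : F j = threePoint (5 / 6) (1 / 12)
            (fun j => ∑ k ∈ Finset.Ico 1 n, (b n (k + 1) - b n k) * e k j) j := by
          simp only [hF, hEdef, threePoint]
          rw [← Finset.sum_add_distrib, Finset.mul_sum, Finset.mul_sum, ← Finset.sum_add_distrib]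
          exact Finset.sum_congr rfl fun k _ => by ring
        have h4 : s * μ = 4 * c := by rw [hμs]; field_simp
        simp only [hG]
        rw [div_mul_eq_mul_div, one_mul, eq_div_iff hs0.ne', ← h1, h3]
        simp only [hEdef, threePoint]
        linear_combination (1 / 2 * e n j - 1 / 4 * (e n (j + 1) + e n (j - 1))) * h4
      intro j
      rw [← funext heqe]
      simp only [hEdef, threePoint]
      ring
    intro p
    have hθ : (s - b n n - q) / s < 1 := by rw [div_lt_one hs0]; linarith
    have hRK : ∀ m j, |convZ (resolventKernel μ m) (R n) j| ≤ stabilityConst * (ρ * b n 1) :=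
      fun m j => (abs_convZ_le (hker m) (hR n hn1 hn) j).trans
        (mul_le_mul_of_nonneg_right (hker2 m) (by positivity))
    -- The history contributes `b n n - b n 1` and the residual `b n 1`, each times `stabilityConst
    -- * ρ`, so together exactly `b n n`. The fixed-point bound is then `b n n / (b n n + q)` times
    -- `stabilityConst * ρ`.
    have hself := abs_le_of_self_improving
      (g := fun p : ℕ × ℤ => convZ (resolventKernel μ p.1) (E n) p.2)
      (B := stabilityConst * B) (t := (s - b n n - q) / s) (c := b n n * (stabilityConst * ρ) / s)
      (fun p => (abs_convZ_le (hker _) (hE n hn) _).trans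
        (mul_le_mul_of_nonneg_right (hker2 _) ((abs_nonneg _).trans (hE n hn 0)))) hθ
      (fun X hX p => by
        rw [convZ_resolventKernel_eq hμ hμ1 (hE n hn) hGbd hcontr, hconvG, abs_mul,
          abs_of_pos (by positivity : 0 < 1 / s), one_div, inv_mul_le_iff₀ hs0]
        have hX' := hX (p.1 + 1, p.2)
        simp only at hX'
        have hsum : |∑ k ∈ Finset.Ico 1 n, (b n (k + 1) - b n k) *
            convZ (resolventKernel μ (p.1 + 1)) (E k) p.2| ≤
            (b n n - b n 1) * (stabilityConst * ρ) := by
          have htel : ∑ k ∈ Finset.Ico 1 n, (b n (k + 1) - b n k) = b n n - b n 1 :=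
            Finset.sum_Ico_sub (b n) hn1
          rw [← htel, Finset.sum_mul]
          refine (Finset.abs_sum_le_sum_abs _ _).trans (Finset.sum_le_sum fun k hk => ?_)
          rw [Finset.mem_Ico] at hk
          have hd : 0 ≤ b n (k + 1) - b n k := by linarith [hbm n hn k hk.1 hk.2]
          rw [abs_mul, abs_of_nonneg hd]
          exact mul_le_mul_of_nonneg_left (ih k hk.2 (by omega) (p.1 + 1, p.2)) hd
        have h1 : |(s - b n n - q) * convZ (resolventKernel μ (p.1 + 1)) (E n) p.2| ≤
            (s - b n n - q) * X := by
          rw [abs_mul, abs_of_nonneg (by linarith)]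
          exact mul_le_mul_of_nonneg_left hX' (by linarith)
        refine ((abs_add_le _ _).trans (add_le_add ((abs_add_le _ _).trans (add_le_add h1 hsum))
          (hRK _ _))).trans (le_of_eq ?_)
        field_simp
        ring) p
    refine hself.trans ?_
    have hd : 0 < 1 - (s - b n n - q) / s := by linarith
    rw [div_le_iff₀ hd]
    have : 1 - (s - b n n - q) / s = (b n n + q) / s := by field_simp; ring
    rw [this, mul_div_assoc']
    have : 0 ≤ stabilityConst * ρ := by positivity
    rw [div_le_div_iff_of_pos_right hs0]
    nlinarith
  intro n hn j
  -- The power `m = 0` returns `E^n` itself. Undoing `H` costs `1/(5/6 - 2/12) = 3/2`.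
  have hEn : ∀ i, |threePoint (5 / 6) (1 / 12) (e n) i| ≤ stabilityConst * ρ := by
    intro i
    have := main n hn (0, i)
    simpa only [convZ_resolventKernel_zero] using this
  have := abs_le_of_abs_threePoint_le (by norm_num) (by norm_num) (he n hn) hEn j
  refine this.trans (le_of_eq ?_)
  norm_num
  ring

/-! ### Odd periodic extension of grid functions -/

/-- The odd `2N`-periodic extension of a grid function on `0, …, N` vanishing at both ends. -/
def oddExt (N : ℕ) (w : ℕ → ℝ) (j : ℤ) : ℝ :=
  if j % (2 * N) ≤ N then w (j % (2 * N)).toNat else -w (2 * N - j % (2 * N)).toNat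

lemma oddExt_of_le {N : ℕ} (hN : 1 ≤ N) (w : ℕ → ℝ) (d : ℤ) {i : ℕ} (hi : i ≤ N) :
    oddExt N w (i + 2 * N * d) = w i := by
  have h : ((i : ℤ) + 2 * N * d) % (2 * N) = i := by
    rw [Int.add_mul_emod_self_left, Int.emod_eq_of_lt (by omega) (by omega)]
  unfold oddExt
  rw [h, if_pos (by exact_mod_cast hi), Int.toNat_natCast]

lemma oddExt_neg_of_le {N : ℕ} (hN : 1 ≤ N) {w : ℕ → ℝ} (h0 : w 0 = 0) (hwN : w N = 0) (d : ℤ)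
    {i : ℕ} (hi : i ≤ N) : oddExt N w (-i + 2 * N * d) = -w i := by
  rcases Nat.eq_zero_or_pos i with rfl | hi0
  · have := oddExt_of_le hN w d (Nat.zero_le N)
    simp only [Nat.cast_zero, neg_zero] at this ⊢
    rw [this, h0, neg_zero]
  rcases hi.eq_or_lt with rfl | hlt
  · have := oddExt_of_le hN w (d - 1) le_rfl
    rw [show -(i : ℤ) + 2 * i * d = i + 2 * i * (d - 1) by ring, this, hwN, neg_zero]
  have h : (-(i : ℤ) + 2 * N * d) % (2 * N) = 2 * N - i := by
    rw [show -(i : ℤ) + 2 * N * d = (2 * N - i) + 2 * N * (d - 1) by ring,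
      Int.add_mul_emod_self_left, Int.emod_eq_of_lt (by omega) (by omega)]
  unfold oddExt
  rw [h, if_neg (by omega)]
  congr 2
  omega

lemma exists_fold_index {N : ℕ} (hN : 1 ≤ N) (j : ℤ) :
    ∃ i ≤ N, ∃ d : ℤ, j = i + 2 * N * d ∨ j = -i + 2 * N * d := by
  have h1 := Int.emod_add_mul_ediv j (2 * N)
  have h2 := Int.emod_nonneg j (show (2 * N : ℤ) ≠ 0 by omega)
  have h3 := Int.emod_lt_of_pos j (show (0 : ℤ) < 2 * N by omega)
  by_cases h : j % (2 * N) ≤ N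
  · refine ⟨(j % (2 * N)).toNat, by omega, j / (2 * N), Or.inl ?_⟩
    rw [Int.toNat_of_nonneg h2]; exact h1.symm
  · refine ⟨(2 * N - j % (2 * N)).toNat, by omega, j / (2 * N) + 1, Or.inr ?_⟩
    rw [Int.toNat_of_nonneg (by omega)]
    linarith

/-- Every value of the odd extension and of its neighbour sum is, up to a sign, one of the grid
function; the neighbour sum vanishes at the images of the end points. -/
lemma exists_oddExt_eq {N : ℕ} (hN : 1 ≤ N) (j : ℤ) :
    ∃ s : ℝ, |s| = 1 ∧ ∃ i ≤ N, ∀ w : ℕ → ℝ, w 0 = 0 → w N = 0 →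
      oddExt N w j = s * w i ∧
      oddExt N w (j + 1) + oddExt N w (j - 1) =
        if i = 0 ∨ i = N then 0 else s * (w (i + 1) + w (i - 1)) := by
  obtain ⟨i, hi, d, hj⟩ := exists_fold_index hN j
  by_cases hb : i = 0 ∨ i = N
  · refine ⟨1, by simp, i, hi, fun w h0 hwN => ?_⟩
    rw [if_pos hb]
    rcases hb with rfl | rfl
    · have e : j = 2 * N * d := by rcases hj with h | h <;> simpa using h
      subst e
      have a1 := oddExt_of_le hN w d (Nat.zero_le N)
      have a2 := oddExt_of_le hN w d hN
      have a3 := oddExt_neg_of_le hN h0 hwN d hN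
      push_cast at a1 a2 a3
      rw [zero_add] at a1
      refine ⟨by rw [a1]; ring, ?_⟩
      rw [show (2 : ℤ) * N * d + 1 = 1 + 2 * N * d by ring,
        show (2 : ℤ) * N * d - 1 = -1 + 2 * N * d by ring, a2, a3]
      ring
    · obtain ⟨d', e⟩ : ∃ d' : ℤ, j = i + 2 * i * d' := by
        rcases hj with h | h
        · exact ⟨d, h⟩
        · exact ⟨d - 1, by rw [h]; ring⟩
      subst e
      have a1 := oddExt_of_le hN w d' le_rfl
      have a2 := oddExt_of_le hN w d' (Nat.sub_le i 1)
      have a3 := oddExt_neg_of_le hN h0 hwN (d' + 1) (Nat.sub_le i 1)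
      push_cast [Nat.cast_sub hN] at a2 a3
      refine ⟨by rw [a1]; ring, ?_⟩
      rw [show (i : ℤ) + 2 * i * d' + 1 = -(i - 1) + 2 * i * (d' + 1) by ring,
        show (i : ℤ) + 2 * i * d' - 1 = i - 1 + 2 * i * d' by ring, a2, a3]
      ring
  · push Not at hb
    have hi1 : 1 ≤ i := Nat.one_le_iff_ne_zero.2 hb.1
    have hiN : i + 1 ≤ N := lt_of_le_of_ne hi hb.2
    rcases hj with rfl | rfl
    · refine ⟨1, by simp, i, hi, fun w h0 hwN => ?_⟩
      rw [if_neg (by tauto)]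
      have a1 := oddExt_of_le hN w d hi
      have a2 := oddExt_of_le hN w d hiN
      have a3 := oddExt_of_le hN w d ((Nat.sub_le i 1).trans hi)
      push_cast [Nat.cast_sub hi1] at a2 a3
      refine ⟨by rw [a1]; ring, ?_⟩
      rw [show (i : ℤ) + 2 * N * d + 1 = i + 1 + 2 * N * d by ring,
        show (i : ℤ) + 2 * N * d - 1 = i - 1 + 2 * N * d by ring, a2, a3]
      ring
    · refine ⟨-1, by simp, i, hi, fun w h0 hwN => ?_⟩
      rw [if_neg (by tauto)]
      have a1 := oddExt_neg_of_le hN h0 hwN d hi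
      have a2 := oddExt_neg_of_le hN h0 hwN d hiN
      have a3 := oddExt_neg_of_le hN h0 hwN d ((Nat.sub_le i 1).trans hi)
      push_cast [Nat.cast_sub hi1] at a2 a3
      refine ⟨by rw [a1]; ring, ?_⟩
      rw [show -(i : ℤ) + 2 * N * d + 1 = -(i - 1) + 2 * N * d by ring,
        show -(i : ℤ) + 2 * N * d - 1 = -(i + 1) + 2 * N * d by ring, a2, a3]
      ring

/-- Maximum-norm stability of the compact scheme on a grid with homogeneous boundary values. -/
theorem grid_compact_scheme_stability {M N : ℕ} (hN : 1 ≤ N) {q c ρ : ℝ} {b : ℕ → ℕ → ℝ}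
    {e : ℕ → ℕ → ℝ} (hq : 0 < q) (hc : 0 < c) (hρ : 0 ≤ ρ)
    (hb1 : ∀ n, 1 ≤ n → n ≤ M → 0 ≤ b n 1)
    (hbm : ∀ n ≤ M, ∀ k, 1 ≤ k → k < n → b n k ≤ b n (k + 1))
    (hl : ∀ n ≤ M, e 0 n = 0) (hr : ∀ n ≤ M, e N n = 0) (h0 : ∀ i ≤ N, e i 0 = 0)
    (heq : ∀ i n, 1 ≤ i → i < N → 1 ≤ n → n ≤ M →
      |5 / 6 * (∑ k ∈ Finset.Icc 1 n, b n k * (e i k - e i (k - 1)))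
        + 1 / 12 * (∑ k ∈ Finset.Icc 1 n, b n k * (e (i + 1) k - e (i + 1) (k - 1))
          + ∑ k ∈ Finset.Icc 1 n, b n k * (e (i - 1) k - e (i - 1) (k - 1)))
        + q * (5 / 6 * e i n + 1 / 12 * (e (i + 1) n + e (i - 1) n))
        + c * (2 * e i n - e (i + 1) n - e (i - 1) n)| ≤ ρ * b n 1) :
    ∀ n ≤ M, ∀ i ≤ N, |e i n| ≤ 3 / 2 * stabilityConst * ρ := by
  set E : ℕ → ℤ → ℝ := fun n => oddExt N (fun i => e i n) with hE
  -- A crude bound is enough: only boundedness of the extended sequences matters.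
  have hbd : ∀ n ≤ M, ∀ j, |E n j| ≤
      ∑ n ∈ Finset.range (M + 1), ∑ i ∈ Finset.range (N + 1), |e i n| := by
    intro n hn j
    obtain ⟨s, hs, i, hi, h⟩ := exists_oddExt_eq hN j
    have h1 := (h (fun i => e i n) (hl n hn) (hr n hn)).1
    simp only [hE]
    rw [h1, abs_mul, hs, one_mul]
    refine (Finset.single_le_sum (f := fun i => |e i n|) (fun _ _ => abs_nonneg _)
      (Finset.mem_range.2 (Nat.lt_succ_of_le hi))).trans ?_
    exact Finset.single_le_sum (f := fun n => ∑ i ∈ Finset.range (N + 1), |e i n|)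
      (fun _ _ => Finset.sum_nonneg fun _ _ => abs_nonneg _)
      (Finset.mem_range.2 (Nat.lt_succ_of_le hn))
  have key := compact_scheme_stability (M := M) (e := E) (b := b) hq hc hρ hb1 hbm hbd
    (fun j => by
      obtain ⟨s, hs, i, hi, h⟩ := exists_oddExt_eq hN j
      have h1 := (h (fun i => e i 0) (hl 0 (Nat.zero_le _)) (hr 0 (Nat.zero_le _))).1
      simp only [hE]
      rw [h1, h0 i hi, mul_zero])
    (fun n _ _ j => rfl)
    (fun n hn1 hn j => by
      have hD : (fun j => ∑ k ∈ Finset.Icc 1 n, b n k * (E k j - E (k - 1) j)) =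
          oddExt N (fun i => ∑ k ∈ Finset.Icc 1 n, b n k * (e i k - e i (k - 1))) := by
        funext j
        simp only [hE, oddExt]
        split_ifs
        · rfl
        · rw [← Finset.sum_neg_distrib]
          exact Finset.sum_congr rfl fun k _ => by ring
      have hDb : ∀ i, (∀ n ≤ M, e i n = 0) →
          ∑ k ∈ Finset.Icc 1 n, b n k * (e i k - e i (k - 1)) = 0 := by
        intro i hi
        refine Finset.sum_eq_zero fun k hk => ?_
        rw [Finset.mem_Icc] at hk
        rw [hi k (by omega), hi (k - 1) (by omega), sub_zero, mul_zero]
      obtain ⟨s, hs, i, hi, h⟩ := exists_oddExt_eq hN j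
      obtain ⟨d1, d2⟩ := h (fun i => ∑ k ∈ Finset.Icc 1 n, b n k * (e i k - e i (k - 1)))
        (hDb 0 hl) (hDb N hr)
      obtain ⟨e1, e2⟩ := h (fun i => e i n) (hl n hn) (hr n hn)
      rw [hD]
      simp only [hE, threePoint]
      rw [sub_sub, d2, e2, d1, e1]
      have hbn := hb1 n hn1 hn
      -- At images of the end points the residual of the odd extension vanishes. Elsewhere it equals
      -- the grid residual up to the sign `s`.
      split_ifs with hib
      · have t1 : e i n = 0 := by rcases hib with rfl | rfl; exacts [hl n hn, hr n hn]
        have t2 := hDb i (by rcases hib with rfl | rfl; exacts [hl, hr])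
        simp only [t1, t2, mul_zero, add_zero, sub_zero, abs_zero]
        positivity
      · push Not at hib
        have := heq i n (Nat.one_le_iff_ne_zero.2 hib.1) (lt_of_le_of_ne hi hib.2) hn1 hn
        have habs : ∀ y : ℝ, |y| = |s * y| := fun y => by rw [abs_mul, hs, one_mul]
        rw [habs] at this
        refine le_trans (le_of_eq ?_) this
        congr 1
        ring)
  intro n hn i hi
  have := key n hn i
  have h2 := oddExt_of_le hN (fun i => e i n) 0 hi
  rw [mul_zero, add_zero] at h2
  simp only [hE] at this
  rwa [h2] at this

/-! ### Truncation error of the compact second difference -/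

/-- Induction on the order: the derivative of the remainder of `f 0` is the lower-order remainder of
`f 1`, and the mean value inequality integrates its bound. The factor `1/n!` is given up, and
one-sided derivatives at the end points suffice. -/
lemma abs_taylor_remainder_le {a b C : ℝ} (n : ℕ) : ∀ {f : ℕ → ℝ → ℝ},
    (∀ p < n, ∀ t ∈ Icc a b, HasDerivWithinAt (f p) (f (p + 1) t) (Icc a b) t) →
    (∀ t ∈ Icc a b, |f n t| ≤ C) → ∀ x ∈ Icc a b, ∀ y ∈ Icc a b,
    |f 0 y - ∑ p ∈ Finset.range n, f p x * (y - x) ^ p / p.factorial| ≤ C * |y - x| ^ n := by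
  induction n with
  | zero => intro f _ hC x _ y hy; simpa using hC y hy
  | succ n ih =>
    intro f hf hC x hx y hy
    have hsub : uIcc x y ⊆ Icc a b := uIcc_subset_Icc hx hy
    have hC0 : 0 ≤ C := (abs_nonneg _).trans (hC x hx)
    set g : ℝ → ℝ := fun t => f 0 t - ∑ p ∈ Finset.range (n + 1), f p x * (t - x) ^ p / p.factorial
      with hg
    have hderiv : ∀ t ∈ uIcc x y, HasDerivWithinAt g
        (f 1 t - ∑ p ∈ Finset.range n, f (p + 1) x * (t - x) ^ p / p.factorial) (uIcc x y) t := by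
      intro t ht
      have h1 := (hf 0 (Nat.succ_pos n) t (hsub ht)).mono hsub
      have h2 : HasDerivAt (fun t => ∑ p ∈ Finset.range (n + 1), f p x * (t - x) ^ p / p.factorial)
          (∑ p ∈ Finset.range n, f (p + 1) x * (t - x) ^ p / p.factorial) t := by
        have h3 : ∀ p ∈ Finset.range (n + 1), HasDerivAt
            (fun t => f p x * (t - x) ^ p / p.factorial)
            (f p x * (p * (t - x) ^ (p - 1)) / p.factorial) t := by
          intro p _
          have := ((((hasDerivAt_id t).sub_const x).pow p).const_mul (f p x)).div_const
            (p.factorial : ℝ)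
          simpa using this
        refine (HasDerivAt.fun_sum h3).congr_deriv ?_
        rw [Finset.sum_range_succ']
        simp only [Nat.cast_zero, zero_mul, mul_zero, zero_div, add_zero, Nat.add_sub_cancel]
        refine Finset.sum_congr rfl fun p _ => ?_
        rw [Nat.factorial_succ]
        push_cast
        have : (p : ℝ) + 1 ≠ 0 := by positivity
        field_simp
      exact h1.sub h2.hasDerivWithinAt
    have hbound : ∀ t ∈ uIcc x y,
        ‖f 1 t - ∑ p ∈ Finset.range n, f (p + 1) x * (t - x) ^ p / p.factorial‖ ≤
          C * |y - x| ^ n := by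
      intro t ht
      refine (ih (f := fun p => f (p + 1)) (fun p hp => hf (p + 1) (by omega)) hC x hx t
        (hsub ht)).trans ?_
      exact mul_le_mul_of_nonneg_left
        (pow_le_pow_left₀ (abs_nonneg _) (abs_sub_left_of_mem_uIcc ht) n) hC0
    have := (convex_uIcc x y).norm_image_sub_le_of_norm_hasDerivWithin_le hderiv hbound
      left_mem_uIcc right_mem_uIcc
    have hgx : g x = 0 := by
      simp only [hg]
      rw [Finset.sum_range_succ']
      simp
    rw [hgx, sub_zero, Real.norm_eq_abs, Real.norm_eq_abs, mul_assoc, ← pow_succ] at this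
    exact this

/-- The odd Taylor terms cancel by symmetry and the `h² f 4 / 12` terms match. What remains is two
remainders of `f 0` and two of `f 2`, the latter weighted by `1/12`: at most `(2 + 1/6) C h^4`. -/
lemma abs_compact_truncation_le {a b C x h : ℝ} {f : ℕ → ℝ → ℝ} (hh : 0 < h)
    (hf : ∀ p < 6, ∀ t ∈ Icc a b, HasDerivWithinAt (f p) (f (p + 1) t) (Icc a b) t)
    (hC : ∀ t ∈ Icc a b, |f 6 t| ≤ C) (hx : x ∈ Icc a b) (hl : x - h ∈ Icc a b)
    (hr : x + h ∈ Icc a b) :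
    |(f 0 (x + h) - 2 * f 0 x + f 0 (x - h)) / h ^ 2 -
      (5 / 6 * f 2 x + 1 / 12 * (f 2 (x + h) + f 2 (x - h)))| ≤ 3 * C * h ^ 4 := by
  have hC0 : 0 ≤ C := (abs_nonneg _).trans (hC x hx)
  have r1 := abs_taylor_remainder_le 6 hf hC x hx _ hr
  have r2 := abs_taylor_remainder_le 6 hf hC x hx _ hl
  have r3 := abs_taylor_remainder_le 4 (f := fun p => f (p + 2)) (fun p hp => hf (p + 2) (by omega))
    hC x hx _ hr
  have r4 := abs_taylor_remainder_le 4 (f := fun p => f (p + 2)) (fun p hp => hf (p + 2) (by omega))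
    hC x hx _ hl
  have e1 : |x + h - x| = h := by rw [add_sub_cancel_left, abs_of_pos hh]
  have e2 : |x - h - x| = h := by rw [sub_sub_cancel_left, abs_neg, abs_of_pos hh]
  rw [e1] at r1 r3
  rw [e2] at r2 r4
  simp only [Finset.sum_range_succ, Finset.sum_range_zero, Nat.factorial, add_sub_cancel_left,
    sub_sub_cancel_left] at r1 r2 r3 r4
  norm_num at r1 r2 r3 r4
  rw [abs_le] at r1 r2 r3 r4
  have hh2 : 0 < h ^ 2 := by positivity
  rw [abs_le]
  have key : (f 0 (x + h) - 2 * f 0 x + f 0 (x - h)) / h ^ 2 * h ^ 2 =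
      f 0 (x + h) - 2 * f 0 x + f 0 (x - h) := by field_simp
  set Q := (f 0 (x + h) - 2 * f 0 x + f 0 (x - h)) / h ^ 2
  have hC6 : 0 ≤ C * h ^ 6 := by positivity
  constructor
  · refine le_of_mul_le_mul_right ?_ hh2
    nlinarith
  · refine le_of_mul_le_mul_right ?_ hh2
    nlinarith

lemma hasDerivWithinAt_iteratedDerivWithin {f : ℝ → ℝ} {s : Set ℝ} {n : WithTop ℕ∞} {p : ℕ} {t : ℝ}
    (hs : UniqueDiffOn ℝ s) (hf : ContDiffOn ℝ n f s) (hp : (p : WithTop ℕ∞) < n) (ht : t ∈ s) :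
    HasDerivWithinAt (iteratedDerivWithin p f s) (iteratedDerivWithin (p + 1) f s t) s t := by
  rw [iteratedDerivWithin_succ]
  exact (hf.differentiableOn_iteratedDerivWithin hp hs t ht).hasDerivWithinAt

/-! ### The graded time levels -/

section TimeLevels

variable {T γ : ℝ} {M : ℕ}

lemma timeLevel_zero (T : ℝ) {γ : ℝ} (hγ : 1 ≤ γ) (M : ℕ) : timeLevel T γ M 0 = 0 := by
  unfold timeLevel
  rw [Nat.cast_zero, zero_div, Real.zero_rpow (by linarith), mul_zero]

lemma timeLevel_pos (hT : 0 < T) (hM : 1 ≤ M) {k : ℕ} (hk : 1 ≤ k) : 0 < timeLevel T γ M k := by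
  unfold timeLevel
  have : (0 : ℝ) < M := by exact_mod_cast hM
  have : (0 : ℝ) < k := by exact_mod_cast hk
  positivity

lemma timeLevel_le_timeLevel (hT : 0 < T) (hγ : 1 ≤ γ) {j k : ℕ} (hjk : j ≤ k) :
    timeLevel T γ M j ≤ timeLevel T γ M k := by
  unfold timeLevel
  gcongr

lemma timeLevel_nonneg (hT : 0 < T) (k : ℕ) : 0 ≤ timeLevel T γ M k := by
  unfold timeLevel
  positivity

lemma timeLevel_lt_timeLevel (hT : 0 < T) (hγ : 1 ≤ γ) (hM : 1 ≤ M) {j k : ℕ} (hjk : j < k) :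
    timeLevel T γ M j < timeLevel T γ M k := by
  unfold timeLevel
  have : (0 : ℝ) < M := by exact_mod_cast hM
  gcongr

lemma timeLevel_self (T γ : ℝ) (hM : 1 ≤ M) : timeLevel T γ M M = T := by
  unfold timeLevel
  have : (M : ℝ) ≠ 0 := by
    have : (0 : ℝ) < M := by exact_mod_cast hM
    exact this.ne'
  rw [div_self this, Real.one_rpow, mul_one]

lemma timeLevel_le (hT : 0 < T) (hγ : 1 ≤ γ) (hM : 1 ≤ M) {k : ℕ} (hk : k ≤ M) :
    timeLevel T γ M k ≤ T :=
  (timeLevel_le_timeLevel hT hγ hk).trans (timeLevel_self T γ hM).le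

lemma timeLevel_eq_mul (hM : 1 ≤ M) {j k : ℕ} (hk : 1 ≤ k) :
    timeLevel T γ M j = timeLevel T γ M k * ((j : ℝ) / k) ^ γ := by
  unfold timeLevel
  have : (0 : ℝ) < M := by exact_mod_cast hM
  have : (0 : ℝ) < k := by exact_mod_cast hk
  rw [mul_assoc, ← Real.mul_rpow (by positivity) (by positivity)]
  congr 2
  field_simp

lemma timeLevel_le_mul (hT : 0 < T) (hγ : 1 ≤ γ) (hM : 1 ≤ M) {j k : ℕ} (hk : 1 ≤ k)
    (hjk : j ≤ k) : timeLevel T γ M j ≤ timeLevel T γ M k * (j / k) := by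
  rw [timeLevel_eq_mul hM hk]
  have hk' : (0 : ℝ) < k := by exact_mod_cast hk
  have h1 : (j : ℝ) / k ≤ 1 := by
    rw [div_le_one hk']
    exact_mod_cast hjk
  refine mul_le_mul_of_nonneg_left ?_ (timeLevel_nonneg hT k)
  exact Real.rpow_le_self_of_le_one (by positivity) h1 hγ

lemma timeLevel_sub_le (hT : 0 < T) (hγ : 1 ≤ γ) (hM : 1 ≤ M) {k : ℕ} (hk : 1 ≤ k) :
    timeLevel T γ M k - timeLevel T γ M (k - 1) ≤ γ * timeLevel T γ M k / k := by
  rw [timeLevel_eq_mul hM hk (j := k - 1)]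
  have hk' : (0 : ℝ) < k := by exact_mod_cast hk
  have h1 : (1 : ℝ) ≤ k := by exact_mod_cast hk
  have h := one_add_mul_self_le_rpow_one_add (s := -(1 / k : ℝ)) (p := γ)
    (by rw [neg_le_neg_iff, div_le_one hk']; exact h1) hγ
  have e : (1 : ℝ) + -(1 / k) = ((k - 1 : ℕ) : ℝ) / k := by
    push_cast [Nat.cast_sub hk]
    field_simp
    ring
  rw [e] at h
  have ht := timeLevel_nonneg (γ := γ) (M := M) hT k
  have := mul_le_mul_of_nonneg_left h ht
  have e2 : timeLevel T γ M k * (1 + γ * -(1 / k)) =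
    timeLevel T γ M k - γ * timeLevel T γ M k / k := by ring
  linarith

lemma timeLevel_le_two_rpow_mul (hT : 0 < T) (hγ : 1 ≤ γ) (hM : 1 ≤ M) {k : ℕ} (hk : 1 ≤ k) :
    timeLevel T γ M (k + 1) ≤ 2 ^ γ * timeLevel T γ M k := by
  rw [timeLevel_eq_mul hM (Nat.le_add_left 1 k) (j := k), mul_comm (timeLevel T γ M (k + 1)),
    ← mul_assoc, ← Real.mul_rpow (by norm_num) (by positivity)]
  refine le_mul_of_one_le_left (timeLevel_nonneg hT _) (Real.one_le_rpow ?_ (by linarith))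
  rw [← mul_div_assoc, le_div_iff₀ (by positivity)]
  have h1 : (1 : ℝ) ≤ k := by exact_mod_cast hk
  push_cast
  linarith

end TimeLevels

/-! ### Local errors of the L1 formula -/

section LocalErrors

variable {α : ℝ}

lemma intervalIntegrable_sub_rpow (hα₁ : α < 1) (t a b : ℝ) :
    IntervalIntegrable (fun s => (t - s) ^ (-α)) MeasureTheory.volume a b := by
  have := (intervalIntegral.intervalIntegrable_rpow' (a := t - a) (b := t - b)
    (show -1 < -α by linarith)).comp_sub_left t
  simpa using this

lemma integral_sub_rpow (hα₁ : α < 1) (t a b : ℝ) :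
    ∫ s in a..b, (t - s) ^ (-α) = ((t - a) ^ (1 - α) - (t - b) ^ (1 - α)) / (1 - α) := by
  rw [intervalIntegral.integral_comp_sub_left (fun x => x ^ (-α)) t,
    integral_rpow (Or.inl (by linarith)), show -α + 1 = 1 - α by ring]

/-- On each side of `b/2` only one factor is singular, and the other is bounded by its value at
`b/2`. -/
lemma sub_rpow_mul_rpow_le {b s : ℝ} (hα₀ : 0 < α) (hα₁ : α < 1) (hs : 0 < s)
    (hsb : s ≤ b) : (b - s) ^ (-α) * s ^ (α - 1) ≤
      (b / 2) ^ (-α) * s ^ (α - 1) + (b / 2) ^ (α - 1) * (b - s) ^ (-α) := by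
  have hb : 0 < b := by linarith
  have h1 : 0 ≤ (b - s) ^ (-α) := Real.rpow_nonneg (by linarith) _
  have h2 : 0 ≤ s ^ (α - 1) := Real.rpow_nonneg hs.le _
  have h3 : 0 ≤ (b / 2) ^ (-α) := Real.rpow_nonneg (by linarith) _
  have h4 : 0 ≤ (b / 2) ^ (α - 1) := Real.rpow_nonneg (by linarith) _
  rcases le_total s (b / 2) with h | h
  · have : (b - s) ^ (-α) ≤ (b / 2) ^ (-α) :=
      Real.rpow_le_rpow_of_nonpos (by linarith) (by linarith) (by linarith)
    nlinarith [mul_nonneg h4 h1]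
  · have : s ^ (α - 1) ≤ (b / 2) ^ (α - 1) :=
      Real.rpow_le_rpow_of_nonpos (by linarith) (by linarith) (by linarith)
    nlinarith [mul_nonneg h3 h2]

/-- The majorant of the Beta integrand is integrable with an explicit bound. -/
lemma integral_beta_majorant_le {b : ℝ} (hα₀ : 0 < α) (hα₁ : α < 1) (hb : 0 < b) :
    ∫ s in (0 : ℝ)..b, ((b / 2) ^ (-α) * s ^ (α - 1) + (b / 2) ^ (α - 1) * (b - s) ^ (-α)) ≤
      2 / α + 2 / (1 - α) := by
  rw [intervalIntegral.integral_add
      ((intervalIntegral.intervalIntegrable_rpow' (by linarith)).const_mul _)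
      ((intervalIntegrable_sub_rpow hα₁ b 0 b).const_mul _),
    intervalIntegral.integral_const_mul, intervalIntegral.integral_const_mul,
    integral_sub_rpow hα₁, integral_rpow (Or.inl (by linarith)), sub_self, sub_zero,
    Real.zero_rpow (by linarith), show α - 1 + 1 = α by ring, sub_zero, Real.zero_rpow (by linarith),
    sub_zero]
  have hb2 : 0 < b / 2 := by linarith
  have two_le : ∀ x : ℝ, x ≤ 1 → (2 : ℝ) ^ x ≤ 2 := fun x hx => by
    simpa using Real.rpow_le_rpow_of_exponent_le (by norm_num : (1 : ℝ) ≤ 2) hx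
  have e : ∀ x : ℝ, (b / 2) ^ (-x) * b ^ x = 2 ^ x := by
    intro x
    nth_rewrite 2 [show b = b / 2 * 2 by ring]
    rw [Real.mul_rpow hb2.le (by norm_num), ← mul_assoc, ← Real.rpow_add hb2, neg_add_cancel,
      Real.rpow_zero, one_mul]
  have e1 := e α
  have e2 := e (1 - α)
  rw [show -(1 - α) = α - 1 by ring] at e2
  rw [mul_div_assoc', mul_div_assoc', e1, e2]
  have h1 := two_le α hα₁.le
  have h2 := two_le (1 - α) (by linarith)
  have : 0 < 1 - α := by linarith
  gcongr

/-- From `t - s ≥ (t/b)(b - s)`. It moves the singularity of the weight from `t` to `b` at the price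
`(b/t)^α`, which is where the factor `t^{-α}` of the first-step error comes from. The case `b = t`
is included. -/
lemma sub_rpow_le_mul {t b s : ℝ} (hα₀ : 0 < α) (hb : 0 < b) (hbt : b ≤ t) (hs : 0 ≤ s)
    (hsb : s < b) : (t - s) ^ (-α) ≤ t ^ (-α) * b ^ α * (b - s) ^ (-α) := by
  have ht : 0 < t := by linarith
  have h1 : t / b * (b - s) ≤ t - s := by
    rw [div_mul_eq_mul_div, div_le_iff₀ hb]
    nlinarith
  have h2 : 0 < t / b * (b - s) := mul_pos (by positivity) (by linarith)
  refine (Real.rpow_le_rpow_of_nonpos h2 h1 (by linarith)).trans (le_of_eq ?_)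
  rw [Real.mul_rpow (by positivity) (by linarith), Real.div_rpow ht.le hb.le, Real.rpow_neg hb.le,
    div_inv_eq_mul]

/-- A function on `[0, T]` with derivative `u'` whose first two derivatives blow up at most like
`s ^ (α - 1)` and `s ^ (α - 2)` at the initial time. -/
structure HasWeakSingularity (α T C : ℝ) (u u' : ℝ → ℝ) : Prop where
  continuousOn : ContinuousOn u (Icc 0 T)
  hasDerivAt : ∀ s ∈ Ioo 0 T, HasDerivAt u (u' s) s
  continuousOn_deriv : ContinuousOn u' (Ioc 0 T)
  deriv_le : ∀ s ∈ Ioc 0 T, |u' s| ≤ C * s ^ (α - 1)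
  deriv_sub_le : ∀ a b, 0 < a → a ≤ b → b ≤ T → |u' b - u' a| ≤ C * a ^ (α - 2) * (b - a)

variable {u u' : ℝ → ℝ} {C T : ℝ}

namespace HasWeakSingularity

lemma const_nonneg (h : HasWeakSingularity α T C u u') (hT : 0 < T) : 0 ≤ C := by
  have := (abs_nonneg _).trans (h.deriv_le T ⟨hT, le_rfl⟩)
  exact nonneg_of_mul_nonneg_left this (Real.rpow_pos_of_pos hT _)

lemma abs_mul_le (h : HasWeakSingularity α T C u u') (hα₀ : 0 < α) (hα₁ : α < 1)
    {t b : ℝ} (hT : 0 < T) (hb : 0 < b) (hbt : b ≤ t) (hbT : b ≤ T) {s : ℝ} (hs : s ∈ Ioo 0 b) :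
    |(t - s) ^ (-α) * u' s| ≤ t ^ (-α) * b ^ α * C *
      ((b / 2) ^ (-α) * s ^ (α - 1) + (b / 2) ^ (α - 1) * (b - s) ^ (-α)) := by
  have hC := h.const_nonneg hT
  have h0 : 0 ≤ (t - s) ^ (-α) := Real.rpow_nonneg (by linarith [hs.2]) _
  have hbs : 0 ≤ (b - s) ^ (-α) := Real.rpow_nonneg (by linarith [hs.2]) _
  have hs1 : 0 ≤ s ^ (α - 1) := Real.rpow_nonneg hs.1.le _
  have ht : 0 < t := by linarith
  rw [abs_mul, abs_of_nonneg h0]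
  calc (t - s) ^ (-α) * |u' s| ≤ (t ^ (-α) * b ^ α * (b - s) ^ (-α)) * (C * s ^ (α - 1)) := by
        gcongr
        · exact sub_rpow_le_mul hα₀ hb hbt hs.1.le hs.2
        · exact h.deriv_le s ⟨hs.1, by linarith [hs.2]⟩
    _ = t ^ (-α) * b ^ α * C * ((b - s) ^ (-α) * s ^ (α - 1)) := by ring
    _ ≤ _ := by
        gcongr
        exact sub_rpow_mul_rpow_le hα₀ hα₁ hs.1 hs.2.le

lemma intervalIntegrable_majorant (hα₀ : 0 < α) (hα₁ : α < 1) (b : ℝ) :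
    IntervalIntegrable (fun s => (b / 2) ^ (-α) * s ^ (α - 1) + (b / 2) ^ (α - 1) * (b - s) ^ (-α))
      MeasureTheory.volume 0 b :=
  ((intervalIntegral.intervalIntegrable_rpow' (by linarith)).const_mul _).add
    ((intervalIntegrable_sub_rpow hα₁ b 0 b).const_mul _)

lemma ae_mem_Ioo (b : ℝ) : ∀ᵐ s : ℝ, s ∈ Ioc 0 b → s ∈ Ioo 0 b := by
  have : ∀ᵐ s : ℝ, s ≠ b := by simp [MeasureTheory.ae_iff]
  filter_upwards [this] with s hs h
  exact ⟨h.1, lt_of_le_of_ne h.2 hs⟩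

lemma intervalIntegrable_mul (h : HasWeakSingularity α T C u u') (hα₀ : 0 < α) (hα₁ : α < 1)
    {t b : ℝ} (hT : 0 < T) (hb : 0 < b) (hbt : b ≤ t) (hbT : b ≤ T) :
    IntervalIntegrable (fun s => (t - s) ^ (-α) * u' s) MeasureTheory.volume 0 b := by
  have hm := (intervalIntegrable_majorant hα₀ hα₁ b).const_mul (t ^ (-α) * b ^ α * C)
  rw [intervalIntegrable_iff_integrableOn_Ioc_of_le hb.le] at hm ⊢
  refine MeasureTheory.Integrable.mono' hm ?_ ?_
  · refine MeasureTheory.AEStronglyMeasurable.mul ?_ ?_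
    · have := intervalIntegrable_sub_rpow hα₁ t 0 b
      rw [intervalIntegrable_iff_integrableOn_Ioc_of_le hb.le] at this
      exact this.aestronglyMeasurable
    · exact (h.continuousOn_deriv.mono (Ioc_subset_Ioc_right hbT)).aestronglyMeasurable
        measurableSet_Ioc
  · rw [MeasureTheory.ae_restrict_iff' measurableSet_Ioc]
    filter_upwards [ae_mem_Ioo b] with s hs hs'
    exact h.abs_mul_le hα₀ hα₁ hT hb hbt hbT (hs hs')

lemma intervalIntegrable_deriv (h : HasWeakSingularity α T C u u') (hα₀ : 0 < α) {b : ℝ}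
    (hb : 0 < b) (hbT : b ≤ T) : IntervalIntegrable u' MeasureTheory.volume 0 b := by
  have hm := (intervalIntegral.intervalIntegrable_rpow' (a := 0) (b := b)
    (show -1 < α - 1 by linarith)).const_mul C
  rw [intervalIntegrable_iff_integrableOn_Ioc_of_le hb.le] at hm ⊢
  refine MeasureTheory.Integrable.mono' hm
    ((h.continuousOn_deriv.mono (Ioc_subset_Ioc_right hbT)).aestronglyMeasurable
        measurableSet_Ioc) ?_
  rw [MeasureTheory.ae_restrict_iff' measurableSet_Ioc]
  exact Filter.Eventually.of_forall fun s hs => h.deriv_le s ⟨hs.1, hs.2.trans hbT⟩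

lemma abs_sub_initial_le (h : HasWeakSingularity α T C u u') (hα₀ : 0 < α) {b : ℝ}
    (hb : 0 < b) (hbT : b ≤ T) : |u b - u 0| ≤ C * (b ^ α / α) := by
  have hint := intervalIntegral.integral_eq_sub_of_hasDerivAt_of_le hb.le
    (h.continuousOn.mono (Icc_subset_Icc_right hbT))
    (fun s hs => h.hasDerivAt s ⟨hs.1, by linarith [hs.2]⟩) (h.intervalIntegrable_deriv hα₀ hb hbT)
  rw [← hint]
  have hm := (intervalIntegral.intervalIntegrable_rpow' (a := 0) (b := b)
    (show -1 < α - 1 by linarith)).const_mul C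
  have := intervalIntegral.norm_integral_le_of_norm_le (μ := MeasureTheory.volume) (f := u') hb.le
    (Filter.Eventually.of_forall fun s hs => h.deriv_le s ⟨hs.1, hs.2.trans hbT⟩) hm
  rw [intervalIntegral.integral_const_mul, integral_rpow (Or.inl (by linarith)),
    show α - 1 + 1 = α by ring, Real.zero_rpow hα₀.ne', sub_zero] at this
  exact this

/-- The local error of the L1 formula on the first interval. -/
lemma abs_first_local_error_le (h : HasWeakSingularity α T C u u') (hα₀ : 0 < α) (hα₁ : α < 1)
    {t b : ℝ} (hT : 0 < T) (hb : 0 < b) (hbt : b ≤ t) (hbT : b ≤ T) :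
    |(∫ s in (0 : ℝ)..b, (t - s) ^ (-α) * u' s) -
      (∫ s in (0 : ℝ)..b, (t - s) ^ (-α)) / (b - 0) * (u b - u 0)| ≤
      C * (3 / (α * (1 - α))) * (t ^ (-α) * b ^ α) := by
  have hC := h.const_nonneg hT
  have ht : 0 < t := by linarith
  have hα1 : 0 < 1 - α := by linarith
  have h1 : |∫ s in (0 : ℝ)..b, (t - s) ^ (-α) * u' s| ≤
      t ^ (-α) * b ^ α * C * (2 / α + 2 / (1 - α)) := by
    have hm := (intervalIntegrable_majorant hα₀ hα₁ b).const_mul (t ^ (-α) * b ^ α * C)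
    have := intervalIntegral.norm_integral_le_of_norm_le (μ := MeasureTheory.volume)
      (f := fun s => (t - s) ^ (-α) * u' s) hb.le
      (by
        filter_upwards [ae_mem_Ioo b] with s hs hs'
        exact h.abs_mul_le hα₀ hα₁ hT hb hbt hbT (hs hs')) hm
    rw [intervalIntegral.integral_const_mul] at this
    refine this.trans ?_
    gcongr
    exact integral_beta_majorant_le hα₀ hα₁ hb
  have h2 : |∫ s in (0 : ℝ)..b, (t - s) ^ (-α)| ≤ t ^ (-α) * b ^ α * (b ^ (1 - α) / (1 - α)) := by
    have hm := (intervalIntegrable_sub_rpow hα₁ b 0 b).const_mul (t ^ (-α) * b ^ α)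
    have := intervalIntegral.norm_integral_le_of_norm_le (μ := MeasureTheory.volume)
      (f := fun s => (t - s) ^ (-α)) hb.le
      (by
        filter_upwards [ae_mem_Ioo b] with s hs hs'
        have h0 : 0 ≤ (t - s) ^ (-α) := Real.rpow_nonneg (by linarith [(hs hs').2]) _
        rw [Real.norm_eq_abs, abs_of_nonneg h0]
        exact sub_rpow_le_mul hα₀ hb hbt hs'.1.le (hs hs').2) hm
    rw [intervalIntegral.integral_const_mul, integral_sub_rpow hα₁ b, sub_zero, sub_self,
      Real.zero_rpow (by linarith), sub_zero] at this
    exact this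
  have h3 := h.abs_sub_initial_le hα₀ hb hbT
  have h4 : |(∫ s in (0 : ℝ)..b, (t - s) ^ (-α)) / (b - 0) * (u b - u 0)| ≤
      t ^ (-α) * b ^ α * (b ^ (1 - α) / (1 - α)) / b * (C * (b ^ α / α)) := by
    rw [sub_zero, abs_mul, abs_div, abs_of_pos hb]
    gcongr
  have hbb : b ^ (1 - α) * b ^ α = b := by
    rw [← Real.rpow_add hb]; simp
  refine (abs_sub _ _).trans ((add_le_add h1 h4).trans (le_of_eq ?_))
  have e : t ^ (-α) * b ^ α * (b ^ (1 - α) / (1 - α)) / b * (C * (b ^ α / α)) =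
      t ^ (-α) * b ^ α * C * (b ^ (1 - α) * b ^ α) / (b * α * (1 - α)) := by
    field_simp
  rw [e, hbb]
  field_simp
  ring

lemma exists_slope_close (h : HasWeakSingularity α T C u u') (hα₁ : α < 1) {a b : ℝ} (hT : 0 < T)
    (ha : 0 < a) (hab : a < b) (hbT : b ≤ T) {s : ℝ} (hs : s ∈ Icc a b) :
    |u' s - (u b - u a) / (b - a)| ≤ C * a ^ (α - 2) * (b - a) := by
  have hC := h.const_nonneg hT
  obtain ⟨c, hc, hcs⟩ := exists_hasDerivAt_eq_slope u u' hab
    (h.continuousOn.mono (Icc_subset_Icc ha.le hbT))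
    (fun x hx => h.hasDerivAt x ⟨ha.trans hx.1, hx.2.trans_le hbT⟩)
  rw [← hcs]
  have key : ∀ x y, a ≤ x → x ≤ y → y ≤ b → |u' y - u' x| ≤ C * a ^ (α - 2) * (b - a) := by
    intro x y hx hxy hy
    refine (h.deriv_sub_le x y (by linarith) hxy (by linarith)).trans ?_
    have : x ^ (α - 2) ≤ a ^ (α - 2) := Real.rpow_le_rpow_of_nonpos ha hx (by linarith)
    have h0 : 0 ≤ x ^ (α - 2) := Real.rpow_nonneg (by linarith) _
    have : y - x ≤ b - a := by linarith
    have : 0 ≤ y - x := by linarith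
    gcongr
  rcases le_total c s with hcs | hcs
  · exact key c s hc.1.le hcs hs.2
  · rw [abs_sub_comm]
    exact key s c hs.1 hcs hc.2.le

/-- The local error of the L1 formula with an arbitrary shift of the weight. -/
lemma abs_local_error_shift_le (h : HasWeakSingularity α T C u u') (hα₁ : α < 1) {a b t W V : ℝ}
    (hT : 0 < T) (ha : 0 < a) (hab : a < b) (hbT : b ≤ T)
    (hW : ∫ s in a..b, |(t - s) ^ (-α) - W| ≤ V) :
    |(∫ s in a..b, (t - s) ^ (-α) * u' s) -
      (∫ s in a..b, (t - s) ^ (-α)) / (b - a) * (u b - u a)| ≤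
      C * a ^ (α - 2) * (b - a) * V := by
  have hC := h.const_nonneg hT
  set m := (u b - u a) / (b - a) with hm
  have hu'c : ContinuousOn u' (uIcc a b) := by
    rw [uIcc_of_le hab.le]
    exact h.continuousOn_deriv.mono fun x hx => ⟨ha.trans_le hx.1, hx.2.trans hbT⟩
  have hw := intervalIntegrable_sub_rpow hα₁ t a b
  have hint : ∫ s in a..b, u' s = u b - u a :=
    intervalIntegral.integral_eq_sub_of_hasDerivAt_of_le hab.le
      (h.continuousOn.mono (Icc_subset_Icc ha.le hbT))
      (fun s hs => h.hasDerivAt s ⟨ha.trans hs.1, hs.2.trans_le hbT⟩) hu'c.intervalIntegrable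
  have hba : b - a ≠ 0 := by linarith
  -- Since `u' - m` has mean zero on `[a, b]`, any constant `W` may be subtracted from the weight.
  have e : (∫ s in a..b, (t - s) ^ (-α) * u' s) -
      (∫ s in a..b, (t - s) ^ (-α)) / (b - a) * (u b - u a) =
      ∫ s in a..b, ((t - s) ^ (-α) - W) * (u' s - m) := by
    have e1 : ∀ s, ((t - s) ^ (-α) - W) * (u' s - m) =
        (t - s) ^ (-α) * u' s - (t - s) ^ (-α) * m - (W * u' s - W * m) := fun s => by ring
    simp only [e1]
    rw [intervalIntegral.integral_sub ((hw.mul_continuousOn hu'c).sub (hw.mul_const m))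
        ((hu'c.intervalIntegrable.const_mul W).sub intervalIntegrable_const),
      intervalIntegral.integral_sub (hw.mul_continuousOn hu'c) (hw.mul_const m),
      intervalIntegral.integral_sub (hu'c.intervalIntegrable.const_mul W) intervalIntegrable_const,
      intervalIntegral.integral_mul_const, intervalIntegral.integral_const_mul, hint,
      intervalIntegral.integral_const, smul_eq_mul, hm]
    field_simp
    ring
  rw [e]
  have hmaj : IntervalIntegrable (fun s => C * a ^ (α - 2) * (b - a) * |(t - s) ^ (-α) - W|)
      MeasureTheory.volume a b := ((hw.sub intervalIntegrable_const).abs).const_mul _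
  have := intervalIntegral.norm_integral_le_of_norm_le (μ := MeasureTheory.volume)
    (f := fun s => ((t - s) ^ (-α) - W) * (u' s - m)) hab.le
    (Filter.Eventually.of_forall fun s hs => by
      rw [Real.norm_eq_abs, abs_mul, mul_comm]
      exact mul_le_mul_of_nonneg_right (h.exists_slope_close hα₁ hT ha hab hbT ⟨hs.1.le, hs.2⟩)
        (abs_nonneg _)) hmaj
  rw [intervalIntegral.integral_const_mul] at this
  refine this.trans (mul_le_mul_of_nonneg_left hW ?_)
  have : 0 < b - a := by linarith
  positivity

/-- The local error of the L1 formula on an interval away from both end points. -/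
lemma abs_middle_local_error_le (h : HasWeakSingularity α T C u u') (hα₀ : 0 < α) (hα₁ : α < 1)
    {a b t : ℝ} (hT : 0 < T) (ha : 0 < a) (hab : a < b) (hbT : b ≤ T) (hbt : b < t) :
    |(∫ s in a..b, (t - s) ^ (-α) * u' s) -
      (∫ s in a..b, (t - s) ^ (-α)) / (b - a) * (u b - u a)| ≤
      C * a ^ (α - 2) * (b - a) * ((b - a) * ((t - b) ^ (-α) - (t - a) ^ (-α))) := by
  -- Shifting by the value at the left end turns the bound into an increment of the weight, which
  -- telescopes over the mesh.
  refine h.abs_local_error_shift_le hα₁ (W := (t - a) ^ (-α)) hT ha hab hbT ?_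
  have := intervalIntegral.norm_integral_le_of_norm_le_const (a := a) (b := b)
    (C := (t - b) ^ (-α) - (t - a) ^ (-α)) (f := fun s => |(t - s) ^ (-α) - (t - a) ^ (-α)|)
    (fun s hs => by
      rw [uIoc_of_le hab.le] at hs
      have h1 : (t - s) ^ (-α) ≤ (t - b) ^ (-α) :=
        Real.rpow_le_rpow_of_nonpos (by linarith) (by linarith [hs.2]) (by linarith)
      have h2 : (t - a) ^ (-α) ≤ (t - s) ^ (-α) :=
        Real.rpow_le_rpow_of_nonpos (by linarith [hs.2]) (by linarith [hs.1]) (by linarith)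
      rw [Real.norm_eq_abs, abs_abs, abs_of_nonneg (by linarith)]
      linarith)
  rw [abs_of_pos (by linarith : 0 < b - a), mul_comm] at this
  exact (le_abs_self _).trans this

/-- The local error of the L1 formula on the last interval. -/
lemma abs_last_local_error_le (h : HasWeakSingularity α T C u u') (hα₁ : α < 1)
    {a t : ℝ} (hT : 0 < T) (ha : 0 < a) (hat : a < t) (htT : t ≤ T) :
    |(∫ s in a..t, (t - s) ^ (-α) * u' s) -
      (∫ s in a..t, (t - s) ^ (-α)) / (t - a) * (u t - u a)| ≤
      C * a ^ (α - 2) * (t - a) * ((t - a) ^ (1 - α) / (1 - α)) := by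
  -- The weight is unbounded at `t`, so its increment is of no use here and its integral is taken
  -- instead.
  refine h.abs_local_error_shift_le hα₁ (W := 0) hT ha hat htT (le_of_eq ?_)
  rw [intervalIntegral.integral_congr (g := fun s => (t - s) ^ (-α)) fun s hs => ?_,
    integral_sub_rpow hα₁, sub_self, Real.zero_rpow (by linarith), sub_zero]
  rw [uIcc_of_le hat.le] at hs
  simp only [sub_zero]
  exact abs_of_nonneg (Real.rpow_nonneg (by linarith [hs.2]) _)

end HasWeakSingularity

end LocalErrors

/-! ### The truncation error of the L1 formula on the graded mesh -/

lemma sum_Icc_one_eq_sum_range (f : ℕ → ℝ) (n : ℕ) :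
    ∑ k ∈ Finset.Icc 1 n, f k = ∑ j ∈ Finset.range n, f (j + 1) := by
  induction n with
  | zero => simp
  | succ n ih => rw [Finset.sum_Icc_succ_top (by omega), ih, Finset.sum_range_succ]

section Truncation

variable {α T γ : ℝ} {M : ℕ}

lemma timeLevel_rpow (hT : 0 < T) (hM : 1 ≤ M) (k : ℕ) :
    timeLevel T γ M k ^ α = T ^ α * (M : ℝ) ^ (-(γ * α)) * (k : ℝ) ^ (γ * α) := by
  have : (0 : ℝ) < M := by exact_mod_cast hM
  unfold timeLevel
  rw [Real.mul_rpow hT.le (by positivity), ← Real.rpow_mul (by positivity),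
    Real.div_rpow (by positivity) (by positivity), Real.rpow_neg this.le]
  ring

/-- The weighted sum of the increments of the singular weight. -/
lemma sum_weight_increments_le (hα₀ : 0 < α) (hT : 0 < T) (hγ : 1 ≤ γ) (hM : 1 ≤ M) (p : ℕ) :
    ∑ j ∈ Finset.range p,
      ((timeLevel T γ M (p + 2) - timeLevel T γ M (j + 2)) ^ (-α) -
        (timeLevel T γ M (p + 2) - timeLevel T γ M (j + 1)) ^ (-α)) * ((j + 2 : ℕ) : ℝ) ^ (-α) ≤
      2 * 2 ^ α * timeLevel T γ M (p + 2) ^ (-α) := by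
  set τ := timeLevel T γ M (p + 2) with hτ
  have hτ0 : 0 < τ := timeLevel_pos hT hM (by omega)
  set w : ℕ → ℝ := fun j => (τ - timeLevel T γ M (j + 1)) ^ (-α) with hw
  set B : ℝ := 2 ^ α * τ ^ (-α) with hB
  set n : ℝ := ((p + 2 : ℕ) : ℝ) with hn
  have hn0 : 0 < n := by rw [hn]; positivity
  have hlt : ∀ j ≤ p, 0 < τ - timeLevel T γ M (j + 1) := fun j hj =>
    sub_pos.2 (timeLevel_lt_timeLevel hT hγ hM (by omega))
  have hmono : ∀ j < p, w j ≤ w (j + 1) := by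
    intro j hj
    refine Real.rpow_le_rpow_of_nonpos (hlt (j + 1) hj) ?_ (by linarith)
    have := timeLevel_le_timeLevel (M := M) hT hγ (Nat.le_succ (j + 1))
    linarith
  -- Two regimes in one telescoping bound. In the first half of the indices `τ - τ_k ≥ τ/2`, so `w`
  -- stays below `B` and truncation at `B` changes nothing. In the second half `k^{-α} ≤ 2^α
  -- n^{-α}`, which offsets the growth of `w` up to `(τ/n)^{-α}`.
  have hterm : ∀ j ∈ Finset.range p, (w (j + 1) - w j) * ((j + 2 : ℕ) : ℝ) ^ (-α) ≤
      (min (w (j + 1)) B - min (w j) B) + 2 ^ α * n ^ (-α) * (w (j + 1) - w j) := by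
    intro j hj
    rw [Finset.mem_range] at hj
    have hd : 0 ≤ w (j + 1) - w j := by linarith [hmono j hj]
    have hk0 : (0 : ℝ) < ((j + 2 : ℕ) : ℝ) := by positivity
    rcases le_total (2 * ((j + 2 : ℕ) : ℝ)) n with h | h
    · have hk1 : ((j + 2 : ℕ) : ℝ) ^ (-α) ≤ 1 :=
        Real.rpow_le_one_of_one_le_of_nonpos (by push_cast; linarith [(Nat.cast_nonneg j : (0 : ℝ) ≤ j)])
          (by linarith)
      have hwB : w (j + 1) ≤ B := by
        have h1 : timeLevel T γ M (j + 2) ≤ τ * (((j + 2 : ℕ) : ℝ) / n) :=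
          timeLevel_le_mul hT hγ hM (by omega) (by omega)
        have h2 : ((j + 2 : ℕ) : ℝ) / n ≤ 1 / 2 := by
          rw [div_le_div_iff₀ hn0 (by norm_num)]; linarith
        have h3 : τ / 2 ≤ τ - timeLevel T γ M (j + 2) := by nlinarith
        have : w (j + 1) ≤ (τ / 2) ^ (-α) :=
          Real.rpow_le_rpow_of_nonpos (by linarith) h3 (by linarith)
        refine this.trans (le_of_eq ?_)
        rw [Real.div_rpow hτ0.le (by norm_num), Real.rpow_neg (by norm_num : (0 : ℝ) ≤ 2),
          div_inv_eq_mul, mul_comm]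
      rw [min_eq_left hwB, min_eq_left ((hmono j hj).trans hwB)]
      have : 0 ≤ 2 ^ α * n ^ (-α) * (w (j + 1) - w j) := by positivity
      nlinarith
    · have h1 : ((j + 2 : ℕ) : ℝ) ^ (-α) ≤ (n / 2) ^ (-α) :=
        Real.rpow_le_rpow_of_nonpos (by linarith) (by linarith) (by linarith)
      rw [Real.div_rpow hn0.le (by norm_num), Real.rpow_neg (by norm_num : (0 : ℝ) ≤ 2),
          div_inv_eq_mul, mul_comm] at h1
      have h2 : min (w j) B ≤ min (w (j + 1)) B := min_le_min_right _ (hmono j hj)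
      nlinarith
  have hsum := Finset.sum_le_sum hterm
  rw [Finset.sum_add_distrib, ← Finset.mul_sum, Finset.sum_range_sub (fun j => min (w j) B),
    Finset.sum_range_sub w] at hsum
  refine hsum.trans ?_
  have hw0 : 0 ≤ w 0 := Real.rpow_nonneg (hlt 0 (Nat.zero_le _)).le _
  have hB0 : 0 ≤ B := by positivity
  have hmin0 : 0 ≤ min (w 0) B := le_min hw0 hB0
  have hwp : w p ≤ n ^ α * τ ^ (-α) := by
    have h1 : timeLevel T γ M (p + 1) ≤ τ * (((p + 1 : ℕ) : ℝ) / n) :=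
      timeLevel_le_mul hT hγ hM (by omega) (by omega)
    have h2 : ((p + 1 : ℕ) : ℝ) / n = 1 - 1 / n := by
      rw [eq_sub_iff_add_eq, ← add_div, div_eq_one_iff_eq hn0.ne', hn]
      push_cast; ring
    have h3 : τ / n ≤ τ - timeLevel T γ M (p + 1) := by
      rw [h2] at h1
      have : τ * (1 - 1 / n) = τ - τ / n := by ring
      linarith
    have : w p ≤ (τ / n) ^ (-α) :=
      Real.rpow_le_rpow_of_nonpos (by positivity) h3 (by linarith)
    refine this.trans (le_of_eq ?_)
    rw [Real.div_rpow hτ0.le hn0.le, Real.rpow_neg hn0.le, div_inv_eq_mul, mul_comm]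
  have hnn : n ^ (-α) * n ^ α = 1 := by
    rw [← Real.rpow_add hn0, neg_add_cancel, Real.rpow_zero]
  have h5 : 2 ^ α * n ^ (-α) * (w p - w 0) ≤ 2 ^ α * τ ^ (-α) := by
    calc 2 ^ α * n ^ (-α) * (w p - w 0) ≤ 2 ^ α * n ^ (-α) * (n ^ α * τ ^ (-α)) := by
          have : 0 ≤ (2 : ℝ) ^ α * n ^ (-α) := by positivity
          exact mul_le_mul_of_nonneg_left (by linarith) this
      _ = 2 ^ α * τ ^ (-α) * (n ^ (-α) * n ^ α) := by ring
      _ = _ := by rw [hnn, mul_one]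
  have := min_le_right (w p) B
  rw [hB] at this
  linarith

lemma timeLevel_rpow_sub_two_le (hα₀ : 0 < α) (hα₁ : α < 1) (hT : 0 < T) (hγ : 1 ≤ γ) (hM : 1 ≤ M)
    {k : ℕ} (hk : 1 ≤ k) :
    timeLevel T γ M k ^ (α - 2) ≤ 4 ^ γ * timeLevel T γ M (k + 1) ^ (α - 2) := by
  have hk1 := timeLevel_pos (γ := γ) hT hM (Nat.le_add_left 1 k)
  have h4 : timeLevel T γ M (k + 1) / 2 ^ γ ≤ timeLevel T γ M k := by
    rw [div_le_iff₀ (by positivity), mul_comm]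
    exact timeLevel_le_two_rpow_mul hT hγ hM hk
  refine (Real.rpow_le_rpow_of_nonpos (by positivity) h4 (by linarith)).trans ?_
  rw [Real.div_rpow hk1.le (by positivity), show α - 2 = -(2 - α) by ring,
    Real.rpow_neg (show (0 : ℝ) ≤ 2 ^ γ by positivity), div_inv_eq_mul, mul_comm]
  refine mul_le_mul_of_nonneg_right ?_ (by positivity)
  rw [show (4 : ℝ) = 2 ^ (2 : ℝ) by norm_num, ← Real.rpow_mul (by norm_num),
    ← Real.rpow_mul (by norm_num)]
  refine Real.rpow_le_rpow_of_exponent_le (by norm_num) ?_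
  nlinarith

lemma step_sq_mul_le (hα₀ : 0 < α) (hα₁ : α < 1) (hT : 0 < T) (hγ : 1 ≤ γ) (hM : 1 ≤ M) {k : ℕ}
    (hk : 1 ≤ k) :
    timeLevel T γ M k ^ (α - 2) *
      (timeLevel T γ M (k + 1) - timeLevel T γ M k) ^ 2 ≤
      4 ^ γ * γ ^ 2 * (timeLevel T γ M (k + 1) ^ α * ((k + 1 : ℕ) : ℝ) ^ (-2 : ℝ)) := by
  have hk1 := timeLevel_pos (γ := γ) hT hM (Nat.le_add_left 1 k)
  set t := timeLevel T γ M (k + 1)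
  have h1 := timeLevel_sub_le hT hγ hM (Nat.le_add_left 1 k)
  rw [Nat.add_sub_cancel] at h1
  have h2 : timeLevel T γ M k ^ (α - 2) ≤ 4 ^ γ * t ^ (α - 2) :=
    timeLevel_rpow_sub_two_le hα₀ hα₁ hT hγ hM hk
  have h0 : 0 ≤ t - timeLevel T γ M k :=
    sub_nonneg.2 (timeLevel_le_timeLevel hT hγ (Nat.le_succ k))
  have hk2 : (0 : ℝ) < ((k + 1 : ℕ) : ℝ) := by positivity
  calc _ ≤ 4 ^ γ * t ^ (α - 2) * (γ * t / ((k + 1 : ℕ) : ℝ)) ^ 2 := by gcongr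
    _ = 4 ^ γ * γ ^ 2 * (t ^ (α - 2) * t ^ 2 / ((k + 1 : ℕ) : ℝ) ^ 2) := by
        field_simp
    _ = _ := by
        rw [← Real.rpow_natCast t 2, ← Real.rpow_add hk1, Real.rpow_neg hk2.le, div_eq_mul_inv]
        norm_num

/-- With `m` the minimum, split `k^{γα-2} = k^{γα-m} k^{m-2}`. The first factor is at most
`M^{γα-m}`, and `m ≤ 2 - α` turns the second into `k^{-α}`, the decay needed for the weighted sum of
increments. -/
lemma timeLevel_rpow_mul_rpow_le (hT : 0 < T) (hM : 1 ≤ M) {k : ℕ}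
    (hk : 1 ≤ k) (hkM : k ≤ M) :
    timeLevel T γ M k ^ α * (k : ℝ) ^ (-2 : ℝ) ≤
      T ^ α * (M : ℝ) ^ (-min (γ * α) (2 - α)) * (k : ℝ) ^ (-α) := by
  have hM0 : (0 : ℝ) < M := by exact_mod_cast hM
  have hk0 : (0 : ℝ) < k := by exact_mod_cast hk
  have hk1 : (1 : ℝ) ≤ k := by exact_mod_cast hk
  have hkM' : (k : ℝ) ≤ M := by exact_mod_cast hkM
  set m := min (γ * α) (2 - α) with hm
  have hm1 : m ≤ γ * α := min_le_left _ _
  have hm2 : m ≤ 2 - α := min_le_right _ _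
  rw [timeLevel_rpow hT hM]
  have h1 : (k : ℝ) ^ (γ * α) * (k : ℝ) ^ (-2 : ℝ) = (k : ℝ) ^ (γ * α - m) * (k : ℝ) ^ (m - 2) := by
    rw [← Real.rpow_add hk0, ← Real.rpow_add hk0]; congr 1; ring
  have h2 : (k : ℝ) ^ (γ * α - m) ≤ (M : ℝ) ^ (γ * α - m) :=
    Real.rpow_le_rpow hk0.le hkM' (by linarith)
  have h3 : (k : ℝ) ^ (m - 2) ≤ (k : ℝ) ^ (-α) :=
    Real.rpow_le_rpow_of_exponent_le hk1 (by linarith)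
  have h4 : (M : ℝ) ^ (-(γ * α)) * (M : ℝ) ^ (γ * α - m) = (M : ℝ) ^ (-m) := by
    rw [← Real.rpow_add hM0]; congr 1; ring
  calc _ = T ^ α * (M : ℝ) ^ (-(γ * α)) * ((k : ℝ) ^ (γ * α) * (k : ℝ) ^ (-2 : ℝ)) := by ring
    _ ≤ T ^ α * (M : ℝ) ^ (-(γ * α)) * ((M : ℝ) ^ (γ * α - m) * (k : ℝ) ^ (-α)) := by
        rw [h1]; gcongr
    _ = T ^ α * ((M : ℝ) ^ (-(γ * α)) * (M : ℝ) ^ (γ * α - m)) * (k : ℝ) ^ (-α) := by ring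
    _ = _ := by rw [h4]

/-- Puts the error of the last step, naturally of size `n^{-(2-α)}`, into the same form `τ_n^{-α}
M^{-m}` as the others. -/
lemma rpow_neg_le_of_le (hT : 0 < T) (hM : 1 ≤ M) {n : ℕ}
    (hn : 1 ≤ n) (hnM : n ≤ M) :
    (n : ℝ) ^ (-(2 - α)) ≤
      T ^ α * (timeLevel T γ M n ^ (-α) * (M : ℝ) ^ (-min (γ * α) (2 - α))) := by
  have hM0 : (0 : ℝ) < M := by exact_mod_cast hM
  have hn0 : (0 : ℝ) < n := by exact_mod_cast hn
  have hn1 : (1 : ℝ) ≤ n := by exact_mod_cast hn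
  have hnM' : (n : ℝ) ≤ M := by exact_mod_cast hnM
  set m := min (γ * α) (2 - α) with hm
  have hm1 : m ≤ γ * α := min_le_left _ _
  have hm2 : m ≤ 2 - α := min_le_right _ _
  have hτ := timeLevel_pos (γ := γ) hT hM hn
  rw [Real.rpow_neg hτ.le, timeLevel_rpow hT hM]
  have e : T ^ α * ((T ^ α * (M : ℝ) ^ (-(γ * α)) * (n : ℝ) ^ (γ * α))⁻¹ * (M : ℝ) ^ (-m)) =
      (M : ℝ) ^ (γ * α - m) * (n : ℝ) ^ (-(γ * α)) := by
    have : T ^ α ≠ 0 := (Real.rpow_pos_of_pos hT _).ne'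
    rw [Real.rpow_neg hM0.le (γ * α), Real.rpow_neg hn0.le (γ * α), sub_eq_add_neg,
      Real.rpow_add hM0, mul_inv, mul_inv, inv_inv]
    field_simp
  rw [e]
  have h2 : (n : ℝ) ^ (γ * α - m) ≤ (M : ℝ) ^ (γ * α - m) :=
    Real.rpow_le_rpow hn0.le hnM' (by linarith)
  calc (n : ℝ) ^ (-(2 - α)) ≤ (n : ℝ) ^ (-m) :=
        Real.rpow_le_rpow_of_exponent_le hn1 (by linarith)
    _ = (n : ℝ) ^ (γ * α - m) * (n : ℝ) ^ (-(γ * α)) := by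
        rw [← Real.rpow_add hn0]; congr 1; ring
    _ ≤ _ := by gcongr

/-- The constant of the truncation error of the L1 formula. -/
def truncationConst (α T γ : ℝ) : ℝ :=
  T ^ α * (3 / (α * (1 - α)) + 2 * 2 ^ α * (4 ^ γ * γ ^ 2) + 4 ^ γ * γ ^ 2 / (1 - α))

lemma truncationConst_pos (hα₀ : 0 < α) (hα₁ : α < 1) (hT : 0 < T) :
    0 < truncationConst α T γ := by
  have : 0 < 1 - α := by linarith
  unfold truncationConst
  positivity

/-- The truncation error of the L1 formula on the graded mesh. -/
theorem HasWeakSingularity.abs_truncation_error_le {C : ℝ} {u u' : ℝ → ℝ}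
    (h : HasWeakSingularity α T C u u') (hα₀ : 0 < α) (hα₁ : α < 1) (hT : 0 < T) (hγ : 1 ≤ γ)
    (hM : 1 ≤ M) {n : ℕ} (hn : 1 ≤ n) (hnM : n ≤ M) :
    |(∫ s in (0 : ℝ)..timeLevel T γ M n, (timeLevel T γ M n - s) ^ (-α) * u' s) -
      ∑ k ∈ Finset.Icc 1 n, l1Coeff α T γ M n k *
        (u (timeLevel T γ M k) - u (timeLevel T γ M (k - 1)))| ≤
      truncationConst α T γ * C *
        (timeLevel T γ M n ^ (-α) * (M : ℝ) ^ (-min (γ * α) (2 - α))) := by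
  have hC := h.const_nonneg hT
  set t := timeLevel T γ M with ht
  set τ := t n with hτ
  have hα1 : 0 < 1 - α := by linarith
  have hM0 : (0 : ℝ) < M := by exact_mod_cast hM
  have hτ0 : 0 < τ := timeLevel_pos hT hM hn
  have hτT : τ ≤ T := timeLevel_le hT hγ hM hnM
  have ht0 : t 0 = 0 := timeLevel_zero T hγ M
  have hlt : ∀ {j k : ℕ}, j < k → t j < t k := fun hjk => timeLevel_lt_timeLevel hT hγ hM hjk
  have hle : ∀ {j k : ℕ}, j ≤ k → t j ≤ t k := fun hjk => timeLevel_le_timeLevel hT hγ hjk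
  set m := min (γ * α) (2 - α) with hm
  set loc : ℕ → ℝ := fun j => (∫ s in (t j)..(t (j + 1)), (τ - s) ^ (-α) * u' s) -
    (∫ s in (t j)..(t (j + 1)), (τ - s) ^ (-α)) / (t (j + 1) - t j) * (u (t (j + 1)) - u (t j))
    with hloc
  have hfull := h.intervalIntegrable_mul hα₀ hα₁ (t := τ) hT hτ0 le_rfl hτT
  have hsplit : (∫ s in (0 : ℝ)..τ, (τ - s) ^ (-α) * u' s) =
      ∑ j ∈ Finset.range n, ∫ s in (t j)..(t (j + 1)), (τ - s) ^ (-α) * u' s := by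
    rw [intervalIntegral.sum_integral_adjacent_intervals, ht0]
    intro k hk
    refine hfull.mono_set ?_
    rw [uIcc_of_le (hle (Nat.le_succ k)), uIcc_of_le hτ0.le]
    exact Icc_subset_Icc (timeLevel_nonneg hT k) (hle hk)
  have herr : (∫ s in (0 : ℝ)..τ, (τ - s) ^ (-α) * u' s) -
      ∑ k ∈ Finset.Icc 1 n, l1Coeff α T γ M n k * (u (t k) - u (t (k - 1))) =
      ∑ j ∈ Finset.range n, loc j := by
    rw [hsplit, sum_Icc_one_eq_sum_range, ← Finset.sum_sub_distrib]
    exact Finset.sum_congr rfl fun j _ => rfl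
  rw [herr]
  have hτα : 0 < τ ^ (-α) := Real.rpow_pos_of_pos hτ0 _
  have hMm : 0 < (M : ℝ) ^ (-m) := Real.rpow_pos_of_pos hM0 _
  have hTα : 0 < T ^ α := Real.rpow_pos_of_pos hT _
  set D := τ ^ (-α) * (M : ℝ) ^ (-m) with hD
  have hD0 : 0 < D := by positivity
  have hfirst : |loc 0| ≤ T ^ α * (3 / (α * (1 - α))) * C * D := by
    have h1 := h.abs_first_local_error_le hα₀ hα₁ (t := τ) (b := t 1) hT
      (timeLevel_pos hT hM le_rfl) (hle hn) (timeLevel_le hT hγ hM (hn.trans hnM))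
    simp only [hloc, zero_add, ht0]
    refine h1.trans ?_
    have h2 : t 1 ^ α ≤ T ^ α * (M : ℝ) ^ (-m) := by
      rw [ht, timeLevel_rpow hT hM, Nat.cast_one, Real.one_rpow, mul_one]
      refine mul_le_mul_of_nonneg_left (Real.rpow_le_rpow_of_exponent_le (by exact_mod_cast hM) ?_)
        hTα.le
      rw [neg_le_neg_iff]
      exact min_le_left _ _
    calc C * (3 / (α * (1 - α))) * (τ ^ (-α) * t 1 ^ α)
        ≤ C * (3 / (α * (1 - α))) * (τ ^ (-α) * (T ^ α * (M : ℝ) ^ (-m))) := by gcongr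
      _ = _ := by rw [hD]; ring
  rcases hn.eq_or_lt with rfl | hn2
  · rw [Finset.sum_range_one]
    refine hfirst.trans ?_
    unfold truncationConst
    have : 0 ≤ 2 * 2 ^ α * (4 ^ γ * γ ^ 2) + 4 ^ γ * γ ^ 2 / (1 - α) := by positivity
    gcongr
    linarith
  obtain ⟨p, rfl⟩ : ∃ p, n = p + 2 := ⟨n - 2, by omega⟩
  have hlast : |loc (p + 1)| ≤ T ^ α * (4 ^ γ * γ ^ 2 / (1 - α)) * C * D := by
    have hpos : 0 < t (p + 1) := timeLevel_pos hT hM (by omega)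
    have h1 := h.abs_last_local_error_le hα₁ hT hpos (hlt (Nat.lt_succ_self (p + 1))) hτT
    refine h1.trans ?_
    have hΔ : 0 < τ - t (p + 1) := sub_pos.2 (hlt (Nat.lt_succ_self (p + 1)))
    have h3 := rpow_neg_le_of_le (α := α) (γ := γ) hT hM hn hnM
    have hΔle : τ - t (p + 1) ≤ γ * τ / ((p + 2 : ℕ) : ℝ) :=
      timeLevel_sub_le hT hγ hM (k := p + 2) (by omega)
    have hn0 : (0 : ℝ) < ((p + 2 : ℕ) : ℝ) := by positivity
    have h4 : t (p + 1) ^ (α - 2) * ((τ - t (p + 1)) * (τ - t (p + 1)) ^ (1 - α)) ≤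
        4 ^ γ * γ ^ 2 * ((p + 2 : ℕ) : ℝ) ^ (-(2 - α)) := by
      have e1 : (τ - t (p + 1)) * (τ - t (p + 1)) ^ (1 - α) = (τ - t (p + 1)) ^ (2 - α) := by
        nth_rewrite 1 [← Real.rpow_one (τ - t (p + 1))]
        rw [← Real.rpow_add hΔ]; congr 1; ring
      have h5 : t (p + 1) ^ (α - 2) ≤ 4 ^ γ * τ ^ (α - 2) :=
        timeLevel_rpow_sub_two_le hα₀ hα₁ hT hγ hM (by omega)
      have h8 : (τ - t (p + 1)) ^ (2 - α) ≤ γ ^ 2 * τ ^ (2 - α) * ((p + 2 : ℕ) : ℝ) ^ (-(2 - α)) := by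
        refine (Real.rpow_le_rpow hΔ.le hΔle (by linarith)).trans ?_
        rw [Real.div_rpow (by positivity) hn0.le, Real.mul_rpow (by linarith) hτ0.le,
          Real.rpow_neg hn0.le, div_eq_mul_inv]
        have : γ ^ (2 - α) ≤ γ ^ 2 := by
          rw [← Real.rpow_natCast γ 2]
          exact Real.rpow_le_rpow_of_exponent_le hγ (by push_cast; linarith)
        gcongr
      have e2 : τ ^ (α - 2) * τ ^ (2 - α) = 1 := by
        rw [← Real.rpow_add hτ0]; simp
      rw [e1]
      calc _ ≤ 4 ^ γ * τ ^ (α - 2) * (γ ^ 2 * τ ^ (2 - α) * ((p + 2 : ℕ) : ℝ) ^ (-(2 - α))) := by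
            gcongr
        _ = 4 ^ γ * γ ^ 2 * ((p + 2 : ℕ) : ℝ) ^ (-(2 - α)) * (τ ^ (α - 2) * τ ^ (2 - α)) := by ring
        _ = _ := by rw [e2, mul_one]
    calc C * t (p + 1) ^ (α - 2) * (τ - t (p + 1)) * ((τ - t (p + 1)) ^ (1 - α) / (1 - α))
        = C / (1 - α) * (t (p + 1) ^ (α - 2) * ((τ - t (p + 1)) * (τ - t (p + 1)) ^ (1 - α))) := by
          ring
      _ ≤ C / (1 - α) * (4 ^ γ * γ ^ 2 * (T ^ α * D)) := by
          refine mul_le_mul_of_nonneg_left (h4.trans ?_) (by positivity)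
          exact mul_le_mul_of_nonneg_left h3 (by positivity)
      _ = _ := by ring
  have hmid : |∑ j ∈ Finset.range p, loc (j + 1)| ≤
      T ^ α * (2 * 2 ^ α * (4 ^ γ * γ ^ 2)) * C * D := by
    refine (Finset.abs_sum_le_sum_abs _ _).trans ?_
    have hterm : ∀ j ∈ Finset.range p, |loc (j + 1)| ≤
        C * (4 ^ γ * γ ^ 2) * (T ^ α * (M : ℝ) ^ (-m)) *
          (((τ - t (j + 2)) ^ (-α) - (τ - t (j + 1)) ^ (-α)) * ((j + 2 : ℕ) : ℝ) ^ (-α)) := by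
      intro j hj
      rw [Finset.mem_range] at hj
      have h1 := h.abs_middle_local_error_le hα₀ hα₁ (t := τ) hT
        (timeLevel_pos (γ := γ) (M := M) hT hM (k := j + 1) (by omega))
        (hlt (Nat.lt_succ_self (j + 1))) (timeLevel_le hT hγ hM (by omega)) (hlt (by omega))
      refine h1.trans ?_
      have h2 := step_sq_mul_le hα₀ hα₁ hT hγ hM (k := j + 1) (by omega)
      have h3 := timeLevel_rpow_mul_rpow_le (α := α) (γ := γ) hT hM (k := j + 2) (by omega) (by omega)
      have hw : 0 ≤ (τ - t (j + 2)) ^ (-α) - (τ - t (j + 1)) ^ (-α) := by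
        have a1 : t (j + 2) < τ := hlt (by omega)
        have a2 : t (j + 1) ≤ t (j + 2) := hle (by omega)
        have : (τ - t (j + 1)) ^ (-α) ≤ (τ - t (j + 2)) ^ (-α) :=
          Real.rpow_le_rpow_of_nonpos (by linarith) (by linarith) (by linarith)
        linarith
      have h4 : t (j + 1) ^ (α - 2) * (t (j + 2) - t (j + 1)) ^ 2 ≤
          4 ^ γ * γ ^ 2 * (T ^ α * (M : ℝ) ^ (-m) * ((j + 2 : ℕ) : ℝ) ^ (-α)) :=
        h2.trans (mul_le_mul_of_nonneg_left h3 (by positivity))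
      calc _ = C * ((τ - t (j + 2)) ^ (-α) - (τ - t (j + 1)) ^ (-α)) *
            (t (j + 1) ^ (α - 2) * (t (j + 2) - t (j + 1)) ^ 2) := by
            simp only [Nat.succ_eq_add_one, ht]; ring
        _ ≤ C * ((τ - t (j + 2)) ^ (-α) - (τ - t (j + 1)) ^ (-α)) *
            (4 ^ γ * γ ^ 2 * (T ^ α * (M : ℝ) ^ (-m) * ((j + 2 : ℕ) : ℝ) ^ (-α))) :=
            mul_le_mul_of_nonneg_left h4 (by positivity)
        _ = _ := by ring
    refine (Finset.sum_le_sum hterm).trans ?_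
    rw [← Finset.mul_sum]
    have h5 := sum_weight_increments_le hα₀ hT hγ hM p
    calc _ ≤ C * (4 ^ γ * γ ^ 2) * (T ^ α * (M : ℝ) ^ (-m)) * (2 * 2 ^ α * τ ^ (-α)) :=
          mul_le_mul_of_nonneg_left h5 (by positivity)
      _ = _ := by rw [hD]; ring
  rw [Finset.sum_range_succ, Finset.sum_range_succ']
  refine (abs_add_le _ _).trans ((add_le_add ((abs_add_le _ _).trans (add_le_add hmid hfirst))
    hlast).trans (le_of_eq ?_))
  unfold truncationConst
  ring

end Truncation

/-! ### The coefficients of the L1 formula -/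

section Coefficients

variable {α T γ : ℝ} {M : ℕ}

lemma l1Coeff_le (hα₀ : 0 < α) (hα₁ : α < 1) (hT : 0 < T) (hγ : 1 ≤ γ) (hM : 1 ≤ M) {n k : ℕ}
    (hk : 1 ≤ k) (hkn : k < n) :
    l1Coeff α T γ M n k ≤ (timeLevel T γ M n - timeLevel T γ M k) ^ (-α) := by
  have h1 : timeLevel T γ M (k - 1) < timeLevel T γ M k :=
    timeLevel_lt_timeLevel hT hγ hM (by omega)
  have h2 : timeLevel T γ M k < timeLevel T γ M n := timeLevel_lt_timeLevel hT hγ hM hkn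
  unfold l1Coeff
  rw [div_le_iff₀ (by linarith), mul_comm]
  have := intervalIntegral.integral_mono_on h1.le
    (intervalIntegrable_sub_rpow hα₁ (timeLevel T γ M n) _ _)
    (intervalIntegrable_const (c := (timeLevel T γ M n - timeLevel T γ M k) ^ (-α)))
    (fun s hs => Real.rpow_le_rpow_of_nonpos (by linarith) (by linarith [hs.2]) (by linarith))
  rwa [intervalIntegral.integral_const, smul_eq_mul] at this

lemma le_l1Coeff (hα₀ : 0 < α) (hα₁ : α < 1) (hT : 0 < T) (hγ : 1 ≤ γ) (hM : 1 ≤ M) {n k : ℕ}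
    (hkn : k < n) :
    (timeLevel T γ M n - timeLevel T γ M k) ^ (-α) ≤ l1Coeff α T γ M n (k + 1) := by
  have h1 : timeLevel T γ M k < timeLevel T γ M (k + 1) :=
    timeLevel_lt_timeLevel hT hγ hM (by omega)
  have h2 : timeLevel T γ M (k + 1) ≤ timeLevel T γ M n := timeLevel_le_timeLevel hT hγ hkn
  unfold l1Coeff
  rw [Nat.add_sub_cancel, le_div_iff₀ (by linarith), mul_comm]
  have := intervalIntegral.integral_mono_on_of_le_Ioo h1.le
    (intervalIntegrable_const (c := (timeLevel T γ M n - timeLevel T γ M k) ^ (-α)))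
    (intervalIntegrable_sub_rpow hα₁ (timeLevel T γ M n) _ _)
    (fun s hs => Real.rpow_le_rpow_of_nonpos (by linarith [hs.2]) (by linarith [hs.1])
      (by linarith))
  rwa [intervalIntegral.integral_const, smul_eq_mul] at this

/-- The coefficients are averages of an increasing weight over consecutive intervals, so its value
at the common node separates them. -/
lemma l1Coeff_mono (hα₀ : 0 < α) (hα₁ : α < 1) (hT : 0 < T) (hγ : 1 ≤ γ) (hM : 1 ≤ M) {n k : ℕ}
    (hk : 1 ≤ k) (hkn : k < n) : l1Coeff α T γ M n k ≤ l1Coeff α T γ M n (k + 1) :=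
  (l1Coeff_le hα₀ hα₁ hT hγ hM hk hkn).trans (le_l1Coeff hα₀ hα₁ hT hγ hM hkn)

lemma timeLevel_rpow_neg_le_l1Coeff_one (hα₀ : 0 < α) (hα₁ : α < 1) (hT : 0 < T) (hγ : 1 ≤ γ)
    (hM : 1 ≤ M) {n : ℕ} (hn : 1 ≤ n) : timeLevel T γ M n ^ (-α) ≤ l1Coeff α T γ M n 1 := by
  have := le_l1Coeff hα₀ hα₁ hT hγ hM (k := 0) hn
  rwa [timeLevel_zero T hγ M, sub_zero] at this

end Coefficients

/-! ### Consistency of the scheme -/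

/-- The derivative of `s ↦ e^{lam s} w s` on `(0, T]`. -/
def temperedDeriv (lam T : ℝ) (w : ℝ → ℝ) (s : ℝ) : ℝ :=
  Real.exp (lam * s) * (lam * w s + iteratedDerivWithin 1 w (Ioc 0 T) s)

section Consistency

variable {α lam T : ℝ} {w : ℝ → ℝ} {C : ℝ}

/-- The factor between the bound on `w` and that on `s ↦ e^{lam s} w s`. -/
def temperingConst (α lam T : ℝ) : ℝ :=
  Real.exp (lam * T) * (lam * T ^ (1 - α) + T ^ (1 - α) + 1 + (lam ^ 2 * T ^ (2 - α) +
    2 * lam * (T ^ (2 - α) + T) + T ^ (2 - α) + 1))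

lemma one_le_rpow_mul_rpow {p s : ℝ} (hp : 0 ≤ p) (hs : 0 < s) (hsT : s ≤ T) :
    1 ≤ T ^ p * s ^ (-p) := by
  rw [Real.rpow_neg hs.le, ← div_eq_mul_inv, one_le_div (Real.rpow_pos_of_pos hs _)]
  exact Real.rpow_le_rpow hs.le hsT hp

lemma hasWeakSingularity_tempered (hα₁ : α < 1) (hlam : 0 ≤ lam) (hT : 0 < T)
    (hw : ContinuousOn w (Icc 0 T)) (hw2 : ContDiffOn ℝ 2 w (Ioc 0 T))
    (hC0 : ∀ s ∈ Ioc 0 T, |w s| ≤ C)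
    (hC : ∀ s ∈ Ioc 0 T, ∀ l : ℕ, l ≤ 2 →
      |iteratedDerivWithin l w (Ioc 0 T) s| ≤ C * (1 + s ^ (α - (l : ℝ)))) :
    HasWeakSingularity α T (C * temperingConst α lam T) (fun s => Real.exp (lam * s) * w s)
      (temperedDeriv lam T w) := by
  have hCnn : 0 ≤ C := (abs_nonneg _).trans (hC0 T ⟨hT, le_rfl⟩)
  have hu : UniqueDiffOn ℝ (Ioc 0 T) := uniqueDiffOn_Ioc 0 T
  have hexp : ∀ s, HasDerivAt (fun s => Real.exp (lam * s)) (lam * Real.exp (lam * s)) s := by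
    intro s
    have := ((hasDerivAt_id s).const_mul lam).exp
    refine this.congr_deriv ?_
    simp [mul_comm]
  have hd0 : ∀ s ∈ Ioc 0 T, HasDerivWithinAt w (iteratedDerivWithin 1 w (Ioc 0 T) s) (Ioc 0 T) s := by
    intro s hs
    have := hasDerivWithinAt_iteratedDerivWithin (p := 0) hu hw2 (by norm_num) hs
    rwa [iteratedDerivWithin_zero] at this
  have hd1 : ∀ s ∈ Ioc 0 T, HasDerivWithinAt (iteratedDerivWithin 1 w (Ioc 0 T))
      (iteratedDerivWithin 2 w (Ioc 0 T) s) (Ioc 0 T) s :=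
    fun s hs => hasDerivWithinAt_iteratedDerivWithin (p := 1) hu hw2 (by norm_num) hs
  have hd2 : ∀ s ∈ Ioc 0 T, HasDerivWithinAt (temperedDeriv lam T w)
      (Real.exp (lam * s) * (lam ^ 2 * w s + 2 * lam * iteratedDerivWithin 1 w (Ioc 0 T) s +
        iteratedDerivWithin 2 w (Ioc 0 T) s)) (Ioc 0 T) s := by
    intro s hs
    have := (hexp s).hasDerivWithinAt.mul (((hd0 s hs).const_mul lam).add (hd1 s hs))
    refine this.congr_deriv ?_
    simp only [Pi.add_apply]
    ring
  set A := T ^ (1 - α) with hA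
  set B := T ^ (2 - α) with hB
  have hA0 : 0 < A := Real.rpow_pos_of_pos hT _
  have hB0 : 0 < B := Real.rpow_pos_of_pos hT _
  set Λ := Real.exp (lam * T) with hΛ
  have hΛ0 : 0 < Λ := Real.exp_pos _
  have hexple : ∀ s ∈ Ioc 0 T, Real.exp (lam * s) ≤ Λ := fun s hs =>
    Real.exp_le_exp.2 (mul_le_mul_of_nonneg_left hs.2 hlam)
  have hAs : ∀ s ∈ Ioc 0 T, 1 ≤ A * s ^ (α - 1) := fun s hs => by
    have := one_le_rpow_mul_rpow (p := 1 - α) (by linarith) hs.1 hs.2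
    rwa [show -(1 - α) = α - 1 by ring] at this
  have hBs : ∀ s ∈ Ioc 0 T, 1 ≤ B * s ^ (α - 2) := fun s hs => by
    have := one_le_rpow_mul_rpow (p := 2 - α) (by linarith) hs.1 hs.2
    rwa [show -(2 - α) = α - 2 by ring] at this
  have hTs : ∀ s ∈ Ioc 0 T, s ^ (α - 1) ≤ T * s ^ (α - 2) := fun s hs => by
    have : s ^ (α - 1) = s * s ^ (α - 2) := by
      nth_rewrite 2 [← Real.rpow_one s]
      rw [← Real.rpow_add hs.1]; congr 1; ring
    rw [this]
    exact mul_le_mul_of_nonneg_right hs.2 (Real.rpow_nonneg hs.1.le _)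
  have hw1 : ∀ s ∈ Ioc 0 T, |iteratedDerivWithin 1 w (Ioc 0 T) s| ≤ C * (1 + s ^ (α - 1)) :=
    fun s hs => by simpa using hC s hs 1 (by norm_num)
  have hw2' : ∀ s ∈ Ioc 0 T, |iteratedDerivWithin 2 w (Ioc 0 T) s| ≤ C * (1 + s ^ (α - 2)) :=
    fun s hs => by simpa using hC s hs 2 le_rfl
  have hconst : C * temperingConst α lam T = Λ * C * (lam * A + A + 1) +
      Λ * C * (lam ^ 2 * B + 2 * lam * (B + T) + B + 1) := by
    unfold temperingConst; ring
  have hpart1 : 0 ≤ Λ * C * (lam * A + A + 1) := by positivity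
  have hpart2 : 0 ≤ Λ * C * (lam ^ 2 * B + 2 * lam * (B + T) + B + 1) := by positivity
  have hbound2 : ∀ s ∈ Ioc 0 T, |Real.exp (lam * s) * (lam ^ 2 * w s +
      2 * lam * iteratedDerivWithin 1 w (Ioc 0 T) s + iteratedDerivWithin 2 w (Ioc 0 T) s)| ≤
      C * temperingConst α lam T * s ^ (α - 2) := by
    intro s hs
    have hs2 : 0 ≤ s ^ (α - 2) := Real.rpow_nonneg hs.1.le _
    have h1 := hBs s hs
    have h2 := hTs s hs
    have e1 : |lam ^ 2 * w s + 2 * lam * iteratedDerivWithin 1 w (Ioc 0 T) s +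
        iteratedDerivWithin 2 w (Ioc 0 T) s| ≤
        lam ^ 2 * C + 2 * lam * (C * (1 + s ^ (α - 1))) + C * (1 + s ^ (α - 2)) := by
      refine (abs_add_le _ _).trans (add_le_add ((abs_add_le _ _).trans (add_le_add ?_ ?_))
        (hw2' s hs))
      · rw [abs_mul, abs_of_nonneg (sq_nonneg lam)]
        exact mul_le_mul_of_nonneg_left (hC0 s hs) (sq_nonneg _)
      · rw [abs_mul, abs_of_nonneg (by positivity : 0 ≤ 2 * lam)]
        exact mul_le_mul_of_nonneg_left (hw1 s hs) (by positivity)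
    have e2 : lam ^ 2 * C + 2 * lam * (C * (1 + s ^ (α - 1))) + C * (1 + s ^ (α - 2)) ≤
        C * (lam ^ 2 * B + 2 * lam * (B + T) + B + 1) * s ^ (α - 2) := by
      calc _ = C * (lam ^ 2 * 1 + 2 * lam * (1 + s ^ (α - 1)) + (1 + s ^ (α - 2))) := by ring
        _ ≤ C * (lam ^ 2 * (B * s ^ (α - 2)) + 2 * lam * (B * s ^ (α - 2) + T * s ^ (α - 2)) +
            (B * s ^ (α - 2) + s ^ (α - 2))) := by gcongr
        _ = _ := by ring
    rw [abs_mul, abs_of_pos (Real.exp_pos _)]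
    calc _ ≤ Λ * (C * (lam ^ 2 * B + 2 * lam * (B + T) + B + 1) * s ^ (α - 2)) :=
          mul_le_mul (hexple s hs) (e1.trans e2) (abs_nonneg _) hΛ0.le
      _ = Λ * C * (lam ^ 2 * B + 2 * lam * (B + T) + B + 1) * s ^ (α - 2) := by ring
      _ ≤ _ := by
        rw [hconst]
        exact mul_le_mul_of_nonneg_right (by linarith) hs2
  refine ⟨?_, ?_, ?_, ?_, ?_⟩
  · exact (by fun_prop : Continuous fun s : ℝ => Real.exp (lam * s)).continuousOn.mul hw
  · intro s hs
    have hs' : s ∈ Ioc 0 T := ⟨hs.1, hs.2.le⟩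
    have h1 := (hd0 s hs').hasDerivAt (Ioc_mem_nhds hs.1 hs.2)
    refine ((hexp s).mul h1).congr_deriv ?_
    unfold temperedDeriv
    ring
  · exact fun s hs => (hd2 s hs).continuousWithinAt
  · intro s hs
    have hs1 : 0 ≤ s ^ (α - 1) := Real.rpow_nonneg hs.1.le _
    have h1 := hAs s hs
    have e1 : |lam * w s + iteratedDerivWithin 1 w (Ioc 0 T) s| ≤
        lam * C + C * (1 + s ^ (α - 1)) := by
      refine (abs_add_le _ _).trans (add_le_add ?_ (hw1 s hs))
      rw [abs_mul, abs_of_nonneg hlam]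
      exact mul_le_mul_of_nonneg_left (hC0 s hs) hlam
    have e2 : lam * C + C * (1 + s ^ (α - 1)) ≤ C * (lam * A + A + 1) * s ^ (α - 1) := by
      calc _ = C * (lam * 1 + (1 + s ^ (α - 1))) := by ring
        _ ≤ C * (lam * (A * s ^ (α - 1)) + (A * s ^ (α - 1) + s ^ (α - 1))) := by gcongr
        _ = _ := by ring
    unfold temperedDeriv
    rw [abs_mul, abs_of_pos (Real.exp_pos _)]
    calc _ ≤ Λ * (C * (lam * A + A + 1) * s ^ (α - 1)) :=
          mul_le_mul (hexple s hs) (e1.trans e2) (abs_nonneg _) hΛ0.le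
      _ = Λ * C * (lam * A + A + 1) * s ^ (α - 1) := by ring
      _ ≤ _ := by
        rw [hconst]
        exact mul_le_mul_of_nonneg_right (by linarith) hs1
  -- The mean value inequality on `[a, b]`, using that the bound for the second derivative decreases
  -- in `s` and is therefore largest at `a`.
  · intro a b ha hab hbT
    have hsub : Icc a b ⊆ Ioc 0 T := fun s hs => ⟨ha.trans_le hs.1, hs.2.trans hbT⟩
    have := (convex_Icc a b).norm_image_sub_le_of_norm_hasDerivWithin_le
      (C := C * temperingConst α lam T * a ^ (α - 2))
      (fun s hs => (hd2 s (hsub hs)).mono hsub)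
      (fun s hs => (hbound2 s (hsub hs)).trans (mul_le_mul_of_nonneg_left
        (Real.rpow_le_rpow_of_nonpos ha hs.1 (by linarith)) (by rw [hconst]; positivity)))
      (left_mem_Icc.2 hab) (right_mem_Icc.2 hab)
    rwa [Real.norm_eq_abs, Real.norm_eq_abs, abs_of_nonneg (by linarith : 0 ≤ b - a)] at this

lemma temperedCaputo_eq {u' : ℝ → ℝ} (h : HasWeakSingularity α T C
    (fun s => Real.exp (lam * s) * w s) u') {τ : ℝ} (hτ : τ ∈ Ioc 0 T) :
    temperedCaputo α lam w τ = Real.exp (-lam * τ) / Real.Gamma (1 - α) *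
      ∫ s in (0 : ℝ)..τ, (τ - s) ^ (-α) * u' s := by
  unfold temperedCaputo
  congr 1
  refine intervalIntegral.integral_congr_ae ?_
  rw [uIoc_of_le hτ.1.le]
  filter_upwards [HasWeakSingularity.ae_mem_Ioo τ] with s hs hs'
  have := hs hs'
  rw [(h.hasDerivAt s ⟨this.1, this.2.trans_le hτ.2⟩).deriv]

lemma HasWeakSingularity.mono {u u' : ℝ → ℝ} (h : HasWeakSingularity α T C u u') {τ : ℝ}
    (hτ : τ ≤ T) : HasWeakSingularity α τ C u u' where
  continuousOn := h.continuousOn.mono (Icc_subset_Icc_right hτ)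
  hasDerivAt s hs := h.hasDerivAt s ⟨hs.1, hs.2.trans_le hτ⟩
  continuousOn_deriv := h.continuousOn_deriv.mono (Ioc_subset_Ioc_right hτ)
  deriv_le s hs := h.deriv_le s ⟨hs.1, hs.2.trans hτ⟩
  deriv_sub_le a b ha hab hb := h.deriv_sub_le a b ha hab (hb.trans hτ)

/-- The tempered L1 formula approximates the tempered Caputo derivative. -/
lemma abs_temperedCaputo_sub_temperedL1_le {u' : ℝ → ℝ} {γ : ℝ} {M n : ℕ} (hα₀ : 0 < α)
    (hα₁ : α < 1) (hT : 0 < T) (hγ : 1 ≤ γ) (hM : 1 ≤ M) (hn : 1 ≤ n) (hnM : n ≤ M)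
    (h : HasWeakSingularity α T C (fun s => Real.exp (lam * s) * w s) u') :
    |temperedCaputo α lam w (timeLevel T γ M n) -
      temperedL1 α lam T γ M (fun k => w (timeLevel T γ M k)) n| ≤
      Real.exp (-lam * timeLevel T γ M n) / Real.Gamma (1 - α) *
        (truncationConst α T γ * C *
          (timeLevel T γ M n ^ (-α) * (M : ℝ) ^ (-min (γ * α) (2 - α)))) := by
  have hΓ : 0 < Real.Gamma (1 - α) := Real.Gamma_pos_of_pos (by linarith)
  rw [temperedCaputo_eq h ⟨timeLevel_pos hT hM hn, timeLevel_le hT hγ hM hnM⟩]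
  unfold temperedL1
  rw [← mul_sub, abs_mul, abs_of_pos (by positivity)]
  exact mul_le_mul_of_nonneg_left (h.abs_truncation_error_le hα₀ hα₁ hT hγ hM hn hnM)
    (by positivity)

end Consistency

/-! ### The equation at the boundary -/

section Boundary

variable {α lam σ q T xl xr : ℝ} {g : ℝ → ℝ → ℝ} {v₀ : ℝ → ℝ} {v : ℝ → ℝ → ℝ} {C : ℝ}

lemma abs_sub_le_of_abs_deriv_le {f : ℝ → ℝ} (hx : xl < xr) (hf : ContDiffOn ℝ 6 f (Icc xl xr))
    (hC : ∀ x ∈ Icc xl xr, |iteratedDerivWithin 1 f (Icc xl xr) x| ≤ C) {x y : ℝ}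
    (hxs : x ∈ Icc xl xr) (hys : y ∈ Icc xl xr) : |f y - f x| ≤ C * |y - x| :=
  (convex_Icc xl xr).norm_image_sub_le_of_norm_hasDerivWithin_le
    (fun z hz => by
      have := hasDerivWithinAt_iteratedDerivWithin (p := 0) (uniqueDiffOn_Icc hx) hf (by norm_num) hz
      rwa [iteratedDerivWithin_zero] at this) hC hxs hys

/-- The time trace of the solution at a lateral boundary point is the limit of the interior ones. -/
lemma tendsto_time_trace {ξ : ℝ} (hx : xl < xr) (hT : 0 < T) (hξ : ξ ∈ Icc xl xr)
    (hsmooth : ∀ τ ∈ Ioc 0 T, ContDiffOn ℝ 6 (fun x => v x τ) (Icc xl xr))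
    (hcont : ∀ x ∈ Icc xl xr, ContinuousOn (v x) (Icc 0 T))
    (hC : ∀ x ∈ Icc xl xr, ∀ τ ∈ Ioc 0 T,
      |iteratedDerivWithin 1 (fun y => v y τ) (Icc xl xr) x| ≤ C)
    {s : ℝ} (hs : s ∈ Icc 0 T) :
    Filter.Tendsto (fun x => v x s) (nhdsWithin ξ (Icc xl xr)) (nhds (v ξ s)) := by
  have hlip : ∀ x ∈ Icc xl xr, |v x s - v ξ s| ≤ C * |x - ξ| := by
    intro x hxs
    -- The Lipschitz bound in space is uniform over positive times, so continuity in time extends it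
    -- to `s = 0`, where no space regularity is assumed.
    have hcl : s ∈ closure (Ioc 0 T) := by rw [closure_Ioc hT.ne]; exact hs
    have hd : ContinuousWithinAt (fun s => |v x s - v ξ s|) (Ioc 0 T) s :=
      ((((hcont x hxs).sub (hcont ξ hξ)).abs) s hs).mono Ioc_subset_Icc_self
    exact closure_minimal (s := (fun s => |v x s - v ξ s|) '' Ioc 0 T)
      (t := Iic (C * |x - ξ|)) (by
        rintro _ ⟨τ, hτ, rfl⟩
        exact abs_sub_le_of_abs_deriv_le hx (hsmooth τ hτ) (fun y hy => hC y hy τ hτ) hξ hxs)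
      isClosed_Iic (hd.mem_closure_image hcl)
  have h0 : Filter.Tendsto (fun x => C * |x - ξ|) (nhdsWithin ξ (Icc xl xr)) (nhds 0) := by
    have : Continuous fun x => C * |x - ξ| := by fun_prop
    have := this.tendsto ξ
    simp only [sub_self, abs_zero, mul_zero] at this
    exact this.mono_left nhdsWithin_le_nhds
  rw [tendsto_iff_dist_tendsto_zero]
  refine squeeze_zero' (Filter.Eventually.of_forall fun _ => dist_nonneg) ?_ h0
  filter_upwards [self_mem_nhdsWithin] with x hxs
  rw [Real.dist_eq]
  exact hlip x hxs

/-- At a lateral boundary point the source balances the second space derivative. -/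
lemma boundary_equation {ξ : ℝ} (hα₀ : 0 < α) (hα₁ : α < 1) (hx : xl < xr)
    (hξ : ξ ∈ Icc xl xr)
    (hsmooth : ∀ τ ∈ Ioc 0 T, ContDiffOn ℝ 6 (fun x => v x τ) (Icc xl xr))
    (hg : ∀ τ ∈ Ioc 0 T, ContinuousOn (fun x => g x τ) (Icc xl xr))
    (heq : ∀ x ∈ Ioo xl xr, ∀ τ ∈ Ioc 0 T, temperedCaputo α lam (v x) τ =
      σ ^ 2 / 2 * iteratedDerivWithin 2 (fun y => v y τ) (Icc xl xr) x - q * v x τ + g x τ)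
    (htrace : ∀ s ∈ Icc 0 T,
      Filter.Tendsto (fun x => v x s) (nhdsWithin ξ (Icc xl xr)) (nhds 0))
    {u' : ℝ → ℝ → ℝ} (hws : ∀ x ∈ Icc xl xr,
      HasWeakSingularity α T C (fun s => Real.exp (lam * s) * v x s) (u' x))
    {τ : ℝ} (hτ : τ ∈ Ioc 0 T) :
    σ ^ 2 / 2 * iteratedDerivWithin 2 (fun y => v y τ) (Icc xl xr) ξ - q * v ξ τ + g ξ τ = 0 := by
  set G : ℝ → ℝ := fun x =>
    σ ^ 2 / 2 * iteratedDerivWithin 2 (fun y => v y τ) (Icc xl xr) x - q * v x τ + g x τ with hG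
  have hGc : ContinuousOn G (Icc xl xr) :=
    (((hsmooth τ hτ).continuousOn_iteratedDerivWithin (by norm_num) (uniqueDiffOn_Icc hx)).const_mul
      _ |>.sub ((hsmooth τ hτ).continuousOn.const_mul q)).add (hg τ hτ)
  have hne : (nhdsWithin ξ (Ioo xl xr)).NeBot := by
    rw [← mem_closure_iff_nhdsWithin_neBot, closure_Ioo hx.ne]
    exact hξ
  have hle : nhdsWithin ξ (Ioo xl xr) ≤ nhdsWithin ξ (Icc xl xr) :=
    nhdsWithin_mono _ Ioo_subset_Icc_self
  have hGt : Filter.Tendsto (fun x => |G x|) (nhdsWithin ξ (Ioo xl xr)) (nhds |G ξ|) :=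
    ((hGc ξ hξ).tendsto.mono_left hle).abs
  set c := Real.exp (-lam * τ) / Real.Gamma (1 - α) * (truncationConst α τ 1 * C * τ ^ (-α)) with hc
  have hmin : min (1 * α) (2 - α) = α := by
    rw [one_mul]; exact min_eq_left (by linarith)
  -- An auxiliary uniform mesh (`γ = 1`) with `k` steps on `[0, τ]` replaces the nonlocal derivative
  -- by a finite sum, with error `c k^{-α}` uniform in `x`. For fixed `k` the finite sum tends to
  -- zero as `x → ξ`; letting `k → ∞` afterwards leaves `G ξ = 0`.
  have hk : ∀ k : ℕ, 1 ≤ k → |G ξ| ≤ c * (k : ℝ) ^ (-α) := by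
    intro k hk
    set S : ℝ → ℝ := fun x => temperedL1 α lam τ 1 k (fun j => v x (timeLevel τ 1 k j)) k with hS
    have hSt : Filter.Tendsto S (nhdsWithin ξ (Ioo xl xr)) (nhds 0) := by
      have h1 : ∀ j ≤ k, Filter.Tendsto (fun x => v x (timeLevel τ 1 k j))
          (nhdsWithin ξ (Ioo xl xr)) (nhds 0) := fun j hj =>
        (htrace _ ⟨timeLevel_nonneg hτ.1 j,
          (timeLevel_le hτ.1 le_rfl hk hj).trans hτ.2⟩).mono_left hle
      have h2 := (tendsto_finsetSum (Finset.Icc 1 k) (fun j hj =>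
        (((h1 j (Finset.mem_Icc.1 hj).2).const_mul (Real.exp (lam * timeLevel τ 1 k j))).sub
          ((h1 (j - 1) ((Nat.sub_le j 1).trans (Finset.mem_Icc.1 hj).2)).const_mul
            (Real.exp (lam * timeLevel τ 1 k (j - 1))))).const_mul
              (l1Coeff α τ 1 k k j))).const_mul
        (Real.exp (-lam * timeLevel τ 1 k k) / Real.Gamma (1 - α))
      simp only [mul_zero, sub_self, Finset.sum_const_zero] at h2
      exact h2
    have hlim : Filter.Tendsto (fun x => c * (k : ℝ) ^ (-α) + |S x|) (nhdsWithin ξ (Ioo xl xr))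
        (nhds (c * (k : ℝ) ^ (-α))) := by
      have := hSt.abs.const_add (c * (k : ℝ) ^ (-α))
      rwa [abs_zero, add_zero] at this
    refine le_of_tendsto_of_tendsto hGt hlim ?_
    filter_upwards [self_mem_nhdsWithin] with x hxs
    have h1 := abs_temperedCaputo_sub_temperedL1_le (γ := 1) hα₀ hα₁ hτ.1 le_rfl hk hk le_rfl
      ((hws x (Ioo_subset_Icc_self hxs)).mono hτ.2)
    rw [timeLevel_self τ 1 hk, hmin, heq x hxs τ hτ] at h1
    have h2 : |G x| ≤ |G x - S x| + |S x| := by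
      have := abs_add_le (G x - S x) (S x)
      rwa [sub_add_cancel] at this
    have h3 : Real.exp (-lam * τ) / Real.Gamma (1 - α) *
        (truncationConst α τ 1 * C * (τ ^ (-α) * (k : ℝ) ^ (-α))) = c * (k : ℝ) ^ (-α) := by
      rw [hc]; ring
    rw [h3] at h1
    exact h2.trans (add_le_add h1 le_rfl)
  have hlim0 : Filter.Tendsto (fun k : ℕ => c * (k : ℝ) ^ (-α)) Filter.atTop (nhds 0) := by
    have := ((tendsto_rpow_neg_atTop hα₀).comp tendsto_natCast_atTop_atTop).const_mul c
    rwa [mul_zero] at this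
  have : |G ξ| ≤ 0 := ge_of_tendsto hlim0 (by
    filter_upwards [Filter.eventually_ge_atTop 1] with k hk1 using hk k hk1)
  exact abs_nonpos_iff.1 this

end Boundary

/-! ### Convergence -/

lemma compactOp_eq {h : ℝ} (hh : h ≠ 0) {N i : ℕ} (hi : 1 ≤ i) (hiN : i < N) (w : ℕ → ℝ) :
    compactOp h N w i = 5 / 6 * w i + 1 / 12 * (w (i + 1) + w (i - 1)) := by
  unfold compactOp secondDiff
  rw [if_neg (by omega)]
  field_simp
  ring

lemma sum_tempered_difference_eq {α lam T γ : ℝ} {M : ℕ} (V W : ℕ → ℝ) (n : ℕ) :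
    ∑ k ∈ Finset.Icc 1 n, l1Coeff α T γ M n k / Real.Gamma (1 - α) *
        (Real.exp (lam * timeLevel T γ M k) * (V k - W k) -
          Real.exp (lam * timeLevel T γ M (k - 1)) * (V (k - 1) - W (k - 1))) =
      Real.exp (lam * timeLevel T γ M n) *
        (temperedL1 α lam T γ M V n - temperedL1 α lam T γ M W n) := by
  have he : Real.exp (lam * timeLevel T γ M n) *
      (Real.exp (-lam * timeLevel T γ M n) / Real.Gamma (1 - α)) = 1 / Real.Gamma (1 - α) := by
    rw [neg_mul, Real.exp_neg, mul_div_assoc', mul_inv_cancel₀ (Real.exp_pos _).ne']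
  unfold temperedL1
  rw [← mul_sub, ← mul_assoc, he, ← Finset.sum_sub_distrib, Finset.mul_sum]
  exact Finset.sum_congr rfl fun k _ => by ring

end

theorem theorem2 (α lam σ q T xl xr γ : ℝ) (hα₀ : 0 < α) (hα₁ : α < 1) (hlam : 0 ≤ lam)
    (hσ : 0 < σ) (hq : 0 < q) (hT : 0 < T) (hx : xl < xr) (hγ : 1 ≤ γ)
    (g : ℝ → ℝ → ℝ) (v₀ : ℝ → ℝ) (v : ℝ → ℝ → ℝ)
    (hg : ∀ τ ∈ Set.Ioc 0 T, ContinuousOn (fun x => g x τ) (Set.Icc xl xr))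
    (hv : IsTemperedSolution α lam σ q T xl xr g v₀ v)
    (hreg : RegularityBounds α T xl xr v) :
    ∃ c₂ : ℝ, 0 < c₂ ∧ ∀ M N : ℕ, 1 ≤ M → 1 ≤ N → ∀ w : ℕ → ℕ → ℝ,
      IsDirectSchemeSolution α lam σ q T xl xr γ g v₀ M N w →
      ∀ n ≤ M, ∀ i ≤ N,
        |v (gridNode xl xr N i) (timeLevel T γ M n) - w i n| ≤
          Real.Gamma (1 - α) * c₂ *
            ((M : ℝ) ^ (-min (γ * α) (2 - α)) + gridSize xl xr N ^ 4) := by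
  obtain ⟨C, hC⟩ := hreg.bounds
  have hxl : xl ∈ Icc xl xr := left_mem_Icc.2 hx.le
  have hxr : xr ∈ Icc xl xr := right_mem_Icc.2 hx.le
  have hC0 : 0 ≤ C :=
    (abs_nonneg _).trans ((hC xl hxl T ⟨hT, le_rfl⟩).1 0 (by norm_num))
  have hΓ : 0 < Real.Gamma (1 - α) := Real.Gamma_pos_of_pos (by linarith)
  set C₁ := C * temperingConst α lam T with hC₁
  have hws : ∀ x ∈ Icc xl xr, HasWeakSingularity α T C₁ (fun s => Real.exp (lam * s) * v x s)
      (temperedDeriv lam T (v x)) := fun x hxs =>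
    hasWeakSingularity_tempered hα₁ hlam hT (hv.continuous_time x hxs) (hreg.smooth_time x hxs)
      (fun s hs => by simpa using (hC x hxs s hs).1 0 (by norm_num))
      (fun s hs => (hC x hxs s hs).2.2)
  have hC₁0 : 0 ≤ C₁ := (hws xl hxl).const_nonneg hT
  set X : ℝ → ℝ → ℝ := fun τ => iteratedDerivWithin 2 (fun y => v y τ) (Icc xl xr) with hX
  have heq : ∀ x ∈ Ioo xl xr, ∀ τ ∈ Ioc 0 T, temperedCaputo α lam (v x) τ =
      σ ^ 2 / 2 * X τ x - q * v x τ + g x τ := by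
    intro x hxs τ hτ
    have hnhds : Icc xl xr ∈ nhds x := Icc_mem_nhds hxs.1 hxs.2
    rw [hv.equation x hxs τ hτ, hX]
    simp only
    rw [iteratedDerivWithin_eq_iteratedDeriv (uniqueDiffOn_Icc hx)
      (((hreg.smooth_space τ hτ).contDiffAt hnhds).of_le (by norm_num)) (Ioo_subset_Icc_self hxs)]
  have htr : ∀ ξ ∈ Icc xl xr, ∀ s ∈ Icc 0 T,
      Filter.Tendsto (fun x => v x s) (nhdsWithin ξ (Icc xl xr)) (nhds (v ξ s)) := fun ξ hξ s hs =>
    tendsto_time_trace hx hT hξ hreg.smooth_space hv.continuous_time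
      (fun x hxs τ hτ => (hC x hxs τ hτ).1 1 (by norm_num)) hs
  have hzero : ∀ ξ ∈ Icc xl xr, (∀ τ ∈ Ioc 0 T, v ξ τ = 0) → ∀ s ∈ Icc 0 T, v ξ s = 0 := by
    intro ξ hξ h0 s hs
    have hcl : s ∈ closure (Ioc 0 T) := by rw [closure_Ioc hT.ne]; exact hs
    have hd := ((hv.continuous_time ξ hξ) s hs).mono (Ioc_subset_Icc_self (a := 0) (b := T))
    have := closure_minimal (s := v ξ '' Ioc 0 T) (t := {0}) (by
      rintro _ ⟨τ, hτ, rfl⟩; exact h0 τ hτ) isClosed_singleton (hd.mem_closure_image hcl)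
    exact this
  have hzl := hzero xl hxl hv.boundary_left
  have hzr := hzero xr hxr hv.boundary_right
  have hbl : ∀ τ ∈ Ioc 0 T, σ ^ 2 / 2 * X τ xl - q * v xl τ + g xl τ = 0 := fun τ hτ =>
    boundary_equation hα₀ hα₁ hx hxl hreg.smooth_space hg heq
      (fun s hs => by have := htr xl hxl s hs; rwa [hzl s hs] at this) hws hτ
  have hbr : ∀ τ ∈ Ioc 0 T, σ ^ 2 / 2 * X τ xr - q * v xr τ + g xr τ = 0 := fun τ hτ =>
    boundary_equation hα₀ hα₁ hx hxr hreg.smooth_space hg heq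
      (fun s hs => by have := htr xr hxr s hs; rwa [hzr s hs] at this) hws hτ
  set K := truncationConst α T γ * C₁ with hK
  have hK0 : 0 ≤ K := mul_nonneg (truncationConst_pos hα₀ hα₁ hT).le hC₁0
  set Λ := Real.exp (lam * T) with hΛ
  have hΛ0 : 0 < Λ := Real.exp_pos _
  set κ := σ ^ 2 / 2 with hκ
  have hκ0 : 0 < κ := by positivity
  set K₂ := Λ * (3 * κ * C * (T ^ α + 1)) * Real.Gamma (1 - α) with hK₂
  have hTα : 0 < T ^ α := Real.rpow_pos_of_pos hT _
  have hK₂0 : 0 ≤ K₂ := by positivity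
  have hS := stabilityConst_pos
  -- The summand `1` only secures positivity. `K₂` contains `Γ(1-α)` because the spatial error is
  -- measured against weights that carry `1/Γ(1-α)`.
  refine ⟨(3 / 2 * stabilityConst * (K + K₂) + 1) / Real.Gamma (1 - α), by positivity, ?_⟩
  intro M N hM hN w hw n hn i hi
  rw [mul_div_cancel₀ _ hΓ.ne']
  set t := timeLevel T γ M with ht
  set h := gridSize xl xr N with hh
  set x := gridNode xl xr N with hxdef
  set m := min (γ * α) (2 - α) with hm
  have hM0 : (0 : ℝ) < M := by exact_mod_cast hM
  have hN0 : (0 : ℝ) < N := by exact_mod_cast hN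
  have hMm : 0 < (M : ℝ) ^ (-m) := Real.rpow_pos_of_pos hM0 _
  have hh0 : 0 < h := div_pos (by linarith) hN0
  have hx0 : x 0 = xl := by simp [hxdef, gridNode]
  have hxN : x N = xr := by
    simp only [hxdef, gridNode, gridSize]
    field_simp
    ring
  have hxstep : ∀ j, x (j + 1) = x j + h := fun j => by
    simp only [hxdef, gridNode]; push_cast; ring
  have hxlt : ∀ {j k : ℕ}, j < k → x j < x k := fun hjk => by
    simp only [hxdef, gridNode]
    gcongr
  have hxle : ∀ {j k : ℕ}, j ≤ k → x j ≤ x k := fun hjk => by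
    simp only [hxdef, gridNode]
    gcongr
  have hxmem : ∀ j ≤ N, x j ∈ Icc xl xr := fun j hj =>
    ⟨hx0 ▸ hxle (Nat.zero_le j), hxN ▸ hxle hj⟩
  have htmem : ∀ k ≤ M, t k ∈ Icc 0 T := fun k hk =>
    ⟨timeLevel_nonneg hT k, timeLevel_le hT hγ hM hk⟩
  have ht0 : t 0 = 0 := timeLevel_zero T hγ M
  set ρ := K * (M : ℝ) ^ (-m) + K₂ * h ^ 4 with hρ
  have hρ0 : 0 ≤ ρ := by positivity
  -- Needed for `j = 0` and `j = N` as well, since `H` at `i = 1` and `i = N - 1` reaches the end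
  -- points. There the L1 formula is zero and `hbl`, `hbr` cancel the rest.
  have hconsist : ∀ n, 1 ≤ n → n ≤ M → ∀ j ≤ N,
      Real.exp (lam * t n) * |temperedL1 α lam T γ M (fun k => v (x j) (t k)) n -
        (κ * X (t n) (x j) - q * v (x j) (t n) + g (x j) (t n))| ≤
        K / Real.Gamma (1 - α) * (t n ^ (-α) * (M : ℝ) ^ (-m)) := by
    intro n hn1 hnM j hj
    have htn : t n ∈ Ioc 0 T := ⟨timeLevel_pos hT hM hn1, (htmem n hnM).2⟩
    have htα : 0 < t n ^ (-α) := Real.rpow_pos_of_pos htn.1 _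
    have hbdry : (∀ s ∈ Icc 0 T, v (x j) s = 0) →
        κ * X (t n) (x j) - q * v (x j) (t n) + g (x j) (t n) = 0 →
        Real.exp (lam * t n) * |temperedL1 α lam T γ M (fun k => v (x j) (t k)) n -
        (κ * X (t n) (x j) - q * v (x j) (t n) + g (x j) (t n))| ≤
        K / Real.Gamma (1 - α) * (t n ^ (-α) * (M : ℝ) ^ (-m)) := by
      intro h0 h1
      have : temperedL1 α lam T γ M (fun k => v (x j) (t k)) n = 0 := by
        unfold temperedL1
        rw [Finset.sum_eq_zero, mul_zero]
        intro k hk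
        rw [Finset.mem_Icc] at hk
        simp only [h0 _ (htmem k (by omega)), h0 _ (htmem (k - 1) (by omega)), mul_zero, sub_self]
      rw [this, h1, sub_zero, abs_zero, mul_zero]
      positivity
    rcases Nat.eq_zero_or_pos j with rfl | hj1
    · exact hbdry (by rw [hx0]; exact hzl) (by rw [hx0]; exact hbl _ htn)
    rcases hj.eq_or_lt with rfl | hjN
    · exact hbdry (by rw [hxN]; exact hzr) (by rw [hxN]; exact hbr _ htn)
    have hxj : x j ∈ Ioo xl xr := ⟨hx0 ▸ hxlt hj1, hxN ▸ hxlt hjN⟩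
    have h1 := abs_temperedCaputo_sub_temperedL1_le hα₀ hα₁ hT hγ hM hn1 hnM (hws _ (hxmem j hj))
    rw [abs_sub_comm, heq _ hxj _ htn, ← ht, ← hm, ← hK] at h1
    refine (mul_le_mul_of_nonneg_left h1 (Real.exp_pos _).le).trans (le_of_eq ?_)
    rw [neg_mul, Real.exp_neg]
    have := (Real.exp_pos (lam * t n)).ne'
    field_simp
  have key := grid_compact_scheme_stability (M := M) hN (c := κ / h ^ 2) (ρ := ρ)
    (b := fun n k => l1Coeff α T γ M n k / Real.Gamma (1 - α))
    (e := fun i n => Real.exp (lam * t n) * (v (x i) (t n) - w i n)) hq (by positivity) hρ0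
    (fun n hn1 _ => by
      have h1 := timeLevel_rpow_neg_le_l1Coeff_one hα₀ hα₁ hT hγ hM hn1
      have h2 : 0 ≤ t n ^ (-α) := Real.rpow_nonneg (timeLevel_nonneg hT n) _
      exact div_nonneg (h2.trans h1) hΓ.le)
    (fun n _ k hk hkn => by
      have := l1Coeff_mono hα₀ hα₁ hT hγ hM hk hkn
      gcongr)
    (fun n hn => by rw [hx0, hzl _ (htmem n hn), hw.boundary_left n hn, sub_zero, mul_zero])
    (fun n hn => by rw [hxN, hzr _ (htmem n hn), hw.boundary_right n hn, sub_zero, mul_zero])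
    (fun i hi => by
      have h00 : (0 : ℝ) ∈ Icc 0 T := ⟨le_rfl, hT.le⟩
      rcases Nat.eq_zero_or_pos i with rfl | hi1
      · rw [ht0, hx0, hzl 0 h00, hw.boundary_left 0 (Nat.zero_le _), sub_zero, mul_zero]
      rcases hi.eq_or_lt with rfl | hiN
      · rw [ht0, hxN, hzr 0 h00, hw.boundary_right 0 (Nat.zero_le _), sub_zero, mul_zero]
      rw [ht0, hv.initial (x i) ⟨hx0 ▸ hxlt hi1, hxN ▸ hxlt hiN⟩, hw.initial i hi1 hiN, sub_self,
        mul_zero])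
    (fun i n hi1 hiN hn1 hnM => by
      have htn : t n ∈ Ioc 0 T := ⟨timeLevel_pos hT hM hn1, (htmem n hnM).2⟩
      have htα : 0 < t n ^ (-α) := Real.rpow_pos_of_pos htn.1 _
      have c0 := hconsist n hn1 hnM i hiN.le
      have c1 := hconsist n hn1 hnM (i + 1) hiN
      have c2 := hconsist n hn1 hnM (i - 1) (by omega)
      have hxi1 : x (i + 1) = x i + h := hxstep i
      have hxi2 : x (i - 1) = x i - h := by
        have := hxstep (i - 1)
        rw [Nat.sub_add_cancel hi1] at this
        linarith
      have hsp := abs_compact_truncation_le (a := xl) (b := xr) (x := x i)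
        (C := C * (1 + t n ^ (-α)))
        (f := fun p => iteratedDerivWithin p (fun y => v y (t n)) (Icc xl xr)) hh0
        (fun p hp y hy => hasDerivWithinAt_iteratedDerivWithin (uniqueDiffOn_Icc hx)
          (hreg.smooth_space _ htn) (by exact_mod_cast hp) hy)
        (fun y hy => (hC y hy _ htn).2.1) (hxmem i hiN.le)
        (hxi2 ▸ hxmem (i - 1) (by omega)) (hxi1 ▸ hxmem (i + 1) hiN)
      simp only [iteratedDerivWithin_zero] at hsp
      rw [← hxi1, ← hxi2] at hsp
      have hscheme := hw.equation i n hi1 hiN hn1 hnM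
      rw [compactOp_eq hh0.ne' hi1 hiN, compactOp_eq hh0.ne' hi1 hiN, compactOp_eq hh0.ne' hi1 hiN]
        at hscheme
      unfold secondDiff at hscheme
      have d0 := sum_tempered_difference_eq (lam := lam) (T := T) (γ := γ) (α := α) (M := M)
        (fun k => v (x i) (t k)) (w i) n
      have d1 := sum_tempered_difference_eq (lam := lam) (T := T) (γ := γ) (α := α) (M := M)
        (fun k => v (x (i + 1)) (t k)) (w (i + 1)) n
      have d2 := sum_tempered_difference_eq (lam := lam) (T := T) (γ := γ) (α := α) (M := M)
        (fun k => v (x (i - 1)) (t k)) (w (i - 1)) n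
      simp only [← ht] at d0 d1 d2
      rw [d0, d1, d2]
      set P := fun j => temperedL1 α lam T γ M (fun k => v (x j) (t k)) n -
        (κ * X (t n) (x j) - q * v (x j) (t n) + g (x j) (t n)) with hP
      set Sp := (v (x (i + 1)) (t n) - 2 * v (x i) (t n) + v (x (i - 1)) (t n)) / h ^ 2 -
        (5 / 6 * X (t n) (x i) + 1 / 12 * (X (t n) (x (i + 1)) + X (t n) (x (i - 1)))) with hSp
      have hEΛ : Real.exp (lam * t n) ≤ Λ :=
        Real.exp_le_exp.2 (mul_le_mul_of_nonneg_left htn.2 hlam)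
      set Et := Real.exp (lam * t n) with hEt
      have hEt0 : 0 < Et := Real.exp_pos _
      -- The residual is `H` applied to the time consistency error, minus `κ` times the spatial one,
      -- all scaled by `Et`; the scheme removes every term in `w`.
      have hident : 5 / 6 * (Et * (temperedL1 α lam T γ M (fun k => v (x i) (t k)) n -
            temperedL1 α lam T γ M (w i) n)) +
          1 / 12 * (Et * (temperedL1 α lam T γ M (fun k => v (x (i + 1)) (t k)) n -
            temperedL1 α lam T γ M (w (i + 1)) n) +
            Et * (temperedL1 α lam T γ M (fun k => v (x (i - 1)) (t k)) n -
            temperedL1 α lam T γ M (w (i - 1)) n)) +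
          q * (5 / 6 * (Et * (v (x i) (t n) - w i n)) +
            1 / 12 * (Et * (v (x (i + 1)) (t n) - w (i + 1) n) +
              Et * (v (x (i - 1)) (t n) - w (i - 1) n))) +
          κ / h ^ 2 * (2 * (Et * (v (x i) (t n) - w i n)) -
            Et * (v (x (i + 1)) (t n) - w (i + 1) n) -
            Et * (v (x (i - 1)) (t n) - w (i - 1) n)) =
          5 / 6 * (Et * P i) + 1 / 12 * (Et * P (i + 1) + Et * P (i - 1)) - Et * κ * Sp := by
        simp only [hP, hSp]
        linear_combination (-Et) * hscheme
      rw [hident]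
      set δ := K / Real.Gamma (1 - α) * (t n ^ (-α) * (M : ℝ) ^ (-m)) with hδ
      have a0 : |Et * P i| ≤ δ := by rw [abs_mul, abs_of_pos hEt0]; exact c0
      have a1 : |Et * P (i + 1)| ≤ δ := by rw [abs_mul, abs_of_pos hEt0]; exact c1
      have a2 : |Et * P (i - 1)| ≤ δ := by rw [abs_mul, abs_of_pos hEt0]; exact c2
      have a3 : |Et * κ * Sp| ≤ Λ * κ * (3 * (C * ((T ^ α + 1) * t n ^ (-α))) * h ^ 4) := by
        rw [abs_mul, abs_of_pos (by positivity : 0 < Et * κ)]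
        have h1 := one_le_rpow_mul_rpow hα₀.le htn.1 htn.2
        have h2 : 1 + t n ^ (-α) ≤ (T ^ α + 1) * t n ^ (-α) := by linarith
        have h3 : |Sp| ≤ 3 * (C * ((T ^ α + 1) * t n ^ (-α))) * h ^ 4 := hsp.trans (by gcongr)
        gcongr
      have hb : t n ^ (-α) ≤ l1Coeff α T γ M n 1 :=
        timeLevel_rpow_neg_le_l1Coeff_one hα₀ hα₁ hT hγ hM hn1
      have htot : δ + Λ * κ * (3 * (C * ((T ^ α + 1) * t n ^ (-α))) * h ^ 4) =
          ρ * (t n ^ (-α) / Real.Gamma (1 - α)) := by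
        rw [hδ, hρ, hK₂]
        field_simp
      calc _ ≤ δ + Λ * κ * (3 * (C * ((T ^ α + 1) * t n ^ (-α))) * h ^ 4) := by
            rw [abs_le] at a0 a1 a2 a3 ⊢
            constructor <;> linarith
        _ = ρ * (t n ^ (-α) / Real.Gamma (1 - α)) := htot
        _ ≤ _ := by gcongr) n hn i hi
  -- As `lam ≥ 0`, the exponential weight on the error is at least `1` and can be dropped.
  have hexp1 : 1 ≤ Real.exp (lam * t n) :=
    Real.one_le_exp (mul_nonneg hlam (htmem n hn).1)
  have h1 : |v (x i) (t n) - w i n| ≤ 3 / 2 * stabilityConst * ρ := by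
    refine le_trans ?_ key
    rw [abs_mul, abs_of_pos (Real.exp_pos _)]
    exact le_mul_of_one_le_left (abs_nonneg _) hexp1
  refine h1.trans ?_
  have hh4 : 0 < h ^ 4 := by positivity
  have e : (3 / 2 * stabilityConst * (K + K₂) + 1) * ((M : ℝ) ^ (-m) + h ^ 4) -
      3 / 2 * stabilityConst * ρ = 3 / 2 * stabilityConst * (K * h ^ 4 + K₂ * (M : ℝ) ^ (-m)) +
        ((M : ℝ) ^ (-m) + h ^ 4) := by
    rw [hρ]; ring
  have : 0 ≤ 3 / 2 * stabilityConst * (K * h ^ 4 + K₂ * (M : ℝ) ^ (-m)) +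
        ((M : ℝ) ^ (-m) + h ^ 4) := by positivity
  linarith
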